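/- **Language.** Types are $A,B::=\mathbf 1\mid\bot\mid A\otimes B\mid A\mathbin{\wp}B\mid\oplus_{\ell\in L}A_\ell\mid\&_{\ell\in L}A_\ell\mid\,!A\mid\,?A$ (where $\wp$ is par) with the usual duality $\overline{A}$; $\mathbf 1,\otimes,\oplus,!$ are positive, the others negative. Processes of $\mathsf{CLLB}$ (up to $\alpha$-conversion) are $$P,Q::=\mathbf 0\mid P\,\|\,Q\mid \mathsf{fwd}\,x\,y\mid \mathsf{cut}\{P\,|a{:}A[q]b{:}B|\,Q\}\mid \mathsf{pcut}\{P\,|a{:}A[q]b{:}B|\,Q\}\mid \mathsf{close}\,x\mid \mathsf{wait}\,x;P\mid \mathsf{case}\,x\{\ell{:}P_\ell\}_{\ell\in L}\mid \ell\,x;P$$ $$\mid \mathsf{send}\,x(z.P);Q\mid \mathsf{recv}\,x(z);P\mid\, !x(z);P\mid\, ?x;P\mid \mathsf{cut!}\{y.P\,|!x{:}A|\,Q\}\mid \mathsf{call}\,x(z);P .$$ In a buffered cut exactly one endpoint is the write endpoint (written $\bar x$); $a$ is bound in $P$, $b$ in $Q$; $q$ is a queue of values $\checkmark$, $\ell$,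 $\mathsf{clos}(z,P)$, $\mathsf{clos}_!(z,P)$; the type of a write endpoint is void ($\emptyset$) when its owner has terminated. $\mathsf{pcut}$ is a cut annotated as concurrent; the annotation does not affect typing rules, congruence or reduction, except that forwarders only connect two endpoints with the same annotation (names passed in messages and names introduced by exponentials are sequential). **Typing** $P\vdash^{\mathsf B}\Delta;\Gamma$ ($\Delta$ linear, $\Gamma$ unrestricted) is given by the rules of dyadic classical linear logic with mix (label sets of $\mathsf{case}$ non-empty), where the cut rule is $$\frac{P\vdash^{\mathsf B}\Delta',x{:}A;\Gamma\quad Q\vdash^{\mathsf B}\Delta,y{:}\overline A;\Gamma\quad A\text{ positive}}{\mathsf{cut}\{P\,|\bar x{:}A[\mathsf{nil}]y{:}\overline A|\,Q\}\vdash^{\mathsf B}\Delta',\Delta;\Gamma}$$ together with the rules that derive a judgement for $\mathsf{cut}\{P\,|\bar x{:}A'[q@v]y{:}B|\,Q\}$ from the same judgement for $\mathsf{cut}\{\alpha\,|\bar x{:}A[q]y{:}B|\,Q\}$, where $\alpha$ is a positive action on $x$ that writes $v$ and continues as $P$ with $x{:}A'$ ($\alpha=\mathsf{send}\,x(z.R);P$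 and $v=\mathsf{clos}(z,R)$; $\alpha=\ell\,x;P$ and $v=\ell$; $\alpha=\mathsf{close}\,x$, $v=\checkmark$, $P=\mathbf 0$, $A'=\emptyset$; $\alpha=\,!x(z);R$, $v=\mathsf{clos}_!(z,R)$, $P=\mathbf 0$, $A'=\emptyset$), and the mirror images of these rules. **Congruence and reduction.** $\equiv$ is the least congruence that contains $\alpha$-conversion, $\mathsf{fwd}\,x\,y\equiv\mathsf{fwd}\,y\,x$, symmetry of cuts, the commutative monoid laws of $(\|,\mathbf 0)$, the commutations of mix, linear cut and exponential cut with each other, the distribution of $\mathsf{cut!}$ over mix, linear cuts (including, where the bound unrestricted name occurs there, the closures in their queue) and exponential cuts, and the commutations of linear action prefixes with static constructs and with prefixes on other names; no name may escape or be captured. $\to$ is closed under $\equiv$ and under static contexts (mix, cut, the client side of $\mathsf{cut!}$). Its axioms let a positive action on a write endpoint append its value to the queue; let a negative action on a read endpoint remove the first value (a received closure is composed with the receiver by a new $\mathsf{cut}$ with empty queue; $?y$ creates a $\mathsf{cut!}$; $\mathsf{wait}$ removes the cut); merge the two cuts (with the same annotation) around a forwarder, $\mathsf{cut}\{Q|\bar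 z[q_1]x|\mathsf{cut}\{\mathsf{fwd}\,x\,y|\bar y[q_2]w|P\}\}\to\mathsf{cut}\{Q|\bar z[q_2@q_1]w|P\}$; and let $\mathsf{cut!}\{y.P|!x{:}A|\mathsf{call}\,x(z);Q\}\to\mathsf{cut}\{P|y{:}A[\mathsf{nil}]z{:}\overline A|\mathsf{cut!}\{y.P|!x{:}A|Q\}\}$. In new cuts, and whenever a read empties the queue, the endpoint of positive type becomes the write endpoint. **Machine.** A state consists of a multiset of threads (processes), a heap of sequential records $x{:}A\langle q,R\rangle y{:}B$ (write endpoint $x$, read endpoint $y$, $R$ the suspended owner of one of them) and concurrent records $x{:}A\langle q\rangle y{:}B$, and an environment that binds unrestricted names to exponential closures. All names in the heap and the environment are distinct; new names are fresh. In a transition $S\Mapsto D$ one thread performs one step. On a sequential record: a positive action on $x$ appends its value to $q$ and the thread continues, except that after $\mathsf{close}$ and $!$ the suspended process $R$ runs and is replaced by $\mathbf 0$; a negative action on $y$ reads the first value and, if $q$ becomes empty, the endpoints are swapped; a negative action (including a forwarder) on a write endpoint $x$ of negative type is suspended and $R$ runs; $\mathsf{fwd}\,x\,y$ replaces records $z\langle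 q_1,Q\rangle x$ and $y\langle q_2,P\rangle w$ by $z\langle q_2@q_1,Q\rangle w$ and $P$ runs. On concurrent records the same actions are atomic and never switch context: a thread that terminates on a session becomes $\mathbf 0$, $\mathsf{fwd}\,x\,y$ merges $z\langle q_1\rangle x$ and $y\langle q_2\rangle w$ into $z\langle q_2@q_1\rangle w$ and becomes $\mathbf 0$, and after a read that empties the queue the endpoints are swapped unless the type of the write endpoint is positive. A received closure, or the closure bound to a called name, becomes the peer of the running thread in a new sequential record with empty queue; the process whose endpoint has positive type runs and the other is suspended. $?y$ binds $y$ in the environment. A $\mathsf{cut}$ with empty queue allocates a sequential record and runs the writer; $\mathsf{pcut}$ allocates a concurrent record and forks both sides; mix forks; $\mathsf{cut!}$ extends the environment; a thread $\mathbf 0$ is dropped. **Encoding.** $D\stackrel{\mathsf{cut}*}{\Mapsto}C$ holds if $C$ is obtained from $D$ by executing static constructs until all threads are actions: threads $\mathbf 0$ are dropped, mixes are split, $\mathsf{cut!}$ adds its closure to the environment, $\mathsf{pcut}\{P|\bar x{:}A[q]y{:}B|Q\}$ adds $x{:}A\langle q\rangle y{:}B$ and the threads $P,Q$, and $\mathsf{cut}\{P|\bar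 x{:}A[q]y{:}B|Q\}$ either adds the record $x{:}A\langle q,Q\rangle y{:}B$ and the thread $P$ (allowed if $A$ is not void), or adds $x{:}A\langle q,P\rangle y{:}B$ and the thread $Q$ (allowed if $A$ is negative or $P=\mathbf 0$). We write $C=enc^c(P)$, and say that $C$ is an encoding of $P$, if $(\{P\},\emptyset,\emptyset)\stackrel{\mathsf{cut}*}{\Mapsto}C$. **Theorem (Soundness-c).** Let $P\vdash^{\mathsf B}\emptyset;\emptyset$. If $enc^c(P)\Mapsto D\stackrel{\mathsf{cut}*}{\Mapsto}C$, i.e. if $S\Mapsto D\stackrel{\mathsf{cut}*}{\Mapsto}C$ for some encoding $S$ of $P$, then there is $Q$ such that $P\to Q$ or $P\equiv Q$, and $C=enc^c(Q)$, i.e. $C$ is an encoding of $Q$. -/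

import Mathlib

namespace CLLB

/-! ### Types -/

/-- Channel names; they also serve as heap references of the machine. -/
abbrev Name := ℕ

/-- Choice labels. -/
abbrev Label := ℕ

/-- Session types of classical linear logic, with labelled additives. -/
inductive Ty : Type
  | one : Ty
  | bot : Ty
  | tensor (A B : Ty) : Ty
  | parr (A B : Ty) : Ty
  | plus (L : Finset Label) (A : L → Ty) : Ty
  | amp (L : Finset Label) (A : L → Ty) : Ty
  | bang (A : Ty) : Ty
  | whynot (A : Ty) : Ty

namespace Ty

/-- Duality. -/
def dual : Ty → Ty
  | one => bot
  | bot => one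
  | tensor A B => parr A.dual B.dual
  | parr A B => tensor A.dual B.dual
  | plus L A => amp L (fun l => (A l).dual)
  | amp L A => plus L (fun l => (A l).dual)
  | bang A => whynot A.dual
  | whynot A => bang A.dual

/-- The positive types are `1`, `⊗`, `⊕` and `!`; the other types are negative. -/
def Pos : Ty → Prop
  | one => True
  | tensor _ _ => True
  | plus _ _ => True
  | bang _ => True
  | _ => False

end Ty

/-- The type of an endpoint of a buffered session: `none` is the void type `∅`, carried by a
write endpoint whose owner has terminated. -/
abbrev EndTy := Option Ty

/-- The endpoint type is a (non-void) positive type. -/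
def EndTy.Pos (A : EndTy) : Prop := ∃ T : Ty, A = some T ∧ T.Pos

/-- The endpoint type is a (non-void) negative type. -/
def EndTy.Neg (A : EndTy) : Prop := ∃ T : Ty, A = some T ∧ ¬ T.Pos

/-! ### Terms -/

/-- Annotation of a session: `seq` for `cut`, `conc` for `pcut`. -/
inductive Mode : Type
  | seq : Mode
  | conc : Mode

/-- Which of the two endpoints of a buffered cut is the write endpoint. -/
inductive Side : Type
  | left : Side
  | right : Side

def Side.flip : Side → Side
  | left => right
  | right => left

mutual
/-- Processes with buffered cuts. `cut m s a A q b B P Q` is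
`cut {P |a:A [q] b:B| Q}` (`pcut` if `m` is `conc`), with the write endpoint on side `s`;
`a` is bound in `P`, `b` is bound in `Q`, and nothing is bound in the queue `q`, whose head is the
next value to be read. -/
inductive Proc : Type
  | nil : Proc
  | mix (P Q : Proc) : Proc
  | fwd (x y : Name) : Proc
  | cut (m : Mode) (s : Side) (a : Name) (A : EndTy) (q : List Val) (b : Name) (B : EndTy)
      (P Q : Proc) : Proc
  | close (x : Name) : Proc
  | wait (x : Name) (P : Proc) : Proc
  | case (x : Name) (L : Finset Label) (P : L → Proc) : Proc
  | sel (x : Name) (l : Label) (P : Proc) : Proc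
  /-- `send x(z.P);Q`, with `z` bound in `P` -/
  | send (x z : Name) (P Q : Proc) : Proc
  /-- `recv x(z);P`, with `z` bound in `P` -/
  | recv (x z : Name) (P : Proc) : Proc
  /-- `!x(z);P`, with `z` bound in `P` -/
  | bang (x z : Name) (P : Proc) : Proc
  /-- `?x;P` -/
  | why (x : Name) (P : Proc) : Proc
  /-- `cut! {y.P |!x:A| Q}`, with `y:A` bound in `P` and `x` bound in `Q` -/
  | cutB (x : Name) (A : Ty) (y : Name) (P Q : Proc) : Proc
  /-- `call x(z);P`, with `z` bound in `P` -/
  | call (x z : Name) (P : Proc) : Proc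
/-- Queue values: close token, label, linear closure, exponential closure. -/
inductive Val : Type
  | tick : Val
  | lab (l : Label) : Val
  | clos (z : Name) (P : Proc) : Val
  | closB (z : Name) (P : Proc) : Val
end

abbrev Queue := List Val

mutual
/-- Free names of a process. -/
def Proc.fn : Proc → Set Name
  | .nil => ∅
  | .mix P Q => P.fn ∪ Q.fn
  | .fwd x y => {x, y}
  | .cut _ _ a _ q b _ P Q => (P.fn \ {a}) ∪ Queue.fn q ∪ (Q.fn \ {b})
  | .close x => {x}
  | .wait x P => {x} ∪ P.fn
  | .case x _ P => {x} ∪ ⋃ l, (P l).fn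
  | .sel x _ P => {x} ∪ P.fn
  | .send x z P Q => {x} ∪ (P.fn \ {z}) ∪ Q.fn
  | .recv x z P => {x} ∪ (P.fn \ {z})
  | .bang x z P => {x} ∪ (P.fn \ {z})
  | .why x P => {x} ∪ P.fn
  | .cutB x _ y P Q => (P.fn \ {y}) ∪ (Q.fn \ {x})
  | .call x z P => {x} ∪ (P.fn \ {z})
/-- Free names of a queue value. -/
def Val.fn : Val → Set Name
  | .tick => ∅
  | .lab _ => ∅
  | .clos z P => P.fn \ {z}
  | .closB z P => P.fn \ {z}
/-- Free names of a queue. -/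
def Queue.fn : List Val → Set Name
  | [] => ∅
  | v :: q => v.fn ∪ Queue.fn q
end

mutual
/-- Action of a permutation of names on all names (free, bound and binding) of a process. -/
def Proc.perm (π : Equiv.Perm Name) : Proc → Proc
  | .nil => .nil
  | .mix P Q => .mix (P.perm π) (Q.perm π)
  | .fwd x y => .fwd (π x) (π y)
  | .cut m s a A q b B P Q => .cut m s (π a) A (Queue.perm π q) (π b) B (P.perm π) (Q.perm π)
  | .close x => .close (π x)
  | .wait x P => .wait (π x) (P.perm π)
  | .case x L P => .case (π x) L (fun l => (P l).perm π)
  | .sel x l P => .sel (π x) l (P.perm π)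
  | .send x z P Q => .send (π x) (π z) (P.perm π) (Q.perm π)
  | .recv x z P => .recv (π x) (π z) (P.perm π)
  | .bang x z P => .bang (π x) (π z) (P.perm π)
  | .why x P => .why (π x) (P.perm π)
  | .cutB x A y P Q => .cutB (π x) A (π y) (P.perm π) (Q.perm π)
  | .call x z P => .call (π x) (π z) (P.perm π)
/-- Action of a permutation of names on a queue value. -/
def Val.perm (π : Equiv.Perm Name) : Val → Val
  | .tick => .tick
  | .lab l => .lab l
  | .clos z P => .clos (π z) (P.perm π)
  | .closB z P => .closB (π z) (P.perm π)
/-- Action of a permutation of names on a queue. -/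
def Queue.perm (π : Equiv.Perm Name) : List Val → List Val
  | [] => []
  | v :: q => v.perm π :: Queue.perm π q
end

/-- `P.ren x a` exchanges `x` and `a` in `P`. When `a` is not free in `P` (or `a = x`), this is,
up to the choice of bound names, the capture-avoiding substitution of `a` for `x`. -/
def Proc.ren (x a : Name) (P : Proc) : Proc := P.perm (Equiv.swap x a)

open Classical in
/-- The polarity setting `cut {P |a:A [q] b:B| Q}ᵖ` for a cut whose write endpoint is `a` as long
as `q` is not empty: when `q` is empty, the endpoint with the positive type is marked. -/
noncomputable def Proc.cutPol (m : Mode) (a : Name) (A : EndTy) (q : Queue) (b : Name) (B : EndTy)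
    (P Q : Proc) : Proc :=
  .cut m (if q = [] ∧ ¬ A.Pos then .right else .left) a A q b B P Q

/-! ### Congruences -/

/-- The least congruence on processes that contains `R`. -/
inductive CongClosure (R : Proc → Proc → Prop) : Proc → Proc → Prop
  | base {P Q} : R P Q → CongClosure R P Q
  | refl (P) : CongClosure R P P
  | symm {P Q} : CongClosure R P Q → CongClosure R Q P
  | trans {P Q S} : CongClosure R P Q → CongClosure R Q S → CongClosure R P S
  | mix {P P' Q Q'} : CongClosure R P P' → CongClosure R Q Q' →
      CongClosure R (.mix P Q) (.mix P' Q')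
  | cut {m s a A q b B P P' Q Q'} : CongClosure R P P' → CongClosure R Q Q' →
      CongClosure R (.cut m s a A q b B P Q) (.cut m s a A q b B P' Q')
  | cut_clos {m s a A q₁ q₂ z S S' b B P Q} : CongClosure R S S' →
      CongClosure R (.cut m s a A (q₁ ++ .clos z S :: q₂) b B P Q)
        (.cut m s a A (q₁ ++ .clos z S' :: q₂) b B P Q)
  | cut_closB {m s a A q₁ q₂ z S S' b B P Q} : CongClosure R S S' →
      CongClosure R (.cut m s a A (q₁ ++ .closB z S :: q₂) b B P Q)
        (.cut m s a A (q₁ ++ .closB z S' :: q₂) b B P Q)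
  | wait {x P P'} : CongClosure R P P' → CongClosure R (.wait x P) (.wait x P')
  | case {x} {L : Finset Label} {P P' : L → Proc} : (∀ l, CongClosure R (P l) (P' l)) →
      CongClosure R (.case x L P) (.case x L P')
  | sel {x l P P'} : CongClosure R P P' → CongClosure R (.sel x l P) (.sel x l P')
  | send {x z P P' Q Q'} : CongClosure R P P' → CongClosure R Q Q' →
      CongClosure R (.send x z P Q) (.send x z P' Q')
  | recv {x z P P'} : CongClosure R P P' → CongClosure R (.recv x z P) (.recv x z P')
  | bang {x z P P'} : CongClosure R P P' → CongClosure R (.bang x z P) (.bang x z P')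
  | why {x P P'} : CongClosure R P P' → CongClosure R (.why x P) (.why x P')
  | cutB {x A y P P' Q Q'} : CongClosure R P P' → CongClosure R Q Q' →
      CongClosure R (.cutB x A y P Q) (.cutB x A y P' Q')
  | call {x z P P'} : CongClosure R P P' → CongClosure R (.call x z P) (.call x z P')

/-- Renaming of one outermost binder to a name that is not free in its scope. -/
inductive AlphaStep : Proc → Proc → Prop
  | cut_left {m s a a' A q b B P Q} : a' ∉ P.fn →
      AlphaStep (.cut m s a A q b B P Q) (.cut m s a' A q b B (P.ren a a') Q)
  | cut_right {m s a A q b b' B P Q} : b' ∉ Q.fn →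
      AlphaStep (.cut m s a A q b B P Q) (.cut m s a A q b' B P (Q.ren b b'))
  | cut_clos {m s a A q₁ q₂ z z' S b B P Q} : z' ∉ S.fn →
      AlphaStep (.cut m s a A (q₁ ++ .clos z S :: q₂) b B P Q)
        (.cut m s a A (q₁ ++ .clos z' (S.ren z z') :: q₂) b B P Q)
  | cut_closB {m s a A q₁ q₂ z z' S b B P Q} : z' ∉ S.fn →
      AlphaStep (.cut m s a A (q₁ ++ .closB z S :: q₂) b B P Q)
        (.cut m s a A (q₁ ++ .closB z' (S.ren z z') :: q₂) b B P Q)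
  | send {x z z' P Q} : z' ∉ P.fn → AlphaStep (.send x z P Q) (.send x z' (P.ren z z') Q)
  | recv {x z z' P} : z' ∉ P.fn → AlphaStep (.recv x z P) (.recv x z' (P.ren z z'))
  | bang {x z z' P} : z' ∉ P.fn → AlphaStep (.bang x z P) (.bang x z' (P.ren z z'))
  | cutB_left {x A y y' P Q} : y' ∉ P.fn →
      AlphaStep (.cutB x A y P Q) (.cutB x A y' (P.ren y y') Q)
  | cutB_right {x x' A y P Q} : x' ∉ Q.fn →
      AlphaStep (.cutB x A y P Q) (.cutB x' A y P (Q.ren x x'))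
  | call {x z z' P} : z' ∉ P.fn → AlphaStep (.call x z P) (.call x z' (P.ren z z'))

/-- Alpha-equivalence. -/
def Alpha : Proc → Proc → Prop := CongClosure AlphaStep

/-- Linear action prefixes `a(x)`. -/
inductive Pre : Type
  | wait (x : Name) : Pre
  | sel (x : Name) (l : Label) : Pre
  | send (x z : Name) (P : Proc) : Pre
  | recv (x z : Name) : Pre
  | why (x : Name) : Pre

namespace Pre

/-- The process `a(x);P`. -/
def app : Pre → Proc → Proc
  | wait x, P => .wait x P
  | sel x l, P => .sel x l P
  | send x z S, P => .send x z S P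
  | recv x z, P => .recv x z P
  | why x, P => .why x P

/-- The subject. -/
def subj : Pre → Name
  | wait x => x
  | sel x _ => x
  | send x _ _ => x
  | recv x _ => x
  | why x => x

/-- Names introduced into the continuation (`?x` turns `x` into an unrestricted name). -/
def bn : Pre → Set Name
  | recv _ z => {z}
  | why x => {x}
  | _ => ∅

/-- Free names of the prefix itself, without the continuation. -/
def fn : Pre → Set Name
  | send x z S => {x} ∪ (S.fn \ {z})
  | a => {a.subj}

end Pre

/-- Distribution of an exponential cut `cut! {y.P |!x:A| _}` over a queue: every closure that
mentions `x` receives a copy of the cut, values that do not mention `x` may stay unchanged. -/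
inductive DistQueue (x : Name) (A : Ty) (y : Name) (P : Proc) : Queue → Queue → Prop
  | nil : DistQueue x A y P [] []
  | keep {v q q'} : x ∉ v.fn → DistQueue x A y P q q' → DistQueue x A y P (v :: q) (v :: q')
  | clos {z S q q'} : z ≠ x → z ∉ P.fn \ {y} → DistQueue x A y P q q' →
      DistQueue x A y P (.clos z S :: q) (.clos z (.cutB x A y P S) :: q')
  | closB {z S q q'} : z ≠ x → z ∉ P.fn \ {y} → DistQueue x A y P q q' →
      DistQueue x A y P (.closB z S :: q) (.closB z (.cutB x A y P S) :: q')

/-- The laws of structural congruence. The side conditions that are not about membership in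
`fn Q` only express that no name escapes from or is captured by a binder. -/
inductive StructStep : Proc → Proc → Prop
  | fwd {x y} : StructStep (.fwd x y) (.fwd y x)
  | comm {m s a A q b B P Q} :
      StructStep (.cut m s a A q b B P Q) (.cut m s.flip b B q a A Q P)
  | par_nil {P} : StructStep (.mix P .nil) P
  | par_comm {P Q} : StructStep (.mix P Q) (.mix Q P)
  | par_assoc {P Q R} : StructStep (.mix P (.mix Q R)) (.mix (.mix P Q) R)
  | cut_mix {m s x A q y B P Q R} : y ∈ Q.fn → y ∉ R.fn →
      StructStep (.cut m s x A q y B P (.mix Q R)) (.mix (.cut m s x A q y B P Q) R)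
  | cut_cut {m s x A q z C m' s' y D p w B P Q R} :
      y ∈ Q.fn → z ∈ Q.fn → y ≠ z → z ∉ R.fn \ {w} → z ∉ Queue.fn p →
      y ∉ P.fn \ {x} → y ∉ Queue.fn q →
      StructStep (.cut m s x A q z C P (.cut m' s' y D p w B Q R))
        (.cut m' s' y D p w B (.cut m s x A q z C P Q) R)
  | cut_cutB {m s z A q w B x C y P Q R} :
      x ∉ P.fn \ {z} → x ∉ Queue.fn q → x ≠ w → w ∉ Q.fn \ {y} →
      StructStep (.cut m s z A q w B P (.cutB x C y Q R))
        (.cutB x C y Q (.cut m s z A q w B P R))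
  | cutB_mix_right {x A y P Q R} : x ∉ P.fn →
      StructStep (.cutB x A y Q (.mix P R)) (.mix P (.cutB x A y Q R))
  | cutB_cutB {x A y z B w P Q R} : x ≠ z → x ∉ Q.fn \ {w} → z ∉ P.fn \ {y} →
      StructStep (.cutB x A y P (.cutB z B w Q R)) (.cutB z B w Q (.cutB x A y P R))
  | dist_mix {x A y P Q R} :
      StructStep (.cutB x A y P (.mix Q R)) (.mix (.cutB x A y P Q) (.cutB x A y P R))
  | dist_cut {x A y P m s z B q q' w C Q R} :
      x ≠ z → x ≠ w → z ∉ P.fn \ {y} → w ∉ P.fn \ {y} → DistQueue x A y P q q' →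
      StructStep (.cutB x A y P (.cut m s z B q w C Q R))
        (.cut m s z B q' w C (.cutB x A y P Q) (.cutB x A y P R))
  | dist_cutB {x A y P z B w Q R} : x ≠ z → x ≠ w → z ∉ P.fn \ {y} → w ∉ P.fn \ {y} →
      StructStep (.cutB x A y P (.cutB z B w Q R))
        (.cutB z B w (.cutB x A y P Q) (.cutB x A y P R))
  | pre_mix {a : Pre} {Q R} : Disjoint a.bn R.fn →
      StructStep (.mix (a.app Q) R) (a.app (.mix Q R))
  | pre_cut {a : Pre} {m s u A q v B Q R} :
      u ∉ a.fn → u ∉ a.bn → Disjoint a.bn (R.fn \ {v}) → Disjoint a.bn (Queue.fn q) →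
      StructStep (.cut m s u A q v B (a.app Q) R) (a.app (.cut m s u A q v B Q R))
  | pre_cutB {a : Pre} {u A v S Q} : u ∉ a.fn → u ∉ a.bn → Disjoint a.bn (S.fn \ {v}) →
      StructStep (.cutB u A v S (a.app Q)) (a.app (.cutB u A v S Q))
  | pre_pre {a₁ a₂ : Pre} {P} : a₁.subj ≠ a₂.subj → Disjoint a₁.bn a₂.bn →
      Disjoint a₁.bn a₂.fn → Disjoint a₂.bn a₁.fn →
      StructStep (a₁.app (a₂.app P)) (a₂.app (a₁.app P))

/-- Structural congruence `P ≡ Q`. -/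
def Cong : Proc → Proc → Prop := CongClosure (fun P Q => AlphaStep P Q ∨ StructStep P Q)

/-! ### Reduction -/

/-- Buffered reduction `P → Q`. -/
inductive Red : Proc → Proc → Prop
  | fwdp {m z A q₁ x B₁ y B₂ q₂ w C P Q} :
      x ≠ y → x ∉ Queue.fn q₂ → x ∉ P.fn \ {w} →
      Red (.cut m .left z A q₁ x B₁ Q (.cut m .left y B₂ q₂ w C (.fwd x y) P))
        (.cut m .left z A (q₂ ++ q₁) w C Q P)
  | one {m x q y B Q} :
      Red (.cut m .left x (some .one) q y B (.close x) Q)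
        (.cut m .left x none (q ++ [.tick]) y B .nil Q)
  | bot {m x y P} : y ∉ P.fn →
      Red (.cut m .left x none [.tick] y (some .bot) .nil (.wait y P)) P
  | tensor {m x T A q y B z P Q R} : x ∉ P.fn \ {z} →
      Red (.cut m .left x (some (.tensor T A)) q y B (.send x z P Q) R)
        (.cut m .left x (some A) (q ++ [.clos z P]) y B Q R)
  | parr {m x A z P q y S B w Q R} : y ∉ P.fn \ {z} →
      Red (.cut m .left x A (.clos z P :: q) y (some (.parr S B)) Q (.recv y w R))
        (Proc.cutPol m x A q y (some B) Q
          (Proc.cutPol .seq z (some S.dual) [] w (some S) P R))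
  | plus {m x} {L : Finset Label} {A : L → Ty} {q y B P R} {l : L} :
      Red (.cut m .left x (some (.plus L A)) q y B (.sel x l P) R)
        (.cut m .left x (some (A l)) (q ++ [.lab l]) y B P R)
  | amp {m x A} {l : Label} {q y} {L : Finset Label} {B : L → Ty}
      {L' : Finset Label} {P : L' → Proc} {Q} (h : l ∈ L) (h' : l ∈ L') :
      Red (.cut m .left x A (.lab l :: q) y (some (.amp L B)) Q (.case y L' P))
        (Proc.cutPol m x A q y (some (B ⟨l, h⟩)) Q (P ⟨l, h'⟩))
  | bang {m x A q y B z P Q} : x ∉ P.fn \ {z} →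
      Red (.cut m .left x (some (.bang A)) q y B (.bang x z P) Q)
        (.cut m .left x none (q ++ [.closB z P]) y B .nil Q)
  | why {m x z P y A Q} :
      Red (.cut m .left x none [.closB z P] y (some (.whynot A)) .nil (.why y Q))
        (.cutB y A.dual z P Q)
  | call {x A y P z Q} : z ≠ x → z ∉ P.fn \ {y} →
      Red (.cutB x A y P (.call x z Q))
        (Proc.cutPol .seq y (some A) [] z (some A.dual) P (.cutB x A y P Q))
  | mix_left {P P' Q} : Red P P' → Red (.mix P Q) (.mix P' Q)
  | mix_right {P Q Q'} : Red Q Q' → Red (.mix P Q) (.mix P Q')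
  | cut_left {m s a A q b B P P' Q} : Red P P' →
      Red (.cut m s a A q b B P Q) (.cut m s a A q b B P' Q)
  | cut_right {m s a A q b B P Q Q'} : Red Q Q' →
      Red (.cut m s a A q b B P Q) (.cut m s a A q b B P Q')
  | cutB_right {x A y P Q Q'} : Red Q Q' → Red (.cutB x A y P Q) (.cutB x A y P Q')
  | cong {P P' Q Q'} : Cong P P' → Red P' Q' → Cong Q' Q → Red P Q

/-! ### Typing -/

/-- Linear contexts: names with the annotation of their session and their type. -/
abbrev LCtx := Multiset (Name × Mode × Ty)

/-- Unrestricted contexts. -/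
abbrev UCtx := Multiset (Name × Ty)

/-- The names of a dyadic context are pairwise distinct. -/
def WF (Δ : LCtx) (Γ : UCtx) : Prop := (Δ.map Prod.fst + Γ.map Prod.fst).Nodup

/-- Typing judgement `P ⊢ Δ; Γ`. The names passed in messages or bound by exponentials belong to
sequential sessions, and a forwarder connects two endpoints with the same annotation. Label sets
of `case` are non-empty: the additive units are not part of the language. -/
inductive Typed : Proc → LCtx → UCtx → Prop
  | nil {Γ} : WF 0 Γ → Typed .nil 0 Γ
  | mix {P Q Δ Δ' Γ} : Typed P Δ' Γ → Typed Q Δ Γ → WF (Δ' + Δ) Γ →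
      Typed (.mix P Q) (Δ' + Δ) Γ
  | fwd {x y m A Γ} : WF {(x, m, A.dual), (y, m, A)} Γ →
      Typed (.fwd x y) {(x, m, A.dual), (y, m, A)} Γ
  | one {x m Γ} : WF {(x, m, Ty.one)} Γ → Typed (.close x) {(x, m, Ty.one)} Γ
  | bot {x m Q Δ Γ} : Typed Q Δ Γ → WF ((x, m, Ty.bot) ::ₘ Δ) Γ →
      Typed (.wait x Q) ((x, m, Ty.bot) ::ₘ Δ) Γ
  | amp {x m} {L : Finset Label} {P : L → Proc} {A : L → Ty} {Δ Γ} : L.Nonempty →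
      (∀ l, Typed (P l) ((x, m, A l) ::ₘ Δ) Γ) →
      Typed (.case x L P) ((x, m, Ty.amp L A) ::ₘ Δ) Γ
  | plus {x m} {L : Finset Label} {A : L → Ty} {l : L} {Q Δ Γ} : Typed Q ((x, m, A l) ::ₘ Δ) Γ →
      Typed (.sel x l Q) ((x, m, Ty.plus L A) ::ₘ Δ) Γ
  | tensor {x y m A B P Q Δ₁ Δ₂ Γ} :
      Typed P ((y, Mode.seq, A) ::ₘ Δ₁) Γ → Typed Q ((x, m, B) ::ₘ Δ₂) Γ →
      WF ((x, m, Ty.tensor A B) ::ₘ (Δ₁ + Δ₂)) Γ →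
      Typed (.send x y P Q) ((x, m, Ty.tensor A B) ::ₘ (Δ₁ + Δ₂)) Γ
  | parr {x z m A B Q Δ Γ} : Typed Q ((z, Mode.seq, A) ::ₘ (x, m, B) ::ₘ Δ) Γ →
      Typed (.recv x z Q) ((x, m, Ty.parr A B) ::ₘ Δ) Γ
  | bang {x y m A P Γ} : Typed P {(y, Mode.seq, A)} Γ → WF {(x, m, Ty.bang A)} Γ →
      Typed (.bang x y P) {(x, m, Ty.bang A)} Γ
  | why {x m A Q Δ Γ} : Typed Q Δ ((x, A) ::ₘ Γ) →
      Typed (.why x Q) ((x, m, Ty.whynot A) ::ₘ Δ) Γ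
  | cutB {x y A P Q Δ Γ} : Typed P {(y, Mode.seq, A)} Γ → Typed Q Δ ((x, A.dual) ::ₘ Γ) →
      Typed (.cutB x A y P Q) Δ Γ
  | call {x z A Q Δ Γ} : Typed Q ((z, Mode.seq, A) ::ₘ Δ) ((x, A) ::ₘ Γ) →
      Typed (.call x z Q) Δ ((x, A) ::ₘ Γ)
  | cut {m x A y P Q Δ Δ' Γ} : A.Pos →
      Typed P ((x, m, A) ::ₘ Δ') Γ → Typed Q ((y, m, A.dual) ::ₘ Δ) Γ → WF (Δ' + Δ) Γ →
      Typed (.cut m .left x (some A) [] y (some A.dual) P Q) (Δ' + Δ) Γ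
  | cut_one {m x q y B Q Δ Γ} :
      Typed (.cut m .left x (some Ty.one) q y B (.close x) Q) Δ Γ →
      Typed (.cut m .left x none (q ++ [.tick]) y B .nil Q) Δ Γ
  | cut_tensor {m x T A q y B z R P Q Δ Γ} :
      Typed (.cut m .left x (some (Ty.tensor T A)) q y B (.send x z R P) Q) Δ Γ →
      Typed (.cut m .left x (some A) (q ++ [.clos z R]) y B P Q) Δ Γ
  | cut_plus {m x} {L : Finset Label} {A : L → Ty} {l : L} {q y B P Q Δ Γ} :
      Typed (.cut m .left x (some (Ty.plus L A)) q y B (.sel x l P) Q) Δ Γ →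
      Typed (.cut m .left x (some (A l)) (q ++ [.lab l]) y B P Q) Δ Γ
  | cut_bang {m x A q y B z P Q Δ Γ} :
      Typed (.cut m .left x (some (Ty.bang A)) q y B (.bang x z P) Q) Δ Γ →
      Typed (.cut m .left x none (q ++ [.closB z P]) y B .nil Q) Δ Γ
  /-- the symmetric forms of the five preceding rules -/
  | cut_symm {m s a A q b B P Q Δ Γ} : Typed (.cut m s a A q b B P Q) Δ Γ →
      Typed (.cut m s.flip b B q a A Q P) Δ Γ
  /-- processes are considered up to alpha-equivalence -/
  | alpha {P P' Δ Γ} : Typed P Δ Γ → Alpha P P' → Typed P' Δ Γ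

/-! ### The multithreaded machine -/

/-- Session records; the first endpoint is the write endpoint, the second the read endpoint.
A sequential record also holds the suspended process that owns one of the endpoints. -/
inductive Rec : Type
  | seq (x : Name) (A : EndTy) (q : Queue) (R : Proc) (y : Name) (B : EndTy) : Rec
  | conc (x : Name) (A : EndTy) (q : Queue) (y : Name) (B : EndTy) : Rec

/-- All names that a record mentions. -/
def Rec.names : Rec → Set Name
  | .seq x _ q R y _ => {x, y} ∪ Queue.fn q ∪ R.fn
  | .conc x _ q y _ => {x, y} ∪ Queue.fn q

open Classical in
/-- A sequential record after a read: the endpoints are swapped when the queue is empty. -/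
noncomputable def Rec.seqTurn (x : Name) (A : EndTy) (q : Queue) (R : Proc) (y : Name)
    (B : EndTy) : Rec :=
  if q = [] then .seq y B q R x A else .seq x A q R y B

open Classical in
/-- A concurrent record after a read: the endpoints are swapped when the queue is empty and
the owner of the write endpoint has no further positive action to perform on it. -/
noncomputable def Rec.concTurn (x : Name) (A : EndTy) (q : Queue) (y : Name) (B : EndTy) : Rec :=
  if q = [] ∧ ¬ A.Pos then .conc y B q x A else .conc x A q y B

abbrev Heap := Multiset Rec

/-- A binding of an unrestricted name to the exponential closure `clos!(z, R)` with `z : A`. -/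
structure Bind : Type where
  name : Name
  ty : Ty
  arg : Name
  body : Proc

/-- All names that a binding mentions. -/
def Bind.names (β : Bind) : Set Name := {β.name} ∪ (β.body.fn \ {β.arg})

abbrev Env := Multiset Bind

/-- States of the machine: a pool of threads, a heap of session records, and the environment of
the unrestricted names. -/
structure State : Type where
  threads : Multiset Proc
  heap : Heap
  env : Env

/-- The names that occur in a heap or an environment. -/
def storeNames (H : Heap) (E : Env) : Set Name :=
  {n | (∃ r ∈ H, n ∈ r.names) ∨ ∃ β ∈ E, n ∈ β.names}

/-- The names that occur (free) in a state. -/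
def State.names (S : State) : Set Name :=
  {n | (∃ P ∈ S.threads, n ∈ P.fn) ∨ n ∈ storeNames S.heap S.env}

/-- `n` is a new name with respect to a single thread, the heap and the environment. -/
def New (n : Name) (P : Proc) (H : Heap) (E : Env) : Prop := n ∉ P.fn ∧ n ∉ storeNames H E

/-- The actions: forwarders and processes with a topmost action prefix. -/
inductive IsAction : Proc → Prop
  | fwd {x y} : IsAction (.fwd x y)
  | close {x} : IsAction (.close x)
  | wait {x P} : IsAction (.wait x P)
  | case {x} {L : Finset Label} {P : L → Proc} : IsAction (.case x L P)
  | sel {x l P} : IsAction (.sel x l P)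
  | send {x z P Q} : IsAction (.send x z P Q)
  | recv {x z P} : IsAction (.recv x z P)
  | bang {x z P} : IsAction (.bang x z P)
  | why {x P} : IsAction (.why x P)
  | call {x z P} : IsAction (.call x z P)

/-- `NegAction P x`: for `x` of negative type, `P` is a negative action with subject `x`. -/
inductive NegAction : Proc → Name → Prop
  | wait {x P} : NegAction (.wait x P) x
  | case {x} {L : Finset Label} {P : L → Proc} : NegAction (.case x L P) x
  | recv {x z P} : NegAction (.recv x z P) x
  | why {x P} : NegAction (.why x P) x
  | fwd_left {x y} : NegAction (.fwd x y) x
  | fwd_right {x y} : NegAction (.fwd y x) x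

/-- Transitions of a single thread `(P, H)` in the environment `E`. -/
inductive ThreadStep : Proc × Heap × Env → Proc × Heap × Env → Prop
  -- sequential cuts
  | cut_left {x A y B P Q H E a b} : EndTy.Pos A → a ≠ b →
      New a (.cut .seq .left x A [] y B P Q) H E → New b (.cut .seq .left x A [] y B P Q) H E →
      ThreadStep (.cut .seq .left x A [] y B P Q, H, E)
        (P.ren x a, .seq a A [] (Q.ren y b) b B ::ₘ H, E)
  | cut_right {x A y B P Q H E a b} : EndTy.Pos B → a ≠ b →
      New a (.cut .seq .right x A [] y B P Q) H E → New b (.cut .seq .right x A [] y B P Q) H E →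
      ThreadStep (.cut .seq .right x A [] y B P Q, H, E)
        (Q.ren y b, .seq b B [] (P.ren x a) a A ::ₘ H, E)
  | cutB {x A y R P H E a} : New a (.cutB x A y R P) H E →
      ThreadStep (.cutB x A y R P, H, E) (P.ren x a, H, ⟨a, A, y, R⟩ ::ₘ E)
  -- actions on sequential records
  | fwd {u v x y z A q₁ Q B₁ B₂ q₂ P w C H E} : (u = x ∧ v = y) ∨ (u = y ∧ v = x) →
      ThreadStep (.fwd u v, .seq z A q₁ Q x B₁ ::ₘ .seq y B₂ q₂ P w C ::ₘ H, E)
        (P, .seq z A (q₂ ++ q₁) Q w C ::ₘ H, E)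
  | neg {P x A q Q y B H E} : NegAction P x → EndTy.Neg A →
      ThreadStep (P, .seq x A q Q y B ::ₘ H, E) (Q, .seq x A q P y B ::ₘ H, E)
  | one {x q P y B H E} :
      ThreadStep (.close x, .seq x (some .one) q P y B ::ₘ H, E)
        (P, .seq x none (q ++ [.tick]) .nil y B ::ₘ H, E)
  | bot {x y P H E} :
      ThreadStep (.wait y P, .seq x none [.tick] .nil y (some .bot) ::ₘ H, E) (P, H, E)
  | tensor {x z R Q T A q P y B H E} :
      ThreadStep (.send x z R Q, .seq x (some (.tensor T A)) q P y B ::ₘ H, E)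
        (Q, .seq x (some A) (q ++ [.clos z R]) P y B ::ₘ H, E)
  | parr_pos {y w Q x A z R q P S B H E e f} : S.Pos → e ≠ f →
      New e (.recv y w Q) (.seq x A (.clos z R :: q) P y (some (.parr S B)) ::ₘ H) E →
      New f (.recv y w Q) (.seq x A (.clos z R :: q) P y (some (.parr S B)) ::ₘ H) E →
      ThreadStep (.recv y w Q, .seq x A (.clos z R :: q) P y (some (.parr S B)) ::ₘ H, E)
        (Q.ren w e, .seq e (some S) [] (R.ren z f) f (some S.dual) ::ₘ
          Rec.seqTurn x A q P y (some B) ::ₘ H, E)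
  | parr_neg {y w Q x A z R q P S B H E e f} : ¬ S.Pos → e ≠ f →
      New e (.recv y w Q) (.seq x A (.clos z R :: q) P y (some (.parr S B)) ::ₘ H) E →
      New f (.recv y w Q) (.seq x A (.clos z R :: q) P y (some (.parr S B)) ::ₘ H) E →
      ThreadStep (.recv y w Q, .seq x A (.clos z R :: q) P y (some (.parr S B)) ::ₘ H, E)
        (R.ren z e, .seq e (some S.dual) [] (Q.ren w f) f (some S) ::ₘ
          Rec.seqTurn x A q P y (some B) ::ₘ H, E)
  | plus {x} {L : Finset Label} {A : L → Ty} {l : L} {Q q P y B H E} :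
      ThreadStep (.sel x l Q, .seq x (some (.plus L A)) q P y B ::ₘ H, E)
        (Q, .seq x (some (A l)) (q ++ [.lab l]) P y B ::ₘ H, E)
  | amp {y} {L' : Finset Label} {Q : L' → Proc} {x A} {l : Label} {q P}
      {L : Finset Label} {B : L → Ty} {H E} (h : l ∈ L) (h' : l ∈ L') :
      ThreadStep (.case y L' Q, .seq x A (.lab l :: q) P y (some (.amp L B)) ::ₘ H, E)
        (Q ⟨l, h'⟩, Rec.seqTurn x A q P y (some (B ⟨l, h⟩)) ::ₘ H, E)
  | bang {x z Q A q P y B H E} :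
      ThreadStep (.bang x z Q, .seq x (some (.bang A)) q P y B ::ₘ H, E)
        (P, .seq x none (q ++ [.closB z Q]) .nil y B ::ₘ H, E)
  | why {y Q x z R A H E} :
      ThreadStep (.why y Q, .seq x none [.closB z R] .nil y (some (.whynot A)) ::ₘ H, E)
        (Q, H, ⟨y, A.dual, z, R⟩ ::ₘ E)
  -- calls
  | call_pos {y w Q A z R H E e f} : A.dual.Pos → e ≠ f →
      New e (.call y w Q) H (⟨y, A, z, R⟩ ::ₘ E) → New f (.call y w Q) H (⟨y, A, z, R⟩ ::ₘ E) →
      ThreadStep (.call y w Q, H, ⟨y, A, z, R⟩ ::ₘ E)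
        (Q.ren w e, .seq e (some A.dual) [] (R.ren z f) f (some A) ::ₘ H, ⟨y, A, z, R⟩ ::ₘ E)
  | call_neg {y w Q A z R H E e f} : ¬ A.dual.Pos → e ≠ f →
      New e (.call y w Q) H (⟨y, A, z, R⟩ ::ₘ E) → New f (.call y w Q) H (⟨y, A, z, R⟩ ::ₘ E) →
      ThreadStep (.call y w Q, H, ⟨y, A, z, R⟩ ::ₘ E)
        (R.ren z e, .seq e (some A) [] (Q.ren w f) f (some A.dual) ::ₘ H, ⟨y, A, z, R⟩ ::ₘ E)
  -- actions on concurrent records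
  | fwd_c {u v x y z A q₁ B₁ B₂ q₂ w C H E} : (u = x ∧ v = y) ∨ (u = y ∧ v = x) →
      ThreadStep (.fwd u v, .conc z A q₁ x B₁ ::ₘ .conc y B₂ q₂ w C ::ₘ H, E)
        (.nil, .conc z A (q₂ ++ q₁) w C ::ₘ H, E)
  | one_c {x q y B H E} :
      ThreadStep (.close x, .conc x (some .one) q y B ::ₘ H, E)
        (.nil, .conc x none (q ++ [.tick]) y B ::ₘ H, E)
  | bot_c {x y P H E} :
      ThreadStep (.wait y P, .conc x none [.tick] y (some .bot) ::ₘ H, E) (P, H, E)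
  | tensor_c {x z R Q T A q y B H E} :
      ThreadStep (.send x z R Q, .conc x (some (.tensor T A)) q y B ::ₘ H, E)
        (Q, .conc x (some A) (q ++ [.clos z R]) y B ::ₘ H, E)
  | parr_pos_c {y w Q x A z R q S B H E e f} : S.Pos → e ≠ f →
      New e (.recv y w Q) (.conc x A (.clos z R :: q) y (some (.parr S B)) ::ₘ H) E →
      New f (.recv y w Q) (.conc x A (.clos z R :: q) y (some (.parr S B)) ::ₘ H) E →
      ThreadStep (.recv y w Q, .conc x A (.clos z R :: q) y (some (.parr S B)) ::ₘ H, E)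
        (Q.ren w e, .seq e (some S) [] (R.ren z f) f (some S.dual) ::ₘ
          Rec.concTurn x A q y (some B) ::ₘ H, E)
  | parr_neg_c {y w Q x A z R q S B H E e f} : ¬ S.Pos → e ≠ f →
      New e (.recv y w Q) (.conc x A (.clos z R :: q) y (some (.parr S B)) ::ₘ H) E →
      New f (.recv y w Q) (.conc x A (.clos z R :: q) y (some (.parr S B)) ::ₘ H) E →
      ThreadStep (.recv y w Q, .conc x A (.clos z R :: q) y (some (.parr S B)) ::ₘ H, E)
        (R.ren z e, .seq e (some S.dual) [] (Q.ren w f) f (some S) ::ₘ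
          Rec.concTurn x A q y (some B) ::ₘ H, E)
  | plus_c {x} {L : Finset Label} {A : L → Ty} {l : L} {Q q y B H E} :
      ThreadStep (.sel x l Q, .conc x (some (.plus L A)) q y B ::ₘ H, E)
        (Q, .conc x (some (A l)) (q ++ [.lab l]) y B ::ₘ H, E)
  | amp_c {y} {L' : Finset Label} {Q : L' → Proc} {x A} {l : Label} {q}
      {L : Finset Label} {B : L → Ty} {H E} (h : l ∈ L) (h' : l ∈ L') :
      ThreadStep (.case y L' Q, .conc x A (.lab l :: q) y (some (.amp L B)) ::ₘ H, E)
        (Q ⟨l, h'⟩, Rec.concTurn x A q y (some (B ⟨l, h⟩)) ::ₘ H, E)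
  | bang_c {x z Q A q y B H E} :
      ThreadStep (.bang x z Q, .conc x (some (.bang A)) q y B ::ₘ H, E)
        (.nil, .conc x none (q ++ [.closB z Q]) y B ::ₘ H, E)
  | why_c {y Q x z R A H E} :
      ThreadStep (.why y Q, .conc x none [.closB z R] y (some (.whynot A)) ::ₘ H, E)
        (Q, H, ⟨y, A.dual, z, R⟩ ::ₘ E)

/-- `n` is a new name with respect to a state. -/
def State.New (n : Name) (S : State) : Prop := n ∉ S.names

/-- Transitions `S ⤇ S'` of the multithreaded machine. -/
inductive Step : State → State → Prop
  | run {P P' T H H' E E'} : ThreadStep (P, H, E) (P', H', E') →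
      Step ⟨P ::ₘ T, H, E⟩ ⟨P' ::ₘ T, H', E'⟩
  | zero {T T' H H' E E'} : Step ⟨T, H, E⟩ ⟨T', H', E'⟩ →
      Step ⟨.nil ::ₘ T, H, E⟩ ⟨T', H', E'⟩
  | mix {P Q T H E} : Step ⟨.mix P Q ::ₘ T, H, E⟩ ⟨P ::ₘ Q ::ₘ T, H, E⟩
  | pcut_left {x A y B P Q T H E a b} : a ≠ b →
      State.New a ⟨.cut .conc .left x A [] y B P Q ::ₘ T, H, E⟩ →
      State.New b ⟨.cut .conc .left x A [] y B P Q ::ₘ T, H, E⟩ →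
      Step ⟨.cut .conc .left x A [] y B P Q ::ₘ T, H, E⟩
        ⟨P.ren x a ::ₘ Q.ren y b ::ₘ T, .conc a A [] b B ::ₘ H, E⟩
  | pcut_right {x A y B P Q T H E a b} : a ≠ b →
      State.New a ⟨.cut .conc .right x A [] y B P Q ::ₘ T, H, E⟩ →
      State.New b ⟨.cut .conc .right x A [] y B P Q ::ₘ T, H, E⟩ →
      Step ⟨.cut .conc .right x A [] y B P Q ::ₘ T, H, E⟩
        ⟨P.ren x a ::ₘ Q.ren y b ::ₘ T, .conc b B [] a A ::ₘ H, E⟩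

/-! ### Completion of cuts and encoding -/

/-- `CutStar S C`: starting from `S`, all the static constructs (cuts, mixes, inactive threads)
at the top of the threads are executed, until every thread of `C` is an action. -/
inductive CutStar : State → State → Prop
  | done {T H E} : (∀ P ∈ T, IsAction P) → CutStar ⟨T, H, E⟩ ⟨T, H, E⟩
  | nil {T H E C} : CutStar ⟨T, H, E⟩ C → CutStar ⟨.nil ::ₘ T, H, E⟩ C
  | mix {P Q T H E C} : CutStar ⟨P ::ₘ Q ::ₘ T, H, E⟩ C → CutStar ⟨.mix P Q ::ₘ T, H, E⟩ C
  /-- the owner of the write endpoint runs, the reader is suspended; the type `A` of the write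
  endpoint is not void -/
  | writer {x A q y B P Q T H E C a b} : a ≠ b →
      State.New a ⟨.cut .seq .left x (some A) q y B P Q ::ₘ T, H, E⟩ →
      State.New b ⟨.cut .seq .left x (some A) q y B P Q ::ₘ T, H, E⟩ →
      CutStar ⟨P.ren x a ::ₘ T, .seq a (some A) q (Q.ren y b) b B ::ₘ H, E⟩ C →
      CutStar ⟨.cut .seq .left x (some A) q y B P Q ::ₘ T, H, E⟩ C
  /-- the reader runs, and the owner of the write endpoint is suspended; the type of the write
  endpoint is negative or its owner has terminated -/
  | reader {x A q y B P Q T H E C a b} : EndTy.Neg A ∨ P = .nil → a ≠ b →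
      State.New a ⟨.cut .seq .left x A q y B P Q ::ₘ T, H, E⟩ →
      State.New b ⟨.cut .seq .left x A q y B P Q ::ₘ T, H, E⟩ →
      CutStar ⟨Q.ren y b ::ₘ T, .seq a A q (P.ren x a) b B ::ₘ H, E⟩ C →
      CutStar ⟨.cut .seq .left x A q y B P Q ::ₘ T, H, E⟩ C
  | pcut {x A q y B P Q T H E C a b} : a ≠ b →
      State.New a ⟨.cut .conc .left x A q y B P Q ::ₘ T, H, E⟩ →
      State.New b ⟨.cut .conc .left x A q y B P Q ::ₘ T, H, E⟩ →
      CutStar ⟨P.ren x a ::ₘ Q.ren y b ::ₘ T, .conc a A q b B ::ₘ H, E⟩ C →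
      CutStar ⟨.cut .conc .left x A q y B P Q ::ₘ T, H, E⟩ C
  /-- a cut with the write endpoint on the right is the mirror image of one with the write
  endpoint on the left -/
  | mirror {m x A q y B P Q T H E C} :
      CutStar ⟨.cut m .left y B q x A Q P ::ₘ T, H, E⟩ C →
      CutStar ⟨.cut m .right x A q y B P Q ::ₘ T, H, E⟩ C
  | cutB {x A y R P T H E C a} : State.New a ⟨.cutB x A y R P ::ₘ T, H, E⟩ →
      CutStar ⟨P.ren x a ::ₘ T, H, ⟨a, A, y, R⟩ ::ₘ E⟩ C →
      CutStar ⟨.cutB x A y R P ::ₘ T, H, E⟩ C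

/-- `Enc P C`: the state `C` encodes the process `P`, that is `C = encᶜ(P)`. -/
def Enc (P : Proc) (C : State) : Prop := CutStar ⟨{P}, 0, 0⟩ C

end CLLB

namespace CLLB

/-! ### Free names and permutations -/

-- An encoding of `P` stores the static structure of `P` (mixes, cuts, exponential cuts) as
-- unordered multisets of threads, records and bindings. A `Tree` keeps this structure and marks the
-- running side of every sequential cut. Encodings and trees correspond: `CutStar.unfolds` reads a
-- tree off an execution of static constructs, and its process is the original one up to
-- alpha-conversion and symmetry of cuts and mixes; conversely, by `Tree.cutStar`, a tree with
-- distinct new session names executes to its own state. It is therefore enough to simulate one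
-- transition on trees.
--
-- Threads of an encoding are actions, so the transition is a step of some leaf `t` on one or two
-- records or on a binding. The process is closed and its session names are distinct, hence the
-- subject of `t` is bound by exactly the frame above `t` that contributes the record. Other frames
-- may stand in between, but the heap forgets their order, so this frame may be pushed down to `t`
-- if the push is a congruence (`Ctx.arr_push`, `Tree.Good.focus`; `Tree.Good.focus₂` for the two
-- cuts around a forwarder). Frame and leaf then form the redex of a reduction axiom
-- (`Tree.Good.simulates_of_ne_call`). The only exception is the context switch, which changes the
-- running side and not the process; it accounts for the alternative `P ≡ Q`. A binding may be
-- shared by several threads, so its exponential cut cannot be pushed down for a call: it is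
-- distributed over the frames in between, the call uses the copy at the thread, and the
-- distribution is undone (`Ctx.red_call`). The static constructs of the continuation form a tree
-- that replaces the leaf.
--
-- Pushing a cut past a frame requires that its endpoint does not occur in the part left behind,
-- which is where linearity enters. Instead of typing, the weaker invariants `Proc.lin` and
-- `Proc.WL` are carried along; they hold for typed processes by `Typed.linear`. Commutations of
-- prefixes can change `lin`, so the rearrangements of trees are tracked by `Rel` and `Arr`, which
-- respect it, and not by arbitrary congruences. Since a single transition is simulated, the reduct
-- only needs to be closed and to have distinct session names.

mutual
theorem Proc.fn_perm (π : Equiv.Perm Name) : ∀ P : Proc, (P.perm π).fn = π '' P.fn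
  | .nil => by simp [Proc.fn, Proc.perm]
  | .mix P Q => by
    simp [Proc.fn, Proc.perm, Proc.fn_perm π P, Proc.fn_perm π Q, Set.image_union]
  | .fwd x y => by simp [Proc.fn, Proc.perm, Set.image_pair]
  | .cut m s a A q b B P Q => by
    simp [Proc.fn, Proc.perm, Proc.fn_perm π P, Proc.fn_perm π Q, Queue.fn_perm π q,
      Set.image_union, Set.image_sdiff π.injective]
  | .close x => by simp [Proc.fn, Proc.perm]
  | .wait x P => by simp [Proc.fn, Proc.perm, Proc.fn_perm π P, Set.image_insert_eq]
  | .case x L P => by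
    have h : ∀ l, ((P l).perm π).fn = π '' (P l).fn := fun l => Proc.fn_perm π (P l)
    simp only [Proc.fn, Proc.perm, h, Set.image_union, Set.image_iUnion, Set.image_singleton]
  | .sel x l P => by simp [Proc.fn, Proc.perm, Proc.fn_perm π P, Set.image_insert_eq]
  | .send x z P Q => by
    simp [Proc.fn, Proc.perm, Proc.fn_perm π P, Proc.fn_perm π Q, Set.image_union,
      Set.image_insert_eq, Set.image_sdiff π.injective]
  | .recv x z P => by
    simp [Proc.fn, Proc.perm, Proc.fn_perm π P, Set.image_insert_eq,
      Set.image_sdiff π.injective]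
  | .bang x z P => by
    simp [Proc.fn, Proc.perm, Proc.fn_perm π P, Set.image_insert_eq,
      Set.image_sdiff π.injective]
  | .why x P => by simp [Proc.fn, Proc.perm, Proc.fn_perm π P, Set.image_insert_eq]
  | .cutB x A y P Q => by
    simp [Proc.fn, Proc.perm, Proc.fn_perm π P, Proc.fn_perm π Q, Set.image_union,
      Set.image_sdiff π.injective]
  | .call x z P => by
    simp [Proc.fn, Proc.perm, Proc.fn_perm π P, Set.image_insert_eq,
      Set.image_sdiff π.injective]
theorem Val.fn_perm (π : Equiv.Perm Name) : ∀ v : Val, (v.perm π).fn = π '' v.fn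
  | .tick => by simp [Val.fn, Val.perm]
  | .lab _ => by simp [Val.fn, Val.perm]
  | .clos z P => by simp [Val.fn, Val.perm, Proc.fn_perm π P, Set.image_sdiff π.injective]
  | .closB z P => by simp [Val.fn, Val.perm, Proc.fn_perm π P, Set.image_sdiff π.injective]
theorem Queue.fn_perm (π : Equiv.Perm Name) :
    ∀ q : List Val, Queue.fn (Queue.perm π q) = π '' Queue.fn q
  | [] => by simp [Queue.fn, Queue.perm]
  | v :: q => by
    simp [Queue.fn, Queue.perm, Val.fn_perm π v, Queue.fn_perm π q, Set.image_union]
end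

mutual
theorem Proc.perm_refl : ∀ P : Proc, P.perm (Equiv.refl Name) = P
  | .nil => by simp [Proc.perm]
  | .mix P Q => by simp [Proc.perm, Proc.perm_refl P, Proc.perm_refl Q]
  | .fwd x y => by simp [Proc.perm]
  | .cut m s a A q b B P Q => by
    simp [Proc.perm, Proc.perm_refl P, Proc.perm_refl Q, Queue.perm_refl q]
  | .close x => by simp [Proc.perm]
  | .wait x P => by simp [Proc.perm, Proc.perm_refl P]
  | .case x L P => by
    have h : ∀ l, (P l).perm (Equiv.refl Name) = P l := fun l => Proc.perm_refl (P l)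
    simp [Proc.perm, h]
  | .sel x l P => by simp [Proc.perm, Proc.perm_refl P]
  | .send x z P Q => by simp [Proc.perm, Proc.perm_refl P, Proc.perm_refl Q]
  | .recv x z P => by simp [Proc.perm, Proc.perm_refl P]
  | .bang x z P => by simp [Proc.perm, Proc.perm_refl P]
  | .why x P => by simp [Proc.perm, Proc.perm_refl P]
  | .cutB x A y P Q => by simp [Proc.perm, Proc.perm_refl P, Proc.perm_refl Q]
  | .call x z P => by simp [Proc.perm, Proc.perm_refl P]
theorem Val.perm_refl : ∀ v : Val, v.perm (Equiv.refl Name) = v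
  | .tick => by simp [Val.perm]
  | .lab _ => by simp [Val.perm]
  | .clos z P => by simp [Val.perm, Proc.perm_refl P]
  | .closB z P => by simp [Val.perm, Proc.perm_refl P]
theorem Queue.perm_refl : ∀ q : List Val, Queue.perm (Equiv.refl Name) q = q
  | [] => by simp [Queue.perm]
  | v :: q => by simp [Queue.perm, Val.perm_refl v, Queue.perm_refl q]
end

@[simp] theorem Proc.ren_self (x : Name) (P : Proc) : P.ren x x = P := by
  rw [Proc.ren, Equiv.swap_self, Proc.perm_refl]

@[simp] theorem Proc.ren_nil (x a : Name) : Proc.nil.ren x a = .nil := by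
  simp [Proc.ren, Proc.perm]

theorem Queue.fn_append (q p : Queue) : Queue.fn (q ++ p) = Queue.fn q ∪ Queue.fn p := by
  induction q with
  | nil => simp [Queue.fn]
  | cons v q ih => simp [Queue.fn, ih, Set.union_assoc]

theorem Proc.mem_fn_ren {x a n : Name} {P : Proc} :
    n ∈ (P.ren x a).fn ↔ Equiv.swap x a n ∈ P.fn := by
  rw [Proc.ren, Proc.fn_perm]
  constructor
  · rintro ⟨k, hk, rfl⟩; simpa using hk
  · intro h; exact ⟨_, h, by simp⟩

/-- Renaming a binder does not change the free names of an abstraction. -/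
theorem Proc.fn_ren_diff {x a : Name} {P : Proc} (h : a ∉ P.fn) :
    (P.ren x a).fn \ {a} = P.fn \ {x} := by
  ext n
  simp only [Set.mem_sdiff, Proc.mem_fn_ren, Set.mem_singleton_iff, Equiv.swap_apply_def]
  grind

-- Free names under congruence and reduction.

theorem AlphaStep.fn_eq {P Q : Proc} (h : AlphaStep P Q) : P.fn = Q.fn := by
  cases h <;> simp only [Proc.fn, Queue.fn, Val.fn, Queue.fn_append] <;>
    rw [Proc.fn_ren_diff (by assumption)]

theorem Pre.fn_app (a : Pre) (P : Proc) : (a.app P).fn = a.fn ∪ (P.fn \ a.bn) := by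
  cases a <;> ext n <;> simp [Pre.app, Pre.fn, Pre.bn, Proc.fn, Pre.subj]

/-- The distributed queue contains the names of the server only if some closure received a copy, so
the two queues are compared after adding these names to both. In `dist_cut` they are always present,
because both sides of the cut receive a copy. -/
theorem DistQueue.mem_fn {x A y P q q'} (h : DistQueue x A y P q q') (n : Name) :
    (n ∈ Queue.fn q' ∨ n ∈ P.fn \ {y}) ↔ ((n ∈ Queue.fn q ∧ n ≠ x) ∨ n ∈ P.fn \ {y}) := by
  induction h with
  | nil => simp [Queue.fn]
  | keep h _ ih =>
    simp only [Queue.fn, Set.mem_union] at *; grind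
  | clos h1 h2 _ ih =>
    simp only [Queue.fn, Val.fn, Proc.fn, Set.mem_union, Set.mem_sdiff, Set.mem_singleton_iff] at *
    grind
  | closB h1 h2 _ ih =>
    simp only [Queue.fn, Val.fn, Proc.fn, Set.mem_union, Set.mem_sdiff, Set.mem_singleton_iff] at *
    grind

theorem StructStep.fn_eq {P Q : Proc} (h : StructStep P Q) : P.fn = Q.fn := by
  cases h with
  | dist_cut h1 h2 h3 h4 h =>
    ext n
    have := h.mem_fn n
    simp only [Proc.fn, Set.mem_union, Set.mem_sdiff, Set.mem_singleton_iff] at *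
    grind
  | pre_mix h =>
    ext n
    have e1 : n ∈ _ → n ∉ _ := fun h' => Set.disjoint_left.1 h h'
    simp only [Proc.fn, Pre.fn_app, Set.mem_union, Set.mem_sdiff] at *
    grind
  | pre_cut h1 h2 h3 h4 =>
    ext n
    have e1 : n ∈ _ → n ∉ _ := fun h' => Set.disjoint_left.1 h3 h'
    have e2 : n ∈ _ → n ∉ _ := fun h' => Set.disjoint_left.1 h4 h'
    simp only [Proc.fn, Pre.fn_app, Set.mem_union, Set.mem_sdiff, Set.mem_singleton_iff] at *
    grind
  | pre_cutB h1 h2 h3 =>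
    ext n
    have e1 : n ∈ _ → n ∉ _ := fun h' => Set.disjoint_left.1 h3 h'
    simp only [Proc.fn, Pre.fn_app, Set.mem_union, Set.mem_sdiff, Set.mem_singleton_iff] at *
    grind
  | pre_pre h0 h1 h2 h3 =>
    ext n
    have e1 : n ∈ _ → n ∉ _ := fun h' => Set.disjoint_left.1 h2 h'
    have e2 : n ∈ _ → n ∉ _ := fun h' => Set.disjoint_left.1 h3 h'
    simp only [Pre.fn_app, Set.mem_union, Set.mem_sdiff] at *
    grind
  | _ =>
    ext n
    simp only [Proc.fn, Set.mem_union, Set.mem_sdiff, Set.mem_singleton_iff,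
      Set.mem_insert_iff, Set.mem_empty_iff_false] at *
    grind

theorem CongClosure.fn_eq {R : Proc → Proc → Prop} (hR : ∀ P Q, R P Q → P.fn = Q.fn)
    {P Q : Proc} (h : CongClosure R P Q) : P.fn = Q.fn := by
  induction h with
  | base h => exact hR _ _ h
  | refl => rfl
  | symm _ ih => exact ih.symm
  | trans _ _ ih1 ih2 => exact ih1.trans ih2
  | _ => simp only [Proc.fn, Queue.fn_append, Queue.fn, Val.fn, *]

theorem Cong.fn_eq {P Q : Proc} (h : Cong P Q) : P.fn = Q.fn :=
  CongClosure.fn_eq (fun _ _ h => h.elim AlphaStep.fn_eq StructStep.fn_eq) h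

theorem Proc.fn_cutPol {m a A q b B P Q} :
    (Proc.cutPol m a A q b B P Q).fn = (P.fn \ {a}) ∪ Queue.fn q ∪ (Q.fn \ {b}) := by
  rw [Proc.cutPol, Proc.fn]

/-- Needed to keep reducts of closed processes closed. Only an inclusion holds, since a choice
discards the names of the other branches. -/
theorem Red.fn_subset {P Q : Proc} (h : Red P Q) : Q.fn ⊆ P.fn := by
  induction h with
  | cong h1 _ h2 ih => rwa [h1.fn_eq, ← h2.fn_eq]
  | @amp m x A l q y L B L' P Q h h' =>
    intro n
    have : n ∈ (P ⟨l, h'⟩).fn → n ∈ ⋃ l, (P l).fn := fun h => Set.mem_iUnion.2 ⟨_, h⟩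
    simp only [Proc.fn, Proc.fn_cutPol, Queue.fn, Set.mem_union, Set.mem_sdiff,
      Set.mem_singleton_iff] at *
    grind
  | _ =>
    intro n
    simp only [Proc.fn, Proc.fn_cutPol, Queue.fn, Val.fn, Queue.fn_append, Set.mem_union,
      Set.mem_sdiff, Set.mem_singleton_iff, Set.mem_insert_iff, Set.mem_empty_iff_false,
      Set.subset_def] at *
    grind

/-! ### Linear names -/

/-- Names that are used linearly, as far as the static structure and the buffered part of a
process are concerned. -/
def Proc.lin : Proc → Set Name
  | .nil => ∅
  | .mix P Q => (P.lin \ Q.fn) ∪ (Q.lin \ P.fn)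
  | .fwd x y => {n | (n = x ∨ n = y) ∧ x ≠ y}
  | .cut _ _ a _ q b _ P Q =>
    ((P.lin \ {a}) \ (Queue.fn q ∪ (Q.fn \ {b}))) ∪ ((Q.lin \ {b}) \ (Queue.fn q ∪ (P.fn \ {a}))) ∪
      (Queue.fn q \ ((P.fn \ {a}) ∪ (Q.fn \ {b})))
  | .close x => {x}
  | .wait x P => {n | (n = x ∧ x ∉ P.fn) ∨ (n ≠ x ∧ n ∈ P.fn)}
  | .case x _ P => {x} ∪ ⋃ l, (P l).fn
  -- `sel` and `send` hand linearity on to the continuation, because the typing rules for queues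
  -- turn such a prefix of the writer into a value and the subject must stay linear in what is left.
  -- For the other prefixes nothing beyond the side conditions of the reduction axioms is recorded.
  | .sel _ _ P => P.lin
  | .send x z P Q => (Q.lin \ (P.fn \ {z})) ∪ ((P.fn \ {z}) \ ({x} ∪ Q.fn))
  | .recv x z P => {x} ∪ (P.fn \ {z})
  | .bang x z P => {x} \ (P.fn \ {z})
  | .why x P => {x} ∪ P.fn
  | .cutB x _ y P Q => (Q.lin \ {x}) \ (P.fn \ {y})
  | .call _ z P => P.fn \ {z}

/-- Every endpoint of a buffered cut is used linearly by its owner; the owner of a void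
endpoint has terminated. -/
def Proc.WL : Proc → Prop
  | .mix P Q => P.WL ∧ Q.WL
  | .cut _ _ a A _ b B P Q => P.WL ∧ Q.WL ∧ (A = none → P = .nil) ∧ (B = none → Q = .nil) ∧
      (A ≠ none → a ∈ P.lin) ∧ (B ≠ none → b ∈ Q.lin)
  | .sel _ _ P => P.WL
  | .send _ _ _ Q => Q.WL
  | .cutB _ _ _ _ Q => Q.WL
  | _ => True

theorem Proc.lin_subset_fn : ∀ P : Proc, P.lin ⊆ P.fn
  | .nil => by simp [Proc.lin, Proc.fn]
  | .mix P Q => by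
    have h1 := Proc.lin_subset_fn P
    have h2 := Proc.lin_subset_fn Q
    intro n
    simp only [Set.subset_def] at h1 h2
    simp only [Proc.lin, Proc.fn, Set.mem_union, Set.mem_sdiff]
    grind
  | .fwd x y => by intro n; simp only [Proc.lin, Proc.fn, Set.mem_ofPred_eq, Set.mem_insert_iff,
      Set.mem_singleton_iff]; grind
  | .cut m s a A q b B P Q => by
    have h1 := Proc.lin_subset_fn P
    have h2 := Proc.lin_subset_fn Q
    intro n
    simp only [Set.subset_def] at h1 h2
    simp only [Proc.lin, Proc.fn, Set.mem_union, Set.mem_sdiff]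
    grind
  | .close x => by simp [Proc.lin, Proc.fn]
  | .wait x P => by intro n; simp only [Proc.lin, Proc.fn, Set.mem_ofPred_eq, Set.mem_union,
      Set.mem_singleton_iff]; grind
  | .case x L P => by simp [Proc.lin, Proc.fn]
  | .sel x l P => (Proc.lin_subset_fn P).trans (by simp [Proc.fn])
  | .send x z P Q => by
    have h2 := Proc.lin_subset_fn Q
    intro n
    simp only [Set.subset_def] at h2
    simp only [Proc.lin, Proc.fn, Set.mem_union, Set.mem_sdiff]
    grind
  | .recv x z P => by simp [Proc.lin, Proc.fn]
  | .bang x z P => by intro n; simp only [Proc.lin, Proc.fn, Set.mem_union, Set.mem_sdiff]; grind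
  | .why x P => by simp [Proc.lin, Proc.fn]
  | .cutB x A y P Q => by
    have h2 := Proc.lin_subset_fn Q
    intro n
    simp only [Set.subset_def] at h2
    simp only [Proc.lin, Proc.fn, Set.mem_union, Set.mem_sdiff]
    grind
  | .call x z P => by intro n; simp only [Proc.lin, Proc.fn, Set.mem_union, Set.mem_sdiff]; grind

theorem mem_image_perm {π : Equiv.Perm Name} {S : Set Name} {n : Name} :
    n ∈ π '' S ↔ π.symm n ∈ S := by
  rw [← Equiv.symm_symm π, Equiv.image_symm_eq_preimage]; simp

theorem Proc.lin_perm (π : Equiv.Perm Name) : ∀ P : Proc, (P.perm π).lin = π '' P.lin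
  | .nil => by simp [Proc.lin, Proc.perm]
  | .mix P Q => by
    simp [Proc.lin, Proc.perm, Proc.lin_perm π P, Proc.lin_perm π Q, Proc.fn_perm,
      Set.image_union, Set.image_sdiff π.injective]
  | .fwd x y => by
    ext n
    simp [Proc.lin, Proc.perm, Equiv.symm_apply_eq]
  | .cut m s a A q b B P Q => by
    simp [Proc.lin, Proc.perm, Proc.lin_perm π P, Proc.lin_perm π Q, Proc.fn_perm, Queue.fn_perm,
      Set.image_union, Set.image_sdiff π.injective]
  | .close x => by simp [Proc.lin, Proc.perm]
  | .wait x P => by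
    ext n
    simp [Proc.lin, Proc.perm, Proc.fn_perm, Equiv.symm_apply_eq]
  | .case x L P => by
    simp only [Proc.lin, Proc.perm, Proc.fn_perm, Set.image_union, Set.image_iUnion,
      Set.image_singleton]
  | .sel x l P => by simp [Proc.lin, Proc.perm, Proc.lin_perm π P]
  | .send x z P Q => by
    simp [Proc.lin, Proc.perm, Proc.lin_perm π Q, Proc.fn_perm,
      Set.image_union, Set.image_sdiff π.injective, Set.image_insert_eq]
  | .recv x z P => by
    simp [Proc.lin, Proc.perm, Proc.fn_perm, Set.image_insert_eq, Set.image_sdiff π.injective]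
  | .bang x z P => by
    simp [Proc.lin, Proc.perm, Proc.fn_perm, Set.image_sdiff π.injective]
  | .why x P => by simp [Proc.lin, Proc.perm, Proc.fn_perm, Set.image_insert_eq]
  | .cutB x A y P Q => by
    simp [Proc.lin, Proc.perm, Proc.lin_perm π Q, Proc.fn_perm, Set.image_sdiff π.injective]
  | .call x z P => by
    simp [Proc.lin, Proc.perm, Proc.fn_perm, Set.image_sdiff π.injective]

theorem Proc.perm_eq_nil {π : Equiv.Perm Name} {P : Proc} : P.perm π = .nil ↔ P = .nil := by
  cases P <;> simp [Proc.perm]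

theorem Proc.WL_perm (π : Equiv.Perm Name) : ∀ P : Proc, (P.perm π).WL ↔ P.WL
  | .nil | .fwd _ _ | .close _ | .wait _ _ | .case _ _ _ | .recv _ _ _ | .bang _ _ _ | .why _ _
  | .call _ _ _ => by simp [Proc.WL, Proc.perm]
  | .mix P Q => by simp [Proc.WL, Proc.perm, Proc.WL_perm π P, Proc.WL_perm π Q]
  | .cut m s a A q b B P Q => by
    simp [Proc.WL, Proc.perm, Proc.WL_perm π P, Proc.WL_perm π Q, Proc.lin_perm,
      Proc.perm_eq_nil]
  | .sel _ _ P => by simp [Proc.WL, Proc.perm, Proc.WL_perm π P]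
  | .send _ _ _ Q => by simp [Proc.WL, Proc.perm, Proc.WL_perm π Q]
  | .cutB _ _ _ _ Q => by simp [Proc.WL, Proc.perm, Proc.WL_perm π Q]

theorem Proc.lin_ren_diff {x a : Name} {P : Proc} (h : a ∉ P.fn) :
    (P.ren x a).lin \ {a} = P.lin \ {x} := by
  have h' : a ∉ P.lin := fun h' => h (P.lin_subset_fn h')
  ext n
  simp only [Set.mem_sdiff, Proc.ren, Proc.lin_perm, mem_image_perm, Equiv.symm_swap,
    Set.mem_singleton_iff, Equiv.swap_apply_def]
  grind

theorem Proc.mem_lin_ren {x a : Name} {P : Proc} : a ∈ (P.ren x a).lin ↔ x ∈ P.lin := by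
  simp [Proc.ren, Proc.lin_perm]

/-- The data of a process that structural rearrangements of its cuts have to respect. -/
structure SameNames (P Q : Proc) : Prop where
  fn : P.fn = Q.fn
  lin : P.lin = Q.lin
  wl : P.WL ↔ Q.WL
  nil : P = .nil ↔ Q = .nil

theorem AlphaStep.sameNames {P Q : Proc} (h : AlphaStep P Q) : SameNames P Q := by
  refine ⟨h.fn_eq, ?_, ?_, ?_⟩
  · cases h <;> simp only [Proc.lin, Queue.fn, Val.fn, Queue.fn_append]
    case cut_left h => rw [Proc.fn_ren_diff h, Proc.lin_ren_diff h]
    case cut_right h => rw [Proc.fn_ren_diff h, Proc.lin_ren_diff h]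
    case cut_clos h => rw [Proc.fn_ren_diff h]
    case cut_closB h => rw [Proc.fn_ren_diff h]
    case send h => rw [Proc.fn_ren_diff h]
    case recv h => rw [Proc.fn_ren_diff h]
    case bang h => rw [Proc.fn_ren_diff h]
    case cutB_left h => rw [Proc.fn_ren_diff h]
    case cutB_right h => rw [Proc.lin_ren_diff h]
    case call h => rw [Proc.fn_ren_diff h]
  · cases h <;> simp only [Proc.WL, Proc.ren, Proc.WL_perm, Proc.perm_eq_nil]
    · rw [← Proc.ren, Proc.mem_lin_ren]
    · rw [← Proc.ren, Proc.mem_lin_ren]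
  · cases h <;> simp

theorem CongClosure.sameNames {R : Proc → Proc → Prop} (hR : ∀ P Q, R P Q → SameNames P Q)
    {P Q : Proc} (h : CongClosure R P Q) : SameNames P Q := by
  induction h with
  | base h => exact hR _ _ h
  | refl => exact ⟨rfl, rfl, Iff.rfl, Iff.rfl⟩
  | symm _ ih => exact ⟨ih.1.symm, ih.2.symm, ih.3.symm, ih.4.symm⟩
  | trans _ _ ih1 ih2 => exact ⟨ih1.1.trans ih2.1, ih1.2.trans ih2.2, ih1.3.trans ih2.3,
      ih1.4.trans ih2.4⟩
  | case _ ih =>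
    constructor <;> simp only [Proc.fn, Proc.lin, Proc.WL, fun l => (ih l).fn, reduceCtorEq]
  | mix _ _ h1 h2 | cut _ _ h1 h2 | send _ _ h1 h2 | cutB _ _ h1 h2 =>
    constructor <;> simp only [Proc.fn, Proc.lin, Proc.WL, h1.fn, h1.lin, h1.wl, h1.nil, h2.fn,
      h2.lin, h2.wl, h2.nil, reduceCtorEq]
  | cut_clos _ h1 | cut_closB _ h1 | wait _ h1 | sel _ h1 | recv _ h1 | bang _ h1 | why _ h1
  | call _ h1 =>
    constructor <;> simp only [Proc.fn, Proc.lin, Proc.WL, Queue.fn_append, Queue.fn, Val.fn,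
      h1.fn, h1.lin, h1.wl, reduceCtorEq]

theorem Alpha.sameNames {P Q : Proc} (h : Alpha P Q) : SameNames P Q :=
  CongClosure.sameNames (fun _ _ => AlphaStep.sameNames) h

/-! ### Typed processes are linear -/

theorem wf_iff {Δ : LCtx} {Γ : UCtx} : WF Δ Γ ↔ (Δ.map Prod.fst).Nodup ∧
    (Γ.map Prod.fst).Nodup ∧ ∀ n, n ∈ Δ.map Prod.fst → n ∉ Γ.map Prod.fst := by
  rw [WF, Multiset.nodup_add, Multiset.disjoint_left]

/-- The facts support each other in the induction: distinctness of the names in the context,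
together with the bound on the free names, shows that a linear name of one premise is absent from
the other premise, which is what `lin` asks of a binary construct. -/
theorem Typed.linear {P : Proc} {Δ : LCtx} {Γ : UCtx} (h : Typed P Δ Γ) :
    WF Δ Γ ∧ (∀ n ∈ Δ.map Prod.fst, n ∈ P.lin) ∧
      (∀ n ∈ P.fn, n ∈ Δ.map Prod.fst ∨ n ∈ Γ.map Prod.fst) ∧ P.WL := by
  induction h with
  | nil h => simpa [Proc.fn, Proc.WL] using h
  | mix _ _ hw ih1 ih2 =>
    refine ⟨hw, ?_, ?_, ih1.2.2.2, ih2.2.2.2⟩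
    all_goals
      intro n
      rw [wf_iff] at hw
      simp only [Multiset.map_add, Multiset.mem_add, Multiset.nodup_add,
        Multiset.disjoint_left] at *
      simp only [Proc.lin, Proc.fn, Set.mem_union, Set.mem_sdiff]
      grind
  | fwd hw =>
    refine ⟨hw, ?_, ?_, trivial⟩
    all_goals
      intro n
      rw [wf_iff] at hw
      simp [Proc.lin, Proc.fn] at *
      grind
  | one hw => refine ⟨hw, ?_, ?_, trivial⟩ <;> simp [Proc.lin, Proc.fn]
  | bot _ hw ih =>
    refine ⟨hw, ?_, ?_, trivial⟩
    all_goals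
      intro n
      rw [wf_iff] at hw
      have := fun n h => Proc.lin_subset_fn _ (ih.2.1 n h)
      simp only [Multiset.map_cons, Multiset.mem_cons, Multiset.nodup_cons] at *
      simp only [Proc.lin, Proc.fn, Set.mem_union, Set.mem_singleton_iff, Set.mem_ofPred_eq] at *
      grind
  | amp hL _ ih =>
    -- Without a branch nothing would make the names of `Δ` distinct or force them to occur.
    obtain ⟨l, hl⟩ := hL
    have i1 := ih ⟨l, hl⟩
    refine ⟨by simpa [WF] using i1.1, ?_, ?_, trivial⟩
    · intro n hn
      have := Proc.lin_subset_fn _ (i1.2.1 n (by simpa using hn))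
      exact Or.inr (Set.mem_iUnion.2 ⟨_, this⟩)
    · intro n hn
      simp only [Proc.fn, Set.mem_union, Set.mem_iUnion, Set.mem_singleton_iff] at hn
      rcases hn with rfl | ⟨l, hl⟩
      · simp
      · simpa using (ih l).2.2.1 n hl
  | plus _ ih =>
    obtain ⟨hw, h1, h2, h3⟩ := ih
    refine ⟨by simpa [WF] using hw, by simpa [Proc.lin] using h1, ?_, h3⟩
    intro n hn
    simp only [Proc.fn, Set.mem_union, Set.mem_singleton_iff] at hn
    rcases hn with rfl | hn
    · simp
    · simpa using h2 n hn
  | tensor _ _ hw ih1 ih2 =>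
    refine ⟨hw, ?_, ?_, ih2.2.2.2⟩
    all_goals
      intro n
      have := fun n h => Proc.lin_subset_fn _ (ih1.2.1 n h)
      obtain ⟨hw1, h1, h2, -⟩ := ih1
      obtain ⟨hw2, h3, h4, -⟩ := ih2
      rw [wf_iff] at hw hw1 hw2
      simp only [Multiset.map_cons, Multiset.mem_cons, Multiset.nodup_cons,
        Multiset.map_add, Multiset.mem_add, Multiset.nodup_add, Multiset.disjoint_left] at *
      simp only [Proc.lin, Proc.fn, Set.mem_union, Set.mem_singleton_iff, Set.mem_sdiff] at *
      grind
  | parr _ ih =>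
    obtain ⟨hw, h1, h2, -⟩ := ih
    have := fun n h => Proc.lin_subset_fn _ (h1 n h)
    rw [wf_iff] at hw
    refine ⟨?_, ?_, ?_, trivial⟩
    · rw [wf_iff]
      simp only [Multiset.map_cons, Multiset.mem_cons, Multiset.nodup_cons] at *
      grind
    all_goals
      intro n
      simp only [Multiset.map_cons, Multiset.mem_cons, Multiset.nodup_cons] at *
      simp only [Proc.lin, Proc.fn, Set.mem_union, Set.mem_singleton_iff, Set.mem_sdiff] at *
      grind
  | bang _ hw ih =>
    refine ⟨hw, ?_, ?_, trivial⟩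
    all_goals
      intro n
      obtain ⟨hw1, h1, h2, -⟩ := ih
      rw [wf_iff] at hw hw1
      simp only [Multiset.map_singleton, Multiset.mem_singleton] at *
      simp only [Proc.lin, Proc.fn, Set.mem_union, Set.mem_singleton_iff, Set.mem_sdiff] at *
      grind
  | why _ ih =>
    obtain ⟨hw, h1, h2, -⟩ := ih
    have := fun n h => Proc.lin_subset_fn _ (h1 n h)
    rw [wf_iff] at hw
    refine ⟨?_, ?_, ?_, trivial⟩
    · rw [wf_iff]
      simp only [Multiset.map_cons, Multiset.mem_cons, Multiset.nodup_cons] at *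
      grind
    all_goals
      intro n
      simp only [Multiset.map_cons, Multiset.mem_cons, Multiset.nodup_cons] at *
      simp only [Proc.lin, Proc.fn, Set.mem_union, Set.mem_singleton_iff] at *
      grind
  | cutB _ _ ih1 ih2 =>
    obtain ⟨hw1, h1, h2, -⟩ := ih1
    obtain ⟨hw2, h3, h4, h5⟩ := ih2
    rw [wf_iff] at hw1 hw2
    refine ⟨?_, ?_, ?_, h5⟩
    · rw [wf_iff]
      simp only [Multiset.map_cons, Multiset.mem_cons, Multiset.nodup_cons] at *
      grind
    all_goals
      intro n
      simp only [Multiset.map_cons, Multiset.mem_cons, Multiset.nodup_cons,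
        Multiset.map_singleton, Multiset.mem_singleton] at *
      simp only [Proc.lin, Proc.fn, Set.mem_union, Set.mem_singleton_iff, Set.mem_sdiff] at *
      grind
  | call _ ih =>
    obtain ⟨hw, h1, h2, -⟩ := ih
    have := fun n h => Proc.lin_subset_fn _ (h1 n h)
    rw [wf_iff] at hw
    refine ⟨?_, ?_, ?_, trivial⟩
    · rw [wf_iff]
      simp only [Multiset.map_cons, Multiset.mem_cons, Multiset.nodup_cons] at *
      grind
    all_goals
      intro n
      simp only [Multiset.map_cons, Multiset.mem_cons, Multiset.nodup_cons] at *
      simp only [Proc.lin, Proc.fn, Set.mem_union, Set.mem_singleton_iff, Set.mem_sdiff] at *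
      grind
  | cut _ _ _ hw ih1 ih2 =>
    obtain ⟨hw1, h1, h2, h5⟩ := ih1
    obtain ⟨hw2, h3, h4, h6⟩ := ih2
    refine ⟨hw, ?_, ?_, h5, h6, by simp, by simp, fun _ => h1 _ (by simp),
      fun _ => h3 _ (by simp)⟩
    all_goals
      intro n
      rw [wf_iff] at hw hw1 hw2
      simp only [Multiset.map_cons, Multiset.mem_cons, Multiset.nodup_cons,
        Multiset.map_add, Multiset.mem_add, Multiset.nodup_add, Multiset.disjoint_left] at *
      simp only [Proc.lin, Proc.fn, Queue.fn, Set.mem_union, Set.mem_singleton_iff, Set.mem_sdiff,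
        Set.mem_empty_iff_false] at *
      grind
  | cut_one _ ih | cut_bang _ ih | cut_tensor _ ih | cut_plus _ ih =>
    obtain ⟨hw, h1, h2, h3⟩ := ih
    -- In the premise the writer is still an action on `x` with a non-void type, so `x` is linear in
    -- that action. Hence `x` is not free in the closure that is moved to the queue, and it is
    -- linear in the continuation if there is one.
    have hx := h3.2.2.2.2.1 (by simp)
    refine ⟨hw, ?_, ?_, ?_⟩
    · intro n hn
      have := h1 n hn
      simp only [Proc.lin, Proc.fn, Queue.fn, Val.fn, Queue.fn_append, Set.mem_union,
        Set.mem_singleton_iff, Set.mem_sdiff, Set.mem_empty_iff_false] at *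
      grind
    · intro n hn
      have := h2 n
      simp only [Proc.lin, Proc.fn, Queue.fn, Val.fn, Queue.fn_append, Set.mem_union,
        Set.mem_singleton_iff, Set.mem_sdiff, Set.mem_empty_iff_false] at *
      grind
    · simp only [Proc.WL, Proc.lin, Proc.fn, Set.mem_union, Set.mem_singleton_iff,
        Set.mem_sdiff] at *
      grind
  | cut_symm _ ih =>
    obtain ⟨hw, h1, h2, h3⟩ := ih
    refine ⟨hw, ?_, ?_, ?_⟩
    · intro n hn
      have := h1 n hn
      simp only [Proc.lin, Set.mem_union, Set.mem_singleton_iff, Set.mem_sdiff] at *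
      grind
    · intro n hn
      have := h2 n
      simp only [Proc.fn, Set.mem_union, Set.mem_singleton_iff, Set.mem_sdiff] at *
      grind
    · simp only [Proc.WL] at *
      grind
  | alpha _ ha ih =>
    have e := Alpha.sameNames ha
    rw [← e.fn, ← e.lin, ← e.wl]
    exact ih

/-! ### Rearrangements that keep the static structure -/

/-- Symmetry of cuts and of mix. -/
inductive CommStep : Proc → Proc → Prop
  | cut {m s a A q b B P Q} : CommStep (.cut m s a A q b B P Q) (.cut m s.flip b B q a A Q P)
  | mix {P Q} : CommStep (.mix P Q) (.mix Q P)

/-- Congruence generated by alpha-conversion and the symmetry of cuts and of mix. -/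
def Rel : Proc → Proc → Prop := CongClosure (fun P Q => AlphaStep P Q ∨ CommStep P Q)

theorem CommStep.sameNames {P Q : Proc} (h : CommStep P Q) : SameNames P Q := by
  cases h with
  | cut =>
    refine ⟨?_, ?_, ?_, by simp⟩
    · ext n; simp only [Proc.fn, Set.mem_union]; tauto
    · ext n; simp only [Proc.lin, Set.mem_union, Set.mem_sdiff]; tauto
    · simp only [Proc.WL]; tauto
  | mix =>
    refine ⟨?_, ?_, ?_, by simp⟩
    · simp only [Proc.fn, Set.union_comm]
    · simp only [Proc.lin, Set.union_comm]
    · simp only [Proc.WL, and_comm]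

theorem Rel.sameNames {P Q : Proc} (h : Rel P Q) : SameNames P Q :=
  CongClosure.sameNames (fun _ _ h => h.elim AlphaStep.sameNames CommStep.sameNames) h

theorem CongClosure.mono {R S : Proc → Proc → Prop} (hRS : ∀ P Q, R P Q → CongClosure S P Q)
    {P Q : Proc} (h : CongClosure R P Q) : CongClosure S P Q := by
  induction h with
  | base h => exact hRS _ _ h
  | refl => exact .refl _
  | symm _ ih => exact .symm ih
  | trans _ _ ih1 ih2 => exact .trans ih1 ih2
  | mix _ _ ih1 ih2 => exact .mix ih1 ih2
  | cut _ _ ih1 ih2 => exact .cut ih1 ih2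
  | cut_clos _ ih => exact .cut_clos ih
  | cut_closB _ ih => exact .cut_closB ih
  | wait _ ih => exact .wait ih
  | case _ ih => exact .case ih
  | sel _ ih => exact .sel ih
  | send _ _ ih1 ih2 => exact .send ih1 ih2
  | recv _ ih => exact .recv ih
  | bang _ ih => exact .bang ih
  | why _ ih => exact .why ih
  | cutB _ _ ih1 ih2 => exact .cutB ih1 ih2
  | call _ ih => exact .call ih

theorem Rel.cong {P Q : Proc} (h : Rel P Q) : Cong P Q := by
  refine CongClosure.mono ?_ h
  rintro P Q (h | h)
  · exact .base (.inl h)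
  · cases h
    · exact .base (.inr .comm)
    · exact .base (.inr .par_comm)

theorem Cong.struct {P Q : Proc} (h : StructStep P Q) : Cong P Q := .base (.inr h)

theorem Cong.alpha {P Q : Proc} (h : AlphaStep P Q) : Cong P Q := .base (.inl h)

/-- `Q` is a rearrangement of `P` with at least the linear names of `P`. -/
structure Arr (P Q : Proc) : Prop where
  cong : Cong P Q
  wl : P.WL → Q.WL
  lin : P.lin ⊆ Q.lin
  nil : P = .nil → Q = .nil

theorem Arr.refl (P : Proc) : Arr P P := ⟨.refl _, id, subset_rfl, id⟩

theorem Arr.trans {P Q R : Proc} (h : Arr P Q) (h' : Arr Q R) : Arr P R :=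
  ⟨.trans h.1 h'.1, h'.2 ∘ h.2, h.3.trans h'.3, h'.4 ∘ h.4⟩

theorem Rel.arr {P Q : Proc} (h : Rel P Q) : Arr P Q :=
  ⟨h.cong, h.sameNames.wl.1, h.sameNames.lin.subset, h.sameNames.nil.1⟩

theorem Rel.symm {P Q : Proc} (h : Rel P Q) : Rel Q P := CongClosure.symm h

theorem Rel.trans {P Q R : Proc} (h : Rel P Q) (h' : Rel Q R) : Rel P R := CongClosure.trans h h'

theorem Arr.mix {P P' Q : Proc} (h : Arr P P') : Arr (.mix P Q) (.mix P' Q) := by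
  have e := h.cong.fn_eq
  refine ⟨.mix h.cong (.refl _), fun w => ⟨h.wl w.1, w.2⟩, ?_, by simp⟩
  have := h.lin
  intro n
  simp only [Set.subset_def] at this
  simp only [Proc.lin, Set.mem_union, Set.mem_sdiff, e]
  grind

theorem Arr.cut {m s a A q b B} {P P' Q : Proc} (h : Arr P P') :
    Arr (.cut m s a A q b B P Q) (.cut m s a A q b B P' Q) := by
  have e := h.cong.fn_eq
  have l := h.lin
  refine ⟨.cut h.cong (.refl _), ?_, ?_, by simp⟩
  · rintro ⟨h1, h2, h3, h4, h5, h6⟩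
    exact ⟨h.wl h1, h2, fun e => h.nil (h3 e), h4, fun e => l (h5 e), h6⟩
  · intro n
    simp only [Set.subset_def] at l
    simp only [Proc.lin, Set.mem_union, Set.mem_sdiff, e]
    grind

theorem Arr.cutB {x A y} {P Q Q' : Proc} (h : Arr Q Q') : Arr (.cutB x A y P Q) (.cutB x A y P Q') := by
  have l := h.lin
  refine ⟨.cutB (.refl _) h.cong, fun w => h.wl w, ?_, by simp⟩
  intro n
  simp only [Set.subset_def] at l
  simp only [Proc.lin, Set.mem_sdiff]
  grind

/-! ### Pushing a cut towards the owner of its endpoint -/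

/-- The owner of a void endpoint is `nil`, which has no free names; any free name of the owner thus
rules out the void case. -/
theorem Proc.WL.cut_lin {m s a A q b B} {P Q : Proc} (h : (Proc.cut m s a A q b B P Q).WL)
    {n : Name} (hn : n ∈ P.fn) : a ∈ P.lin := by
  obtain ⟨-, -, h3, -, h5, -⟩ := h
  by_cases hA : A = none
  · rw [h3 hA] at hn; simp [Proc.fn] at hn
  · exact h5 hA

/-- Linearity of `x` in the mix and its occurrence in `u` exclude it from `R`, so the scope of the
cut can shrink to `u`. -/
theorem arr_cut_mix {m s x A q y B} {u R V : Proc} (hx : x ∈ u.fn)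
    (hw : (Proc.cut m s x A q y B (.mix u R) V).WL) :
    Arr (.cut m s x A q y B (.mix u R) V) (.mix (.cut m s x A q y B u V) R) := by
  have h1 : x ∈ u.lin ∧ x ∉ R.fn := by
    have := hw.cut_lin (n := x) (by simp [Proc.fn, hx])
    have := R.lin_subset_fn
    simp only [Set.subset_def] at this
    simp only [Proc.lin, Set.mem_union, Set.mem_sdiff] at *
    grind
  refine ⟨?_, ?_, ?_, by simp⟩
  · refine .trans (Cong.struct .comm) (.trans (Cong.struct (.cut_mix hx h1.2)) (.mix ?_ (.refl _)))
    exact .symm (Cong.struct .comm)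
  · rintro ⟨h2, h3, h4, h5, h6, h7⟩
    exact ⟨⟨h2.1, h3, fun e => by simpa using h4 e, h5, fun _ => h1.1, h7⟩, h2.2⟩
  · intro n
    have := u.lin_subset_fn
    have := R.lin_subset_fn
    simp only [Set.subset_def] at *
    simp only [Proc.lin, Proc.fn, Set.mem_union, Set.mem_sdiff, Set.mem_singleton_iff]
    grind

/-- Linearity is used twice. The process `u` is not `nil` because it contains `x`, hence it also
uses `c`; and `x`, being linear in the inner cut, occurs neither in `R` nor in the queue `p`. These
are the side conditions of `cut_cut`. -/
theorem arr_cut_cut {m s x A q y B m' s' c C p d D} {u R V : Proc} (hx : x ∈ u.fn) (hc : c ≠ x)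
    (hV : c ∉ V.fn \ {y}) (hq : c ∉ Queue.fn q)
    (hw : (Proc.cut m s x A q y B (.cut m' s' c C p d D u R) V).WL) :
    Arr (.cut m s x A q y B (.cut m' s' c C p d D u R) V)
      (.cut m' s' c C p d D (.cut m s x A q y B u V) R) := by
  have h0 : c ∈ u.lin := hw.1.cut_lin hx
  have hu := u.lin_subset_fn
  have hR := R.lin_subset_fn
  simp only [Set.subset_def] at hu hR
  have h1 : x ∈ u.lin ∧ x ∉ R.fn \ {d} ∧ x ∉ Queue.fn p := by
    have := hw.cut_lin (n := x) (by simp [Proc.fn, hx, hc.symm])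
    simp only [Proc.lin, Set.mem_union, Set.mem_sdiff, Set.mem_singleton_iff] at *
    grind
  refine ⟨?_, ?_, ?_, by simp⟩
  · refine .trans (Cong.struct .comm) (.trans (Cong.struct (.cut_cut (hu _ h0) hx hc h1.2.1 h1.2.2 hV hq)) ?_)
    exact .cut (.symm (Cong.struct .comm)) (.refl _)
  · rintro ⟨⟨h2, h3, h4, h5, h6, h7⟩, h8, h9, h10, h11, h12⟩
    refine ⟨⟨h2, h8, fun e => ?_, h10, fun _ => h1.1, h12⟩, h3, fun e => ?_, h5, fun e => ?_, h7⟩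
    · simpa using h9 e
    · have := h4 e; rw [this] at hx; simp [Proc.fn] at hx
    · simp only [Proc.lin, Set.mem_union, Set.mem_sdiff, Set.mem_singleton_iff] at *
      grind
  · intro n
    have := V.lin_subset_fn
    simp only [Set.subset_def] at *
    simp only [Proc.lin, Proc.fn, Set.mem_union, Set.mem_sdiff, Set.mem_singleton_iff] at *
    grind

theorem arr_cut_cutB {m s x A q y B c C d} {u R V : Proc} (hx : x ∈ u.fn) (hc : c ≠ x)
    (hV : c ∉ V.fn \ {y}) (hq : c ∉ Queue.fn q)
    (hw : (Proc.cut m s x A q y B (.cutB c C d R u) V).WL) :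
    Arr (.cut m s x A q y B (.cutB c C d R u) V) (.cutB c C d R (.cut m s x A q y B u V)) := by
  have hu := u.lin_subset_fn
  simp only [Set.subset_def] at hu
  have h1 : x ∈ u.lin ∧ x ∉ R.fn \ {d} := by
    have := hw.cut_lin (n := x) (by simp [Proc.fn, hx, hc.symm])
    simp only [Proc.lin, Set.mem_sdiff, Set.mem_singleton_iff] at *
    grind
  refine ⟨?_, ?_, ?_, by simp⟩
  · refine .trans (Cong.struct .comm) (.trans (Cong.struct (.cut_cutB hV hq hc h1.2)) ?_)
    exact .cutB (.refl _) (.symm (Cong.struct .comm))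
  · rintro ⟨h2, h3, h4, h5, h6, h7⟩
    exact ⟨h2, h3, fun e => by simpa using h4 e, h5, fun _ => h1.1, h7⟩
  · intro n
    have := V.lin_subset_fn
    simp only [Set.subset_def] at *
    simp only [Proc.lin, Proc.fn, Set.mem_union, Set.mem_sdiff, Set.mem_singleton_iff] at *
    grind

/-! ### Trees: processes together with a choice of the running side of every cut -/

def Rec.ends : Rec → Multiset Name
  | .seq x _ _ _ y _ => {x, y}
  | .conc x _ _ y _ => {x, y}

/-- The names of the sessions of a heap and of the bindings of an environment. -/
def binders (H : Heap) (E : Env) : Multiset Name := H.bind Rec.ends + E.map Bind.name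

theorem binders_add (H H' : Heap) (E E' : Env) :
    binders (H + H') (E + E') = binders H E + binders H' E' := by
  simp only [binders, Multiset.add_bind, Multiset.map_add]; abel

@[simp] theorem binders_zero : binders 0 0 = 0 := rfl

/-- The static structure of a process, with the owner of one endpoint of every sequential cut
suspended. -/
inductive Tree : Type
  | nil : Tree
  | leaf (t : Proc) : Tree
  | mix (a b : Tree) : Tree
  | wr (x : Name) (A : Ty) (q : Queue) (y : Name) (B : EndTy) (a : Tree) (R : Proc) : Tree
  | rd (x : Name) (A : EndTy) (q : Queue) (y : Name) (B : EndTy) (R : Proc) (a : Tree) : Tree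
  | pc (x : Name) (A : EndTy) (q : Queue) (y : Name) (B : EndTy) (a b : Tree) : Tree
  | ex (x : Name) (A : Ty) (y : Name) (R : Proc) (a : Tree) : Tree

namespace Tree

def proc : Tree → Proc
  | nil => .nil
  | leaf t => t
  | mix a b => .mix a.proc b.proc
  | wr x A q y B a R => .cut .seq .left x (some A) q y B a.proc R
  | rd x A q y B R a => .cut .seq .left x A q y B R a.proc
  | pc x A q y B a b => .cut .conc .left x A q y B a.proc b.proc
  | ex x A y R a => .cutB x A y R a.proc

def thr : Tree → Multiset Proc
  | nil => 0
  | leaf t => {t}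
  | mix a b => a.thr + b.thr
  | wr _ _ _ _ _ a _ => a.thr
  | rd _ _ _ _ _ _ a => a.thr
  | pc _ _ _ _ _ a b => a.thr + b.thr
  | ex _ _ _ _ a => a.thr

def heap : Tree → Heap
  | nil => 0
  | leaf _ => 0
  | mix a b => a.heap + b.heap
  | wr x A q y B a R => .seq x (some A) q R y B ::ₘ a.heap
  | rd x A q y B R a => .seq x A q R y B ::ₘ a.heap
  | pc x A q y B a b => .conc x A q y B ::ₘ (a.heap + b.heap)
  | ex _ _ _ _ a => a.heap

def env : Tree → Env
  | nil => 0
  | leaf _ => 0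
  | mix a b => a.env + b.env
  | wr _ _ _ _ _ a _ => a.env
  | rd _ _ _ _ _ _ a => a.env
  | pc _ _ _ _ _ a b => a.env + b.env
  | ex x A y R a => ⟨x, A, y, R⟩ ::ₘ a.env

/-- The side conditions of an encoding. -/
def Valid : Tree → Prop
  | nil => True
  | leaf t => IsAction t
  | mix a b => a.Valid ∧ b.Valid
  | wr _ _ _ _ _ a _ => a.Valid
  | rd _ A _ _ _ R a => (EndTy.Neg A ∨ R = .nil) ∧ a.Valid
  | pc _ _ _ _ _ a b => a.Valid ∧ b.Valid
  | ex _ _ _ _ a => a.Valid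

def bnd (a : Tree) : Multiset Name := binders a.heap a.env

def state (a : Tree) : State := ⟨a.thr, a.heap, a.env⟩

end Tree

/-- One-hole static contexts of depth one. -/
inductive Frame : Type
  | mixL (b : Tree) : Frame
  | mixR (a : Tree) : Frame
  | wr (x : Name) (A : Ty) (q : Queue) (y : Name) (B : EndTy) (R : Proc) : Frame
  | rd (x : Name) (A : EndTy) (q : Queue) (y : Name) (B : EndTy) (R : Proc) : Frame
  | pcL (x : Name) (A : EndTy) (q : Queue) (y : Name) (B : EndTy) (b : Tree) : Frame
  | pcR (x : Name) (A : EndTy) (q : Queue) (y : Name) (B : EndTy) (a : Tree) : Frame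
  | ex (x : Name) (A : Ty) (y : Name) (R : Proc) : Frame

namespace Frame

def fill : Frame → Tree → Tree
  | mixL b, t => .mix t b
  | mixR a, t => .mix a t
  | wr x A q y B R, t => .wr x A q y B t R
  | rd x A q y B R, t => .rd x A q y B R t
  | pcL x A q y B b, t => .pc x A q y B t b
  | pcR x A q y B a, t => .pc x A q y B a t
  | ex x A y R, t => .ex x A y R t

def app : Frame → Proc → Proc
  | mixL b, P => .mix P b.proc
  | mixR a, P => .mix a.proc P
  | wr x A q y B R, P => .cut .seq .left x (some A) q y B P R
  | rd x A q y B R, P => .cut .seq .left x A q y B R P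
  | pcL x A q y B b, P => .cut .conc .left x A q y B P b.proc
  | pcR x A q y B a, P => .cut .conc .left x A q y B a.proc P
  | ex x A y R, P => .cutB x A y R P

/-- The part of the frame outside the hole, as a tree. -/
def rest (F : Frame) : Tree := F.fill .nil

def Valid (F : Frame) : Prop := F.rest.Valid

/-- The name that is bound in the hole. -/
def hole : Frame → Option Name
  | mixL _ => none
  | mixR _ => none
  | wr x _ _ _ _ _ => some x
  | rd _ _ _ y _ _ => some y
  | pcL x _ _ _ _ _ => some x
  | pcR _ _ _ y _ _ => some y
  | ex x _ _ _ => some x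

/-- Free names of the part of the frame outside the hole. -/
def fn : Frame → Set Name
  | mixL b => b.proc.fn
  | mixR a => a.proc.fn
  | wr _ _ q y _ R => Queue.fn q ∪ (R.fn \ {y})
  | rd x _ q _ _ R => Queue.fn q ∪ (R.fn \ {x})
  | pcL _ _ q y _ b => Queue.fn q ∪ (b.proc.fn \ {y})
  | pcR x _ q _ _ a => Queue.fn q ∪ (a.proc.fn \ {x})
  | ex _ _ y R => R.fn \ {y}

/-- The frame belongs to a cut. -/
def IsCut : Frame → Prop
  | wr .. | rd .. | pcL .. | pcR .. => True
  | _ => False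

theorem proc_fill (F : Frame) (t : Tree) : (F.fill t).proc = F.app t.proc := by
  cases F <;> rfl

theorem thr_fill (F : Frame) (t : Tree) : (F.fill t).thr = F.rest.thr + t.thr := by
  cases F <;> simp [fill, rest, Tree.thr, add_comm]

theorem heap_fill (F : Frame) (t : Tree) : (F.fill t).heap = F.rest.heap + t.heap := by
  cases F <;> simp [fill, rest, Tree.heap, add_comm]

theorem env_fill (F : Frame) (t : Tree) : (F.fill t).env = F.rest.env + t.env := by
  cases F <;> simp [fill, rest, Tree.env, add_comm]

theorem valid_fill (F : Frame) (t : Tree) : (F.fill t).Valid ↔ F.Valid ∧ t.Valid := by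
  cases F <;> simp [fill, rest, Valid, Tree.Valid, and_comm]

theorem mem_fn_app (F : Frame) (P : Proc) (n : Name) :
    n ∈ (F.app P).fn ↔ n ∈ F.fn ∨ (n ∈ P.fn ∧ F.hole ≠ some n) := by
  cases F <;> simp only [app, Proc.fn, fn, hole, Set.mem_union, Set.mem_sdiff,
    Set.mem_singleton_iff, Option.some.injEq, ne_eq] <;> grind

theorem arr (F : Frame) {P Q : Proc} (h : Arr P Q) : Arr (F.app P) (F.app Q) := by
  have flip : ∀ {m s a A q b B R}, Arr (.cut m s a A q b B R P) (.cut m s a A q b B R Q) := by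
    intro m s a A q b B R
    have c : ∀ P Q, Rel (.cut m s a A q b B P Q) (.cut m s.flip b B q a A Q P) :=
      fun P Q => .base (.inr .cut)
    exact (c _ _).arr.trans (h.cut.trans (c _ _).symm.arr)
  cases F with
  | mixL => exact h.mix
  | mixR a =>
    have c : ∀ P Q, Rel (.mix P Q) (.mix Q P) := fun P Q => .base (.inr .mix)
    exact (c _ _).arr.trans (h.mix.trans (c _ _).arr)
  | wr => exact h.cut
  | rd => exact flip
  | pcL => exact h.cut
  | pcR => exact flip
  | ex => exact h.cutB

theorem red (F : Frame) {P Q : Proc} (h : Red P Q) : Red (F.app P) (F.app Q) := by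
  cases F with
  | mixL => exact .mix_left h
  | mixR => exact .mix_right h
  | wr => exact .cut_left h
  | rd => exact .cut_right h
  | pcL => exact .cut_left h
  | pcR => exact .cut_right h
  | ex => exact .cutB_right h

theorem cong (F : Frame) {P Q : Proc} (h : Cong P Q) : Cong (F.app P) (F.app Q) := by
  cases F with
  | mixL => exact .mix h (.refl _)
  | mixR => exact .mix (.refl _) h
  | wr => exact .cut h (.refl _)
  | rd => exact .cut (.refl _) h
  | pcL => exact .cut h (.refl _)
  | pcR => exact .cut (.refl _) h
  | ex => exact .cutB (.refl _) h

theorem wl_of_app (F : Frame) {P : Proc} (h : (F.app P).WL) : P.WL := by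
  cases F with
  | mixL => exact h.1
  | mixR => exact h.2
  | wr => exact h.1
  | rd => exact h.2.1
  | pcL => exact h.1
  | pcR => exact h.2.1
  | ex => exact h

end Frame

theorem Rel.cut_comm {m s a A q b B P Q} :
    Rel (.cut m s a A q b B P Q) (.cut m s.flip b B q a A Q P) := .base (.inr .cut)

theorem Rel.mix_comm {P Q} : Rel (.mix P Q) (.mix Q P) := .base (.inr .mix)

theorem arr_cut_frame {m s x A q y B V} (G : Frame) {u : Proc} (hx : x ∈ u.fn)
    (hGx : G.hole ≠ some x) (hG : ∀ c, G.hole = some c → c ∉ Queue.fn q ∪ (V.fn \ {y}))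
    (hw : (Proc.cut m s x A q y B (G.app u) V).WL) :
    Arr (.cut m s x A q y B (G.app u) V) (G.app (.cut m s x A q y B u V)) := by
  have flip : ∀ {m' s' c C p d D R}, c ≠ x → c ∉ Queue.fn q ∪ (V.fn \ {y}) →
      (Proc.cut m s x A q y B (.cut m' s' d D p c C R u) V).WL →
      Arr (.cut m s x A q y B (.cut m' s' d D p c C R u) V)
        (.cut m' s' d D p c C R (.cut m s x A q y B u V)) := by
    intro m' s' c C p d D R hcx hc hw
    have e : Rel (Proc.cut m s x A q y B (.cut m' s' d D p c C R u) V)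
      (.cut m s x A q y B (.cut m' s'.flip c C p d D u R) V) := .cut Rel.cut_comm (.refl _)
    simp only [Set.mem_union, not_or] at hc
    exact e.arr.trans ((arr_cut_cut hx hcx hc.2 hc.1 (e.sameNames.wl.1 hw)).trans
      Rel.cut_comm.symm.arr)
  cases G with
  | mixL => exact arr_cut_mix hx hw
  | mixR a =>
    have e : Rel (Proc.cut m s x A q y B (.mix a.proc u) V)
      (.cut m s x A q y B (.mix u a.proc) V) := .cut Rel.mix_comm (.refl _)
    exact e.arr.trans ((arr_cut_mix hx (e.sameNames.wl.1 hw)).trans Rel.mix_comm.arr)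
  | wr c | pcL c =>
    have := hG c rfl
    simp only [Set.mem_union, not_or] at this
    exact arr_cut_cut hx (fun e => hGx (congrArg some e)) this.2 this.1 hw
  | rd d D p c C R => exact flip (fun e => hGx (congrArg some e)) (hG c rfl) hw
  | pcR d D p c C R => exact flip (fun e => hGx (congrArg some e)) (hG c rfl) hw
  | ex c =>
    have := hG c rfl
    simp only [Set.mem_union, not_or] at this
    exact arr_cut_cutB hx (fun e => hGx (congrArg some e)) this.2 this.1 hw

/-- Only a cut is pushed inwards in this way: a mix binds no name in the hole, and the name of an
exponential cut may also be used in `G`. -/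
theorem arr_frame_frame {F : Frame} (hF : F.IsCut) (G : Frame) {u : Proc} {x : Name}
    (hFx : F.hole = some x) (hx : x ∈ u.fn) (hGx : G.hole ≠ some x)
    (hG : ∀ c, G.hole = some c → c ∉ F.fn) (hw : (F.app (G.app u)).WL) :
    Arr (F.app (G.app u)) (G.app (F.app u)) := by
  cases F with
  | mixL | mixR | ex => exact hF.elim
  | wr | pcL =>
    obtain rfl := Option.some.inj hFx
    exact arr_cut_frame G hx hGx hG hw
  | rd | pcR =>
    obtain rfl := Option.some.inj hFx
    exact Rel.cut_comm.arr.trans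
      ((arr_cut_frame G hx hGx hG (Rel.cut_comm.sameNames.wl.1 hw)).trans
        (G.arr Rel.cut_comm.symm.arr))

/-! ### Contexts -/

/-- Static contexts, the outermost frame first. -/
abbrev Ctx := List Frame

namespace Ctx

def fill (K : Ctx) (t : Tree) : Tree := K.foldr Frame.fill t

def app (K : Ctx) (P : Proc) : Proc := K.foldr Frame.app P

/-- The components of a context are commutative sums over its frames, so the order of the frames is
invisible in the state. -/
def thr (K : Ctx) : Multiset Proc := (K.map fun F => F.rest.thr).sum

def heap (K : Ctx) : Heap := (K.map fun F => F.rest.heap).sum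

def env (K : Ctx) : Env := (K.map fun F => F.rest.env).sum

def Valid (K : Ctx) : Prop := ∀ F ∈ K, F.Valid

def bnd (K : Ctx) : Multiset Name := (K.map fun F => F.rest.bnd).sum

theorem proc_fill (K : Ctx) (t : Tree) : (fill K t).proc = app K t.proc := by
  induction K with
  | nil => rfl
  | cons F K ih => exact (F.proc_fill _).trans (congrArg F.app ih)

theorem thr_fill (K : Ctx) (t : Tree) : (fill K t).thr = thr K + t.thr := by
  induction K with
  | nil => simp [fill, thr]
  | cons F K ih =>
    refine (F.thr_fill _).trans ?_
    rw [show (List.foldr Frame.fill t K) = fill K t from rfl, ih]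
    simp [thr, add_assoc]

theorem heap_fill (K : Ctx) (t : Tree) : (fill K t).heap = heap K + t.heap := by
  induction K with
  | nil => simp [fill, heap]
  | cons F K ih =>
    refine (F.heap_fill _).trans ?_
    rw [show (List.foldr Frame.fill t K) = fill K t from rfl, ih]
    simp [heap, add_assoc]

theorem env_fill (K : Ctx) (t : Tree) : (fill K t).env = env K + t.env := by
  induction K with
  | nil => simp [fill, env]
  | cons F K ih =>
    refine (F.env_fill _).trans ?_
    rw [show (List.foldr Frame.fill t K) = fill K t from rfl, ih]
    simp [env, add_assoc]

theorem valid_fill (K : Ctx) (t : Tree) : (fill K t).Valid ↔ Valid K ∧ t.Valid := by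
  induction K with
  | nil => simp [fill, Valid]
  | cons F K ih =>
    refine (F.valid_fill _).trans ?_
    rw [show (List.foldr Frame.fill t K) = fill K t from rfl, ih]
    simp [Valid, and_assoc]

theorem bnd_eq (K : Ctx) : bnd K = binders (heap K) (env K) := by
  induction K with
  | nil => rfl
  | cons F K ih =>
    simp only [bnd, heap, env, List.map_cons, List.sum_cons, binders_add, Tree.bnd] at ih ⊢
    rw [ih]

theorem bnd_fill (K : Ctx) (t : Tree) : (fill K t).bnd = bnd K + t.bnd := by
  rw [Tree.bnd, heap_fill, env_fill, binders_add, ← bnd_eq, Tree.bnd]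

theorem fill_append (K L : Ctx) (t : Tree) : fill (K ++ L) t = fill K (fill L t) := by
  simp [fill]

theorem app_append (K L : Ctx) (P : Proc) : app (K ++ L) P = app K (app L P) := by
  simp [app]

theorem arr (K : Ctx) {P Q : Proc} (h : Arr P Q) : Arr (app K P) (app K Q) := by
  induction K with
  | nil => exact h
  | cons F K ih => exact F.arr ih

theorem red (K : Ctx) {P Q : Proc} (h : Red P Q) : Red (app K P) (app K Q) := by
  induction K with
  | nil => exact h
  | cons F K ih => exact F.red ih

theorem cong (K : Ctx) {P Q : Proc} (h : Cong P Q) : Cong (app K P) (app K Q) := by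
  induction K with
  | nil => exact h
  | cons F K ih => exact F.cong ih

theorem wl_of_app (K : Ctx) {P : Proc} (h : (app K P).WL) : P.WL := by
  induction K with
  | nil => exact h
  | cons F K ih => exact ih (F.wl_of_app h)

theorem mem_fn_app {K : Ctx} {P : Proc} {n : Name} (hn : n ∈ P.fn)
    (h : ∀ F ∈ K, F.hole ≠ some n) : n ∈ (app K P).fn := by
  induction K with
  | nil => exact hn
  | cons F K ih =>
    exact (F.mem_fn_app _ n).2 (.inr ⟨ih fun G hG => h G (List.mem_cons_of_mem _ hG),
      h F List.mem_cons_self⟩)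

/-- A name that is free in the hole but not in the whole is bound by a frame. -/
theorem exists_hole {K : Ctx} {P : Proc} {n : Name} (hn : n ∈ P.fn) (h : n ∉ (app K P).fn) :
    ∃ F ∈ K, F.hole = some n := by
  by_contra hc
  push Not at hc
  exact h (mem_fn_app hn hc)

theorem arr_push {F : Frame} (hF : F.IsCut) {x : Name} (hFx : F.hole = some x) (K : Ctx)
    {u : Proc} (hx : x ∈ u.fn) (hK : ∀ G ∈ K, G.hole ≠ some x ∧ ∀ c, G.hole = some c → c ∉ F.fn)
    (hw : (F.app (app K u)).WL) : Arr (F.app (app K u)) (app K (F.app u)) := by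
  induction K with
  | nil => exact .refl _
  | cons G K ih =>
    have hK' : ∀ G ∈ K, G.hole ≠ some x ∧ ∀ c, G.hole = some c → c ∉ F.fn :=
      fun G hG => hK G (List.mem_cons_of_mem _ hG)
    have h := arr_frame_frame hF G hFx (mem_fn_app (K := K) hx fun G hG => (hK' G hG).1)
      (hK G List.mem_cons_self).1 (hK G List.mem_cons_self).2 hw
    exact h.trans (G.arr (ih hK' (G.wl_of_app (h.wl hw))))

end Ctx

theorem Frame.hole_mem_bnd {F : Frame} {n : Name} (h : F.hole = some n) : n ∈ F.rest.bnd := by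
  cases F <;> simp_all [Frame.hole, Frame.rest, Frame.fill, Tree.bnd, binders, Tree.heap, Tree.env,
    Rec.ends]

theorem Ctx.hole_mem_bnd {K : Ctx} {F : Frame} {n : Name} (hF : F ∈ K) (h : F.hole = some n) :
    n ∈ Ctx.bnd K := by
  induction K with
  | nil => simp at hF
  | cons G K ih =>
    simp only [Ctx.bnd, List.map_cons, List.sum_cons, Multiset.mem_add] at *
    rcases List.mem_cons.1 hF with rfl | hF
    · exact .inl (Frame.hole_mem_bnd h)
    · exact .inr (ih hF)

theorem Tree.exists_ctx {a : Tree} {t : Proc} (h : t ∈ a.thr) :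
    ∃ K : Ctx, a = Ctx.fill K (.leaf t) := by
  induction a with
  | nil => simp [Tree.thr] at h
  | leaf s =>
    simp only [Tree.thr, Multiset.mem_singleton] at h
    exact ⟨[], by simp [Ctx.fill, h]⟩
  | mix a b iha ihb =>
    rcases Multiset.mem_add.1 h with h | h
    · obtain ⟨K, rfl⟩ := iha h; exact ⟨.mixL b :: K, rfl⟩
    · obtain ⟨K, rfl⟩ := ihb h; exact ⟨.mixR a :: K, rfl⟩
  | wr x A q y B a R ih => obtain ⟨K, rfl⟩ := ih h; exact ⟨.wr x A q y B R :: K, rfl⟩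
  | rd x A q y B R a ih => obtain ⟨K, rfl⟩ := ih h; exact ⟨.rd x A q y B R :: K, rfl⟩
  | pc x A q y B a b iha ihb =>
    rcases Multiset.mem_add.1 h with h | h
    · obtain ⟨K, rfl⟩ := iha h; exact ⟨.pcL x A q y B b :: K, rfl⟩
    · obtain ⟨K, rfl⟩ := ihb h; exact ⟨.pcR x A q y B a :: K, rfl⟩
  | ex x A y R a ih => obtain ⟨K, rfl⟩ := ih h; exact ⟨.ex x A y R :: K, rfl⟩

/-! ### Encodings and trees -/

theorem State.mem_names {T H E} {n : Name} : n ∈ State.names ⟨T, H, E⟩ ↔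
    (∃ P ∈ T, n ∈ P.fn) ∨ (∃ r ∈ H, n ∈ r.names) ∨ ∃ β ∈ E, n ∈ β.names := Iff.rfl

theorem Rec.mem_ends_names {r : Rec} {n : Name} (h : n ∈ r.ends) : n ∈ r.names := by
  cases r <;> simp [Rec.ends, Rec.names] at * <;> tauto

theorem mem_binders_store {H : Heap} {E : Env} {n : Name} (h : n ∈ binders H E) :
    n ∈ storeNames H E := by
  simp only [binders, Multiset.mem_add, Multiset.mem_bind, Multiset.mem_map] at h
  rcases h with ⟨r, hr, h⟩ | ⟨β, hβ, rfl⟩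
  · exact .inl ⟨r, hr, Rec.mem_ends_names h⟩
  · exact .inr ⟨β, hβ, by simp [Bind.names]⟩

@[simp] theorem binders_cons_rec (r : Rec) (H : Heap) (E : Env) :
    binders (r ::ₘ H) E = r.ends + binders H E := by
  simp [binders, add_assoc]

@[simp] theorem binders_cons_bind (β : Bind) (H : Heap) (E : Env) :
    binders H (β ::ₘ E) = β.name ::ₘ binders H E := by
  simp [binders]

/-- Shows that the session names of one branch of a mix or concurrent cut are still new after the
other branch has been executed. -/
theorem Tree.names_subset (a : Tree) (n : Name) (h : n ∈ a.state.names) :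
    n ∈ a.proc.fn ∨ n ∈ a.bnd := by
  induction a with
  | nil => simp [Tree.state, Tree.thr, Tree.heap, Tree.env, State.mem_names] at h
  | leaf t => exact .inl (by simpa [Tree.state, Tree.thr, Tree.heap, Tree.env, State.mem_names, Tree.proc] using h)
  | mix a b iha ihb =>
    simp only [Tree.state, Tree.thr, Tree.heap, Tree.env, State.mem_names, Tree.proc, Tree.bnd,
      Multiset.mem_add, or_and_right, exists_or, binders_add, Proc.fn, Set.mem_union] at *
    grind
  | wr x A q y B a R ih | rd x A q y B R a ih =>
    simp only [Tree.state, Tree.thr, Tree.heap, Tree.env, State.mem_names, Tree.proc, Tree.bnd,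
      Multiset.mem_add, Multiset.mem_cons, or_and_right, exists_or, exists_eq_left,
      binders_cons_rec, Rec.ends, Rec.names, Proc.fn, Set.mem_union, Set.mem_sdiff,
      Set.mem_singleton_iff, Set.mem_insert_iff, Multiset.insert_eq_cons,
      Multiset.mem_singleton] at *
    grind
  | pc x A q y B a b iha ihb =>
    simp only [Tree.state, Tree.thr, Tree.heap, Tree.env, State.mem_names, Tree.proc, Tree.bnd,
      Multiset.mem_add, Multiset.mem_cons, or_and_right, exists_or, exists_eq_left, binders_add,
      binders_cons_rec, Rec.ends, Rec.names, Proc.fn, Set.mem_union, Set.mem_sdiff,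
      Set.mem_singleton_iff, Set.mem_insert_iff, Multiset.insert_eq_cons,
      Multiset.mem_singleton] at *
    grind
  | ex x A y R a ih =>
    simp only [Tree.state, Tree.thr, Tree.heap, Tree.env, State.mem_names, Tree.proc, Tree.bnd,
      Multiset.mem_cons, or_and_right, exists_or, exists_eq_left,
      binders_cons_bind, Bind.names, Proc.fn, Set.mem_union, Set.mem_sdiff,
      Set.mem_singleton_iff] at *
    grind

theorem State.names_add {T T' H H' E E'} {n : Name} :
    n ∈ State.names ⟨T + T', H + H', E + E'⟩ ↔
      n ∈ State.names ⟨T, H, E⟩ ∨ n ∈ State.names ⟨T', H', E'⟩ := by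
  simp only [State.mem_names, Multiset.mem_add, or_and_right, exists_or]
  grind

theorem State.names_cons_thread {P T H E} {n : Name} :
    n ∈ State.names ⟨P ::ₘ T, H, E⟩ ↔ n ∈ P.fn ∨ n ∈ State.names ⟨T, H, E⟩ := by
  simp [State.mem_names, or_assoc]

theorem State.names_cons_rec {r T H E} {n : Name} :
    n ∈ State.names ⟨T, r ::ₘ H, E⟩ ↔ n ∈ r.names ∨ n ∈ State.names ⟨T, H, E⟩ := by
  simp [State.mem_names]; grind

theorem State.names_cons_bind {β T H E} {n : Name} :
    n ∈ State.names ⟨T, H, β ::ₘ E⟩ ↔ n ∈ β.names ∨ n ∈ State.names ⟨T, H, E⟩ := by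
  simp [State.mem_names]; grind

/-- A tree whose session names are pairwise distinct and new describes an execution of the static
constructs of its process. -/
theorem Tree.cutStar (a : Tree) (T : Multiset Proc) (H : Heap) (E : Env) {C : State}
    (hn : a.bnd.Nodup) (hv : a.Valid) (hf : ∀ n ∈ a.bnd, n ∉ a.proc.fn ∧ n ∉ State.names ⟨T, H, E⟩)
    (hC : CutStar ⟨a.thr + T, a.heap + H, a.env + E⟩ C) : CutStar ⟨a.proc ::ₘ T, H, E⟩ C := by
  induction a generalizing T H E with
  | nil => exact .nil (by simpa [Tree.thr, Tree.heap, Tree.env] using hC)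
  | leaf t => simpa [Tree.thr, Tree.heap, Tree.env, Tree.proc] using hC
  | mix a b iha ihb =>
    rw [Tree.bnd, Tree.heap, Tree.env, binders_add, Multiset.nodup_add,
      Multiset.disjoint_left] at hn
    simp only [Tree.bnd, Tree.heap, Tree.env, binders_add, Multiset.mem_add, Tree.proc, Proc.fn,
      Set.mem_union] at hf
    refine .mix (iha _ _ _ hn.1 hv.1 (fun n h => ?_) ?_)
    · rw [State.names_cons_thread]
      have := hf n (.inl h)
      tauto
    · rw [Multiset.add_cons]
      refine ihb _ _ _ hn.2.1 hv.2 (fun n h => ?_) ?_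
      · have h1 := hf n (.inr h)
        refine ⟨by tauto, ?_⟩
        rw [State.names_add]
        -- The branch `b` is executed in the state left by `a`, so its names must also be new for
        -- that state.
        have h2 : n ∉ a.state.names := fun h' => by
          rcases a.names_subset n h' with h' | h'
          · tauto
          · exact hn.2.2 h' h
        rw [Tree.state] at h2
        tauto
      · convert hC using 2 <;> simp only [Tree.thr, Tree.heap, Tree.env] <;> abel
  | wr x A q y B a R ih =>
    simp only [Tree.bnd, Tree.heap, Tree.env, Tree.proc, binders_cons_rec, Rec.ends,
      Multiset.insert_eq_cons, Multiset.cons_add, Multiset.singleton_add, Multiset.nodup_cons,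
      Multiset.mem_cons, forall_eq_or_imp] at hn hf
    -- The binders `x` and `y` are new already, so the machine may choose them as its new names; the
    -- renamings are then identities.
    refine .writer (fun e => hn.1 (.inl e)) ?_ ?_ ?_
    · rw [State.New, State.names_cons_thread]; tauto
    · rw [State.New, State.names_cons_thread]; tauto
    · rw [Proc.ren_self, Proc.ren_self]
      refine ih _ _ _ hn.2.2 hv (fun n h => ?_) ?_
      · have h1 := hf.2.2 n h
        have h2 : n ≠ x := by rintro rfl; exact hn.1 (.inr h)
        have h3 : n ≠ y := by rintro rfl; exact hn.2.1 h
        clear hC ih hf hn hv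
        simp only [State.names_cons_rec, Rec.names, Proc.fn, Set.mem_union, Set.mem_sdiff,
          Set.mem_singleton_iff, Set.mem_insert_iff] at h1 ⊢
        tauto
      · simpa only [Tree.thr, Tree.heap, Tree.env, Multiset.add_cons, Multiset.cons_add] using hC
  | rd x A q y B R a ih =>
    simp only [Tree.bnd, Tree.heap, Tree.env, Tree.proc, binders_cons_rec, Rec.ends,
      Multiset.insert_eq_cons, Multiset.cons_add, Multiset.singleton_add, Multiset.nodup_cons,
      Multiset.mem_cons, forall_eq_or_imp] at hn hf
    refine CutStar.reader hv.1 (fun e => hn.1 (.inl e)) ?_ ?_ ?_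
    · rw [State.New, State.names_cons_thread]; tauto
    · rw [State.New, State.names_cons_thread]; tauto
    · rw [Proc.ren_self, Proc.ren_self]
      refine ih _ _ _ hn.2.2 hv.2 (fun n h => ?_) ?_
      · have h1 := hf.2.2 n h
        have h2 : n ≠ x := by rintro rfl; exact hn.1 (.inr h)
        have h3 : n ≠ y := by rintro rfl; exact hn.2.1 h
        clear hC ih hf hn hv
        simp only [State.names_cons_rec, Rec.names, Proc.fn, Set.mem_union, Set.mem_sdiff,
          Set.mem_singleton_iff, Set.mem_insert_iff] at h1 ⊢
        tauto
      · simpa only [Tree.thr, Tree.heap, Tree.env, Multiset.add_cons, Multiset.cons_add] using hC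
  | pc x A q y B a b iha ihb =>
    simp only [Tree.bnd, Tree.heap, Tree.env, Tree.proc, binders_cons_rec, Rec.ends, binders_add,
      Multiset.insert_eq_cons, Multiset.cons_add, Multiset.singleton_add, Multiset.nodup_cons,
      Multiset.mem_cons, Multiset.mem_add, forall_eq_or_imp, Multiset.nodup_add,
      Multiset.disjoint_left] at hn hf
    refine .pcut (fun e => hn.1 (.inl e)) ?_ ?_ ?_
    · rw [State.New, State.names_cons_thread]; tauto
    · rw [State.New, State.names_cons_thread]; tauto
    · rw [Proc.ren_self, Proc.ren_self]
      refine iha _ _ _ hn.2.2.1 hv.1 (fun n h => ?_) ?_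
      · have h1 := hf.2.2 n (.inl h)
        have h2 : n ≠ x := by rintro rfl; exact hn.1 (.inr (.inl h))
        have h3 : n ≠ y := by rintro rfl; exact hn.2.1 (.inl h)
        clear hC iha ihb hf hn
        simp only [State.names_cons_rec, State.names_cons_thread, Rec.names, Proc.fn,
          Set.mem_union, Set.mem_sdiff, Set.mem_singleton_iff, Set.mem_insert_iff] at h1 ⊢
        tauto
      · rw [Multiset.add_cons]
        refine ihb _ _ _ hn.2.2.2.1 hv.2 (fun n h => ?_) ?_
        · have h1 := hf.2.2 n (.inr h)
          have h2 := fun h' => a.names_subset n h'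
          have h3 : n ∉ binders a.heap a.env := fun h' => hn.2.2.2.2 h' h
          have h4 : n ≠ x := by rintro rfl; exact hn.1 (.inr (.inr h))
          have h5 : n ≠ y := by rintro rfl; exact hn.2.1 (.inr h)
          clear hC iha ihb hf hn
          rw [State.names_add]
          simp only [State.names_cons_rec, Rec.names, Proc.fn, Tree.state, Tree.bnd,
            Set.mem_union, Set.mem_sdiff, Set.mem_singleton_iff, Set.mem_insert_iff] at *
          grind
        · convert hC using 2 <;> simp only [Tree.thr, Tree.heap, Tree.env, Multiset.add_cons,
            Multiset.cons_add] <;> abel_nf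
  | ex x A y R a ih =>
    simp only [Tree.bnd, Tree.heap, Tree.env, Tree.proc, binders_cons_bind, Multiset.nodup_cons,
      Multiset.mem_cons, forall_eq_or_imp] at hn hf
    refine .cutB (a := x) ?_ ?_
    · rw [State.New, State.names_cons_thread]; tauto
    · rw [Proc.ren_self]
      refine ih _ _ _ hn.2 hv (fun n h => ?_) ?_
      · have h1 := hf.2 n h
        simp only [State.names_cons_bind, Bind.names, Proc.fn, Set.mem_union, Set.mem_sdiff,
          Set.mem_singleton_iff] at *
        have : n ≠ x := by rintro rfl; exact hn.1 h
        tauto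
      · simpa only [Tree.thr, Tree.heap, Tree.env, Multiset.add_cons, Multiset.cons_add] using hC

-- Reading a tree off an execution of static constructs.

theorem Rel.ren_left {m s a a' A q b B P Q} (h : a' ∉ P.fn \ {a}) :
    Rel (.cut m s a A q b B P Q) (.cut m s a' A q b B (P.ren a a') Q) := by
  -- A new name is only known not to be free in the whole cut, so it may coincide with the old
  -- binder; this case is not an alpha step and is separated.
  by_cases e : a' = a
  · subst e; rw [Proc.ren_self]; exact .refl _
  · exact .base (.inl (.cut_left fun h' => h ⟨h', e⟩))

theorem Rel.ren_right {m s a A q b b' B P Q} (h : b' ∉ Q.fn \ {b}) :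
    Rel (.cut m s a A q b B P Q) (.cut m s a A q b' B P (Q.ren b b')) := by
  by_cases e : b' = b
  · subst e; rw [Proc.ren_self]; exact .refl _
  · exact .base (.inl (.cut_right fun h' => h ⟨h', e⟩))

theorem Rel.ren_cutB {x x' A y P Q} (h : x' ∉ Q.fn \ {x}) :
    Rel (.cutB x A y P Q) (.cutB x' A y P (Q.ren x x')) := by
  by_cases e : x' = x
  · subst e; rw [Proc.ren_self]; exact .refl _
  · exact .base (.inl (.cutB_right fun h' => h ⟨h', e⟩))

theorem Proc.mem_fn_ren_of_ne {x a n : Name} {P : Proc} (h : a ∉ P.fn \ {x}) (hn : n ∈ P.fn)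
    (hx : n ≠ x) : n ∈ (P.ren x a).fn := by
  rw [Proc.mem_fn_ren, Equiv.swap_apply_of_ne_of_ne hx]
  · exact hn
  · rintro rfl; exact h ⟨hn, hx⟩

/-- The threads, records and bindings of a family of trees. -/
def famThr (f : Multiset (Proc × Tree)) : Multiset Proc := (f.map fun p => p.2.thr).sum

def famHeap (f : Multiset (Proc × Tree)) : Heap := (f.map fun p => p.2.heap).sum

def famEnv (f : Multiset (Proc × Tree)) : Env := (f.map fun p => p.2.env).sum

@[simp] theorem famThr_cons (p f) : famThr (p ::ₘ f) = p.2.thr + famThr f := by simp [famThr]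

@[simp] theorem famHeap_cons (p f) : famHeap (p ::ₘ f) = p.2.heap + famHeap f := by simp [famHeap]

@[simp] theorem famEnv_cons (p f) : famEnv (p ::ₘ f) = p.2.env + famEnv f := by simp [famEnv]

/-- The names in `B` are pairwise distinct and do not occur in `S`. -/
def Fresh (B : Multiset Name) (S : State) : Prop := B.Nodup ∧ ∀ n ∈ B, n ∉ S.names

/-- Freshness is composed along an execution: `B'` is allocated in `S`, which leads to `S'`, and `B`
is allocated from `S'` on. As `S'` mentions `B'` and every name of `S`, the later names avoid all of
these. -/
theorem Fresh.add {B B' : Multiset Name} {S S' : State} (h : Fresh B S')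
    (hS : ∀ n ∈ S.names, n ∈ S'.names) (h' : Fresh B' S) (hB' : ∀ n ∈ B', n ∈ S'.names) :
    Fresh (B' + B) S := by
  refine ⟨Multiset.nodup_add.2 ⟨h'.1, h.1, Multiset.disjoint_left.2 @fun n h1 h2 =>
    h.2 n h2 (hB' n h1)⟩, fun n hn => ?_⟩
  rcases Multiset.mem_add.1 hn with hn | hn
  · exact h'.2 n hn
  · exact fun h1 => h.2 n hn (hS n h1)

/-- Every thread of `S` unfolds to a tree with new session names, and `C` consists of these
trees. -/
structure Unfolds (S C : State) (f : Multiset (Proc × Tree)) : Prop where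
  map_fst : f.map Prod.fst = S.threads
  tree : ∀ p ∈ f, Rel p.1 p.2.proc ∧ p.2.Valid ∧ (IsAction p.1 → p.2 = .leaf p.1)
  threads : C.threads = famThr f
  heap : C.heap = S.heap + famHeap f
  env : C.env = S.env + famEnv f
  fresh : Fresh (binders (famHeap f) (famEnv f)) S

theorem exists_of_map_fst_eq_cons {α β : Type*} {f : Multiset (α × β)} {a : α}
    {s : Multiset α} (h : f.map Prod.fst = a ::ₘ s) :
    ∃ (b : β) (g : Multiset (α × β)), f = (a, b) ::ₘ g ∧ g.map Prod.fst = s := by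
  have : a ∈ f.map Prod.fst := h ▸ Multiset.mem_cons_self a s
  obtain ⟨⟨a', b⟩, hp, rfl⟩ := Multiset.mem_map.1 this
  obtain ⟨g, rfl⟩ := Multiset.exists_cons_of_mem hp
  exact ⟨b, g, rfl, by simpa using h⟩

theorem forall_mem_cons_fam {p : Proc × Tree} {f : Multiset (Proc × Tree)}
    {φ : Proc × Tree → Prop} (h : φ p) (h' : ∀ p ∈ f, φ p) : ∀ r ∈ p ::ₘ f, φ r := by
  intro r hr
  rcases Multiset.mem_cons.1 hr with rfl | hr
  · exact h
  · exact h' r hr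

theorem fresh_pair {a b : Name} {S : State} (h : a ≠ b) (ha : State.New a S) (hb : State.New b S) :
    Fresh {a, b} S := by
  refine ⟨by simp [h], fun n hn => ?_⟩
  simp only [Multiset.insert_eq_cons, Multiset.mem_cons, Multiset.mem_singleton] at hn
  rcases hn with rfl | rfl
  · exact ha
  · exact hb

theorem unfolds_done {T H E} (hT : ∀ P ∈ T, IsAction P) :
    Unfolds ⟨T, H, E⟩ ⟨T, H, E⟩ (T.map fun t => (t, .leaf t)) := by
  have e1 : famHeap (T.map fun t => (t, .leaf t)) = 0 := by
    simp [famHeap, Tree.heap, Function.comp_def]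
  have e2 : famEnv (T.map fun t => (t, .leaf t)) = 0 := by
    simp [famEnv, Tree.env, Function.comp_def]
  refine ⟨by simp, ?_, by simp [famThr, Tree.thr, Function.comp_def], by simp [e1], by simp [e2], ?_⟩
  · intro p hp
    obtain ⟨t, ht, rfl⟩ := Multiset.mem_map.1 hp
    exact ⟨.refl _, hT t ht, fun _ => rfl⟩
  · rw [e1, e2]; exact ⟨by simp, by simp⟩

/-- Executing a cut loses no name: a free name of the cut differs from the two binders and from
their new names, so it survives the renaming. `Fresh.add` relies on this. -/
theorem names_cut {m s x A q y B P Q T H E} {r : Rec} {Ps : Multiset Proc} {a b n : Name}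
    (ha : State.New a ⟨.cut m s x A q y B P Q ::ₘ T, H, E⟩)
    (hb : State.New b ⟨.cut m s x A q y B P Q ::ₘ T, H, E⟩)
    (hq : ∀ n ∈ Queue.fn q, n ∈ r.names)
    (hP : ∀ n ∈ (P.ren x a).fn, n ∈ r.names ∨ ∃ P ∈ Ps, n ∈ P.fn)
    (hQ : ∀ n ∈ (Q.ren y b).fn, n ∈ r.names ∨ ∃ P ∈ Ps, n ∈ P.fn)
    (hn : n ∈ State.names ⟨.cut m s x A q y B P Q ::ₘ T, H, E⟩) :
    n ∈ State.names ⟨Ps + T, r ::ₘ H, E⟩ := by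
  simp only [State.New, State.names_cons_thread, Proc.fn, Set.mem_union, not_or] at ha hb hn
  rw [State.names_cons_rec]
  have key : n ∈ r.names ∨ (∃ P ∈ Ps, n ∈ P.fn) ∨ n ∈ State.names ⟨T, H, E⟩ := by
    rcases hn with ((⟨hn, h⟩ | hn) | ⟨hn, h⟩) | hn
    · exact (hP n (Proc.mem_fn_ren_of_ne ha.1.1.1 hn h)).imp_right .inl
    · exact .inl (hq n hn)
    · exact (hQ n (Proc.mem_fn_ren_of_ne hb.1.2 hn h)).imp_right .inl
    · exact .inr (.inr hn)
  rcases key with h | ⟨P, h, h'⟩ | h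
  · exact .inl h
  · exact .inr (.inl ⟨P, by simp [h], h'⟩)
  · refine .inr ?_
    rcases h with ⟨P, h, h'⟩ | h
    · exact .inl ⟨P, by simp [h], h'⟩
    · exact .inr h

theorem Rel.ren_cut {m s x A q y B P Q T H E} {a b : Name}
    (ha : State.New a ⟨.cut m s x A q y B P Q ::ₘ T, H, E⟩)
    (hb : State.New b ⟨.cut m s x A q y B P Q ::ₘ T, H, E⟩) :
    Rel (.cut m s x A q y B P Q) (.cut m s a A q b B (P.ren x a) (Q.ren y b)) := by
  simp only [State.New, State.names_cons_thread, Proc.fn, Set.mem_union, not_or] at ha hb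
  exact (Rel.ren_left ha.1.1.1).trans (Rel.ren_right hb.1.2)

/-- An execution may interleave the static constructs of different threads, so the induction is on
whole states with one tree per thread. Undoing a rule puts a node on top of one tree, or joins the
two trees of the processes it forked. -/
theorem CutStar.unfolds {S C : State} (h : CutStar S C) : ∃ f, Unfolds S C f := by
  induction h with
  | done hT => exact ⟨_, unfolds_done hT⟩
  | nil _ ih =>
    obtain ⟨f, h1, h2, h3, h4, h5, h6⟩ := ih
    refine ⟨(.nil, .nil) ::ₘ f, by simp [h1], forall_mem_cons_fam ⟨.refl _, trivial, by rintro ⟨⟩⟩ h2,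
      by simp [h3, Tree.thr], by simp [h4, Tree.heap], by simp [h5, Tree.env], ?_⟩
    simpa [Fresh, Tree.heap, Tree.env, State.names_cons_thread, Proc.fn] using h6
  | mix _ ih =>
    obtain ⟨f, h1, h2, h3, h4, h5, h6⟩ := ih
    obtain ⟨a, f, rfl, h1'⟩ := exists_of_map_fst_eq_cons h1
    obtain ⟨b, f, rfl, h1''⟩ := exists_of_map_fst_eq_cons h1'
    have ha := h2 _ (Multiset.mem_cons_self _ _)
    have hb := h2 _ (Multiset.mem_cons_of_mem (Multiset.mem_cons_self _ _))
    refine ⟨(.mix _ _, .mix a b) ::ₘ f, by simp only [Multiset.map_cons, h1''],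
      forall_mem_cons_fam ⟨.mix ha.1 hb.1, ⟨ha.2.1, hb.2.1⟩, by rintro ⟨⟩⟩ fun p hp =>
        h2 p (Multiset.mem_cons_of_mem (Multiset.mem_cons_of_mem hp)), by simp [h3, Tree.thr, add_assoc],
      by simp [h4, Tree.heap, add_assoc], by simp [h5, Tree.env, add_assoc], ?_⟩
    simpa [Fresh, Tree.heap, Tree.env, add_assoc, State.names_cons_thread, Proc.fn, or_assoc] using h6
  | @writer x A q y B P Q T H E C a b hab ha hb _ ih =>
    obtain ⟨f, h1, h2, h3, h4, h5, h6⟩ := ih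
    obtain ⟨σ, f, rfl, h1'⟩ := exists_of_map_fst_eq_cons h1
    have hσ := h2 _ (Multiset.mem_cons_self _ _)
    refine ⟨(.cut .seq .left x (some A) q y B P Q, .wr a A q b B σ (Q.ren y b)) ::ₘ f,
      by simp only [Multiset.map_cons, h1'],
      forall_mem_cons_fam ⟨(Rel.ren_cut ha hb).trans (.cut hσ.1 (.refl _)), hσ.2.1, by rintro ⟨⟩⟩
        fun p hp => h2 p (Multiset.mem_cons_of_mem hp), by simp [h3, Tree.thr],
      by simp [h4, Tree.heap], by simp [h5, Tree.env], ?_⟩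
    have := h6.add (fun n hn => names_cut (r := .seq a (some A) q (Q.ren y b) b B)
      (Ps := {P.ren x a}) ha hb (by simp +contextual [Rec.names])
      (fun n h => .inr ⟨_, by simp, h⟩) (by simp +contextual [Rec.names]) hn) (fresh_pair hab ha hb)
      (by simp [State.mem_names, Rec.names])
    simpa [Tree.heap, Tree.env, Rec.ends] using this
  | @reader x A q y B P Q T H E C a b hv hab ha hb _ ih =>
    obtain ⟨f, h1, h2, h3, h4, h5, h6⟩ := ih
    obtain ⟨σ, f, rfl, h1'⟩ := exists_of_map_fst_eq_cons h1
    have hσ := h2 _ (Multiset.mem_cons_self _ _)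
    refine ⟨(.cut .seq .left x A q y B P Q, .rd a A q b B (P.ren x a) σ) ::ₘ f,
      by simp only [Multiset.map_cons, h1'],
      forall_mem_cons_fam ⟨(Rel.ren_cut ha hb).trans (.cut (.refl _) hσ.1),
        ⟨hv.imp_right (by rintro rfl; simp), hσ.2.1⟩, by rintro ⟨⟩⟩
        fun p hp => h2 p (Multiset.mem_cons_of_mem hp), by simp [h3, Tree.thr],
      by simp [h4, Tree.heap], by simp [h5, Tree.env], ?_⟩
    have := h6.add (fun n hn => names_cut (r := .seq a A q (P.ren x a) b B)
      (Ps := {Q.ren y b}) ha hb (by simp +contextual [Rec.names])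
      (by simp +contextual [Rec.names]) (fun n h => .inr ⟨_, by simp, h⟩) hn) (fresh_pair hab ha hb)
      (by simp [State.mem_names, Rec.names])
    simpa [Tree.heap, Tree.env, Rec.ends] using this
  | @pcut x A q y B P Q T H E C a b hab ha hb _ ih =>
    obtain ⟨f, h1, h2, h3, h4, h5, h6⟩ := ih
    obtain ⟨σ, f, rfl, h1'⟩ := exists_of_map_fst_eq_cons h1
    obtain ⟨τ, f, rfl, h1''⟩ := exists_of_map_fst_eq_cons h1'
    have hσ := h2 _ (Multiset.mem_cons_self _ _)
    have hτ := h2 _ (Multiset.mem_cons_of_mem (Multiset.mem_cons_self _ _))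
    refine ⟨(.cut .conc .left x A q y B P Q, .pc a A q b B σ τ) ::ₘ f,
      by simp only [Multiset.map_cons, h1''],
      forall_mem_cons_fam ⟨(Rel.ren_cut ha hb).trans (.cut hσ.1 hτ.1), ⟨hσ.2.1, hτ.2.1⟩,
        by rintro ⟨⟩⟩ fun p hp => h2 p (Multiset.mem_cons_of_mem (Multiset.mem_cons_of_mem hp)),
      by simp [h3, Tree.thr, add_assoc], by simp [h4, Tree.heap, add_assoc],
      by simp [h5, Tree.env, add_assoc], ?_⟩
    have := h6.add (fun n hn => by
      simpa using names_cut (r := .conc a A q b B)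
        (Ps := P.ren x a ::ₘ {Q.ren y b}) ha hb (by simp +contextual [Rec.names])
        (fun n h => .inr ⟨_, by simp, h⟩) (fun n h => .inr ⟨Q.ren y b, by simp, h⟩) hn) (fresh_pair hab ha hb)
      (by simp [State.mem_names, Rec.names])
    simpa [Tree.heap, Tree.env, Rec.ends, add_assoc] using this
  | @mirror m x A q y B P Q T H E C _ ih =>
    obtain ⟨f, h1, h2, h3, h4, h5, h6⟩ := ih
    obtain ⟨σ, f, rfl, h1'⟩ := exists_of_map_fst_eq_cons h1
    have hσ := h2 _ (Multiset.mem_cons_self _ _)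
    -- In trees the write endpoint is always on the left; the mirror image is absorbed by the
    -- symmetry of cuts in `Rel`.
    refine ⟨(.cut m .right x A q y B P Q, σ) ::ₘ f, by simp only [Multiset.map_cons, h1'],
      forall_mem_cons_fam ⟨Rel.cut_comm.trans hσ.1, hσ.2.1, by rintro ⟨⟩⟩
        fun p hp => h2 p (Multiset.mem_cons_of_mem hp), by simpa using h3, by simpa using h4,
      by simpa using h5, ?_⟩
    simp only [famHeap_cons, famEnv_cons] at h6 ⊢
    refine ⟨h6.1, fun n hn h => h6.2 n hn ?_⟩
    simp only [State.names_cons_thread, Proc.fn, Set.mem_union] at h ⊢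
    tauto
  | @cutB x A y R P T H E C a ha _ ih =>
    obtain ⟨f, h1, h2, h3, h4, h5, h6⟩ := ih
    obtain ⟨σ, f, rfl, h1'⟩ := exists_of_map_fst_eq_cons h1
    have hσ := h2 _ (Multiset.mem_cons_self _ _)
    have ha' := ha
    simp only [State.New, State.names_cons_thread, Proc.fn, Set.mem_union, not_or] at ha'
    refine ⟨(.cutB x A y R P, .ex a A y R σ) ::ₘ f, by simp only [Multiset.map_cons, h1'],
      forall_mem_cons_fam ⟨(Rel.ren_cutB ha'.1.2).trans (.cutB (.refl _) hσ.1), hσ.2.1,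
        by rintro ⟨⟩⟩ fun p hp => h2 p (Multiset.mem_cons_of_mem hp), by simp [h3, Tree.thr],
      by simp [h4, Tree.heap], by simp [h5, Tree.env], ?_⟩
    have := h6.add (B' := {a}) (fun n hn => ?_) ⟨by simp, fun n hn => by
      obtain rfl := Multiset.mem_singleton.1 hn; exact ha⟩
      (by simp [State.mem_names, Bind.names])
    · simpa [Tree.heap, Tree.env] using this
    · simp only [State.names_cons_thread, State.names_cons_bind, Bind.names, Proc.fn,
        Set.mem_union] at hn ⊢
      rcases hn with (hn | ⟨hn, h⟩) | hn
      · exact .inl (.inr hn)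
      · exact .inr (.inl <| Proc.mem_fn_ren_of_ne ha'.1.2 hn h)
      · exact .inr (.inr hn)

/-! ### Bringing a thread next to its session -/

/-- Trees of closed linear processes with pairwise distinct session names. -/
structure Tree.Good (a : Tree) : Prop where
  valid : a.Valid
  wl : a.proc.WL
  closed : a.proc.fn = ∅
  nodup : a.bnd.Nodup

theorem eq_of_mem_ends {H : Heap} {E : Env} (h : (binders H E).Nodup) {r r' : Rec} (hr : r ∈ H)
    (hr' : r' ∈ H) {n : Name} (hn : n ∈ r.ends) (hn' : n ∈ r'.ends) : r = r' := by
  obtain ⟨H, rfl⟩ := Multiset.exists_cons_of_mem hr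
  rcases Multiset.mem_cons.1 hr' with e | hr'
  · exact e.symm
  · exfalso
    rw [binders_cons_rec, Multiset.nodup_add, Multiset.disjoint_left] at h
    refine h.2.2 hn ?_
    simp only [binders, Multiset.mem_add, Multiset.mem_bind]
    exact .inl ⟨r', hr', hn'⟩

theorem not_mem_env_of_mem_ends {H : Heap} {E : Env} (h : (binders H E).Nodup) {r : Rec}
    (hr : r ∈ H) {n : Name} (hn : n ∈ r.ends) : n ∉ E.map Bind.name := by
  rw [binders, Multiset.nodup_add, Multiset.disjoint_left] at h
  exact h.2.2 (Multiset.mem_bind.2 ⟨r, hr, hn⟩)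

/-- The session record of a frame. -/
def Frame.rcd : Frame → Option Rec
  | wr x A q y B R => some (.seq x (some A) q R y B)
  | rd x A q y B R => some (.seq x A q R y B)
  | pcL x A q y B _ => some (.conc x A q y B)
  | pcR x A q y B _ => some (.conc x A q y B)
  | _ => none

theorem Frame.rcd_or_env {F : Frame} {x : Name} (h : F.hole = some x) :
    (∃ r, F.rcd = some r ∧ r ∈ F.rest.heap ∧ x ∈ r.ends ∧ F.IsCut) ∨
      x ∈ F.rest.env.map Bind.name := by
  cases F <;> simp_all [Frame.hole, Frame.rcd, Frame.rest, Frame.fill, Tree.heap, Tree.env,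
    Rec.ends, Frame.IsCut]

namespace Ctx

theorem thr_append (K L : Ctx) : thr (K ++ L) = thr K + thr L := by simp [thr]
theorem heap_append (K L : Ctx) : heap (K ++ L) = heap K + heap L := by simp [heap]
theorem env_append (K L : Ctx) : env (K ++ L) = env K + env L := by simp [env]
theorem bnd_append (K L : Ctx) : bnd (K ++ L) = bnd K + bnd L := by simp [bnd]
theorem thr_cons (F : Frame) (L : Ctx) : thr (F :: L) = F.rest.thr + thr L := by simp [thr]
theorem heap_cons (F : Frame) (L : Ctx) : heap (F :: L) = F.rest.heap + heap L := by simp [heap]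
theorem env_cons (F : Frame) (L : Ctx) : env (F :: L) = F.rest.env + env L := by simp [env]
theorem bnd_cons (F : Frame) (L : Ctx) : bnd (F :: L) = F.rest.bnd + bnd L := by simp [bnd]

end Ctx

theorem Tree.Good.of_arr {a b : Tree} (h : a.Good) (hab : Arr a.proc b.proc)
    (hs : b.state = a.state) (hv : b.Valid) : b.Good := by
  have h1 : b.heap = a.heap := congrArg State.heap hs
  have h2 : b.env = a.env := congrArg State.env hs
  exact ⟨hv, hab.wl h.wl, hab.cong.fn_eq ▸ h.closed, by rw [Tree.bnd, h1, h2]; exact h.nodup⟩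

/-- The whole process is closed, so a frame binds `x`; session names are distinct, so it is the cut
of the record `r` and not an exponential cut. This cut is pushed through the frames below it down to
the thread, and the state does not change because only the order of the frames does. -/
theorem Tree.Good.focus {K : Ctx} {t : Proc} {r : Rec} {x : Name}
    (h : (Ctx.fill K (.leaf t)).Good) (hx : x ∈ t.fn) (hr : r ∈ (Ctx.fill K (.leaf t)).heap)
    (hxr : x ∈ r.ends) :
    ∃ (K₁ : Ctx) (F : Frame) (K₂ : Ctx), K = K₁ ++ F :: K₂ ∧ F.hole = some x ∧ F.rcd = some r ∧
      (Ctx.fill (K₁ ++ K₂) (F.fill (.leaf t))).Good ∧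
      Arr (Ctx.fill K (.leaf t)).proc (Ctx.fill (K₁ ++ K₂) (F.fill (.leaf t))).proc ∧
      (Ctx.fill (K₁ ++ K₂) (F.fill (.leaf t))).state = (Ctx.fill K (.leaf t)).state := by
  have hcl := h.closed
  rw [Ctx.proc_fill] at hcl
  obtain ⟨F, hF, hFx⟩ := Ctx.exists_hole (K := K) (P := t) (n := x) hx (by
    rw [show Ctx.app K t = Ctx.app K (Tree.leaf t).proc from rfl, hcl]; simp)
  obtain ⟨K₁, K₂, rfl⟩ := List.append_of_mem hF
  have hnd := h.nodup
  rw [Ctx.bnd_fill, Ctx.bnd_append, Ctx.bnd_cons] at hnd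
  have hnd1 : (F.rest.bnd + Ctx.bnd K₂).Nodup :=
    (Multiset.nodup_add.1 (Multiset.nodup_add.1 hnd).1).2.1
  have hd1 : ∀ n ∈ Ctx.bnd K₁, n ∉ Ctx.bnd K₂ := fun n h1 h2 =>
    Multiset.disjoint_left.1 (Multiset.nodup_add.1 (Multiset.nodup_add.1 hnd).1).2.2 h1
      (Multiset.mem_add.2 (.inr h2))
  have hd2 : ∀ n ∈ F.rest.bnd, n ∉ Ctx.bnd K₂ := fun n h1 h2 =>
    Multiset.disjoint_left.1 (Multiset.nodup_add.1 hnd1).2.2 h1 h2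
  rcases F.rcd_or_env hFx with ⟨r', hr', hr'F, hxr', hFc⟩ | hE
  · have e : r' = r := by
      refine eq_of_mem_ends h.nodup ?_ hr hxr' hxr
      rw [Ctx.heap_fill, Ctx.heap_append, Ctx.heap_cons]
      simp [hr'F]
    subst e
    have harr : Arr (Ctx.app (K₁ ++ F :: K₂) t) (Ctx.app (K₁ ++ K₂) (F.app t)) := by
      rw [Ctx.app_append, Ctx.app_append]
      refine Ctx.arr K₁ (Ctx.arr_push hFc hFx K₂ hx (fun G hG => ⟨fun e => ?_, fun c hc hcF => ?_⟩) ?_)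
      · exact hd2 x (Frame.hole_mem_bnd hFx) (Ctx.hole_mem_bnd hG e)
      -- A name `c` bound in `K₂` is not free in `F`: otherwise it would be free in the hole of
      -- `K₁`, so closedness would give a second binder for it there, against distinctness.
      · obtain ⟨F', hF', hc'⟩ := Ctx.exists_hole (K := K₁) (n := c)
          (P := F.app (Ctx.app K₂ t)) ((F.mem_fn_app _ c).2 (.inl hcF)) (by
            rw [← show Ctx.app (K₁ ++ F :: K₂) t = Ctx.app K₁ (F.app (Ctx.app K₂ t)) from
              Ctx.app_append _ _ _]
            rw [show Ctx.app (K₁ ++ F :: K₂) t = Ctx.app (K₁ ++ F :: K₂) (Tree.leaf t).proc from rfl,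
              hcl]
            simp)
        exact hd1 c (Ctx.hole_mem_bnd hF' hc') (Ctx.hole_mem_bnd hG hc)
      · have := h.wl
        rw [Ctx.proc_fill, Ctx.app_append] at this
        exact Ctx.wl_of_app K₁ this
    have hs : (Ctx.fill (K₁ ++ K₂) (F.fill (.leaf t))).state =
        (Ctx.fill (K₁ ++ F :: K₂) (.leaf t)).state := by
      simp only [Tree.state, Ctx.thr_fill, Ctx.heap_fill, Ctx.env_fill, Frame.thr_fill,
        Frame.heap_fill, Frame.env_fill, Ctx.thr_append, Ctx.heap_append, Ctx.env_append,
        Ctx.thr_cons, Ctx.heap_cons, Ctx.env_cons]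
      congr 1 <;> abel
    have harr' : Arr (Ctx.fill (K₁ ++ F :: K₂) (.leaf t)).proc
        (Ctx.fill (K₁ ++ K₂) (F.fill (.leaf t))).proc := by
      rw [Ctx.proc_fill, Ctx.proc_fill, Frame.proc_fill]; exact harr
    refine ⟨K₁, F, K₂, rfl, hFx, hr', h.of_arr harr' hs ?_, harr', hs⟩
    have hv := h.valid
    rw [Ctx.valid_fill] at hv ⊢
    rw [Frame.valid_fill]
    simp only [Ctx.Valid, List.mem_append, List.mem_cons] at hv ⊢
    exact ⟨fun G hG => hv.1 G (by tauto), hv.1 F (by simp), hv.2⟩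
  · exfalso
    refine not_mem_env_of_mem_ends h.nodup hr hxr ?_
    rw [Ctx.env_fill, Ctx.env_append, Ctx.env_cons]
    simp only [Multiset.map_add, Multiset.mem_add]
    exact .inl (.inr (.inl hE))

theorem Tree.Good.focus' {a : Tree} (h : a.Good) {t : Proc} {T : Multiset Proc} {r : Rec}
    {H : Heap} {E : Env} {x : Name} (hs : a.state = ⟨t ::ₘ T, r ::ₘ H, E⟩) (hx : x ∈ t.fn)
    (hxr : x ∈ r.ends) :
    ∃ (K : Ctx) (F : Frame), F.hole = some x ∧ F.rcd = some r ∧ (Ctx.fill K (F.fill (.leaf t))).Good ∧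
      Arr a.proc (Ctx.fill K (F.fill (.leaf t))).proc ∧ F.rest.thr + Ctx.thr K = T ∧
      F.rest.heap + Ctx.heap K = r ::ₘ H ∧ F.rest.env + Ctx.env K = E := by
  have h1 : a.thr = t ::ₘ T := congrArg State.threads hs
  have h2 : a.heap = r ::ₘ H := congrArg State.heap hs
  have h3 : a.env = E := congrArg State.env hs
  obtain ⟨K, rfl⟩ := Tree.exists_ctx (a := a) (t := t) (by rw [h1]; simp)
  obtain ⟨K₁, F, K₂, -, h4, h5, h6, h7, h8⟩ := h.focus hx (by rw [h2]; simp) hxr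
  refine ⟨K₁ ++ K₂, F, h4, h5, h6, h7, ?_⟩
  rw [hs, Tree.state] at h8
  simp only [Ctx.thr_fill, Ctx.heap_fill, Ctx.env_fill, Frame.thr_fill, Frame.heap_fill,
    Frame.env_fill, Tree.thr, Tree.heap, Tree.env, State.mk.injEq, add_zero] at h8
  refine ⟨?_, ?_, ?_⟩
  · have := h8.1
    rw [← Multiset.singleton_add] at this
    exact add_left_cancel (a := {t}) (by rw [← this]; abel)
  · rw [← h8.2.1, add_comm]
  · rw [← h8.2.2, add_comm]

/-- The frame of the record binds `x` in the hole. In a `rd` frame that would be the read endpoint,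
so `x` and `y` would coincide; hence the frame is `wr`, whose type is never void. The three variants
that follow are analogous. -/
theorem Tree.Good.focus_wr {a : Tree} (h : a.Good) {t : Proc} {T : Multiset Proc} {H : Heap}
    {E : Env} {x y : Name} {A B : EndTy} {q : Queue} {R : Proc}
    (hs : a.state = ⟨t ::ₘ T, .seq x A q R y B ::ₘ H, E⟩) (hx : x ∈ t.fn) :
    ∃ (K : Ctx) (A' : Ty), A = some A' ∧ (Ctx.fill K (.wr x A' q y B (.leaf t) R)).Good ∧
      Arr a.proc (Ctx.fill K (.wr x A' q y B (.leaf t) R)).proc ∧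
      Ctx.thr K = T ∧ Ctx.heap K = H ∧ Ctx.env K = E := by
  obtain ⟨K, F, h1, h2, h3, h4, h5, h6, h7⟩ := h.focus' hs hx (by simp [Rec.ends])
  have hn := h3.nodup
  cases F <;> simp only [Frame.rcd, Frame.hole, Option.some.injEq, Rec.seq.injEq, reduceCtorEq] at h1 h2
  case wr =>
    obtain ⟨rfl, rfl, rfl, rfl, rfl, rfl⟩ := h2
    exact ⟨K, _, rfl, h3, h4, by simpa [Frame.rest, Frame.fill, Tree.thr] using h5,
      by simpa [Frame.rest, Frame.fill, Tree.heap] using h6,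
      by simpa [Frame.rest, Frame.fill, Tree.env] using h7⟩
  case rd =>
    obtain ⟨rfl, rfl, rfl, rfl, rfl, rfl⟩ := h2
    subst h1
    rw [Ctx.bnd_fill, Multiset.nodup_add] at hn
    simp [Frame.fill, Tree.bnd, Tree.heap, Tree.env, Rec.ends, binders] at hn

theorem Tree.Good.focus_rd {a : Tree} (h : a.Good) {t : Proc} {T : Multiset Proc} {H : Heap}
    {E : Env} {x y : Name} {A B : EndTy} {q : Queue} {R : Proc}
    (hs : a.state = ⟨t ::ₘ T, .seq x A q R y B ::ₘ H, E⟩) (hy : y ∈ t.fn) :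
    ∃ K : Ctx, (Ctx.fill K (.rd x A q y B R (.leaf t))).Good ∧
      Arr a.proc (Ctx.fill K (.rd x A q y B R (.leaf t))).proc ∧
      Ctx.thr K = T ∧ Ctx.heap K = H ∧ Ctx.env K = E := by
  obtain ⟨K, F, h1, h2, h3, h4, h5, h6, h7⟩ := h.focus' hs hy (by simp [Rec.ends])
  have hn := h3.nodup
  cases F <;> simp only [Frame.rcd, Frame.hole, Option.some.injEq, Rec.seq.injEq, reduceCtorEq] at h1 h2
  case rd =>
    obtain ⟨rfl, rfl, rfl, rfl, rfl, rfl⟩ := h2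
    exact ⟨K, h3, h4, by simpa [Frame.rest, Frame.fill, Tree.thr] using h5,
      by simpa [Frame.rest, Frame.fill, Tree.heap] using h6,
      by simpa [Frame.rest, Frame.fill, Tree.env] using h7⟩
  case wr =>
    obtain ⟨rfl, rfl, rfl, rfl, rfl, rfl⟩ := h2
    subst h1
    rw [Ctx.bnd_fill, Multiset.nodup_add] at hn
    simp [Frame.fill, Tree.bnd, Tree.heap, Tree.env, Rec.ends, binders] at hn

theorem Tree.Good.focus_pcL {a : Tree} (h : a.Good) {t : Proc} {T : Multiset Proc} {H : Heap}
    {E : Env} {x y : Name} {A B : EndTy} {q : Queue}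
    (hs : a.state = ⟨t ::ₘ T, .conc x A q y B ::ₘ H, E⟩) (hx : x ∈ t.fn) :
    ∃ (K : Ctx) (b : Tree), (Ctx.fill K (.pc x A q y B (.leaf t) b)).Good ∧
      Arr a.proc (Ctx.fill K (.pc x A q y B (.leaf t) b)).proc ∧
      b.thr + Ctx.thr K = T ∧ b.heap + Ctx.heap K = H ∧ b.env + Ctx.env K = E := by
  obtain ⟨K, F, h1, h2, h3, h4, h5, h6, h7⟩ := h.focus' hs hx (by simp [Rec.ends])
  have hn := h3.nodup
  cases F <;> simp only [Frame.rcd, Frame.hole, Option.some.injEq, Rec.conc.injEq, reduceCtorEq] at h1 h2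
  case pcL =>
    obtain ⟨rfl, rfl, rfl, rfl, rfl⟩ := h2
    exact ⟨K, _, h3, h4, by simpa [Frame.rest, Frame.fill, Tree.thr] using h5,
      by simpa [Frame.rest, Frame.fill, Tree.heap] using h6,
      by simpa [Frame.rest, Frame.fill, Tree.env] using h7⟩
  case pcR =>
    obtain ⟨rfl, rfl, rfl, rfl, rfl⟩ := h2
    subst h1
    rw [Ctx.bnd_fill, Multiset.nodup_add] at hn
    simp [Frame.fill, Tree.bnd, Tree.heap, Tree.env, Rec.ends, binders] at hn

theorem Tree.Good.focus_pcR {a : Tree} (h : a.Good) {t : Proc} {T : Multiset Proc} {H : Heap}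
    {E : Env} {x y : Name} {A B : EndTy} {q : Queue}
    (hs : a.state = ⟨t ::ₘ T, .conc x A q y B ::ₘ H, E⟩) (hy : y ∈ t.fn) :
    ∃ (K : Ctx) (b : Tree), (Ctx.fill K (.pc x A q y B b (.leaf t))).Good ∧
      Arr a.proc (Ctx.fill K (.pc x A q y B b (.leaf t))).proc ∧
      b.thr + Ctx.thr K = T ∧ b.heap + Ctx.heap K = H ∧ b.env + Ctx.env K = E := by
  obtain ⟨K, F, h1, h2, h3, h4, h5, h6, h7⟩ := h.focus' hs hy (by simp [Rec.ends])
  have hn := h3.nodup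
  cases F <;> simp only [Frame.rcd, Frame.hole, Option.some.injEq, Rec.conc.injEq, reduceCtorEq] at h1 h2
  case pcR =>
    obtain ⟨rfl, rfl, rfl, rfl, rfl⟩ := h2
    exact ⟨K, _, h3, h4, by simpa [Frame.rest, Frame.fill, Tree.thr] using h5,
      by simpa [Frame.rest, Frame.fill, Tree.heap] using h6,
      by simpa [Frame.rest, Frame.fill, Tree.env] using h7⟩
  case pcL =>
    obtain ⟨rfl, rfl, rfl, rfl, rfl⟩ := h2
    subst h1
    rw [Ctx.bnd_fill, Multiset.nodup_add] at hn
    simp [Frame.fill, Tree.bnd, Tree.heap, Tree.env, Rec.ends, binders] at hn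

/-- A name of a session record and of an environment do not escape from their scope. -/
theorem Tree.Good.not_mem_fn {K : Ctx} {a : Tree} (h : (Ctx.fill K a).Good) {n : Name}
    (hn : n ∈ a.bnd) : n ∉ a.proc.fn := by
  intro h'
  have hc := h.closed
  rw [Ctx.proc_fill] at hc
  obtain ⟨F, hF, e⟩ := Ctx.exists_hole (K := K) h' (by rw [hc]; simp)
  have hd := h.nodup
  rw [Ctx.bnd_fill, Multiset.nodup_add, Multiset.disjoint_left] at hd
  exact hd.2.2 (Ctx.hole_mem_bnd hF e) hn

theorem Tree.Good.of_fill {K : Ctx} {a : Tree} (h : (Ctx.fill K a).Good) :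
    Ctx.Valid K ∧ a.Valid ∧ a.proc.WL :=
  ⟨((Ctx.valid_fill _ _).1 h.valid).1, ((Ctx.valid_fill _ _).1 h.valid).2,
    Ctx.wl_of_app K (Ctx.proc_fill K a ▸ h.wl)⟩

/-- Focusing is applied twice. The first time makes `F` the innermost frame; the second time pulls
`G` out from above `F` and places it below, so both end up next to the forwarder. -/
theorem Tree.Good.focus₂ {a : Tree} (h : a.Good) {t : Proc} {T : Multiset Proc} {r r' : Rec}
    {H : Heap} {E : Env} {x y : Name} (hs : a.state = ⟨t ::ₘ T, r ::ₘ r' ::ₘ H, E⟩)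
    (hx : x ∈ t.fn) (hy : y ∈ t.fn) (hxr : x ∈ r.ends) (hyr : y ∈ r'.ends) :
    ∃ (K : Ctx) (F G : Frame), F.hole = some x ∧ F.rcd = some r ∧ G.hole = some y ∧
      G.rcd = some r' ∧ x ≠ y ∧ (Ctx.fill K (F.fill (G.fill (.leaf t)))).Good ∧
      Arr a.proc (Ctx.fill K (F.fill (G.fill (.leaf t)))).proc ∧
      F.rest.thr + G.rest.thr + Ctx.thr K = T ∧
      F.rest.heap + G.rest.heap + Ctx.heap K = r ::ₘ r' ::ₘ H ∧
      F.rest.env + G.rest.env + Ctx.env K = E := by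
  have hxy : x ≠ y := by
    rintro rfl
    have hn := h.nodup
    rw [Tree.bnd, show a.heap = _ from congrArg State.heap hs, binders_cons_rec,
      Multiset.nodup_add, Multiset.disjoint_left] at hn
    exact hn.2.2 hxr (by simp [hyr])
  obtain ⟨K', F, h1, h2, h3, h4, h5, h6, h7⟩ := h.focus' hs hx hxr
  have e : Ctx.fill K' (F.fill (.leaf t)) = Ctx.fill (K' ++ [F]) (.leaf t) :=
    (Ctx.fill_append K' [F] _).symm
  rw [e] at h3 h4
  obtain ⟨K₁, G, K₂, h8, h9, h10, h11, h12, h13⟩ := h3.focus hy (r := r') (by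
    rw [Ctx.heap_fill, Ctx.heap_append, Ctx.heap_cons, add_comm (Ctx.heap K'), add_assoc, add_assoc]
    simp only [Ctx.heap, List.map_nil, List.sum_nil, Tree.heap, zero_add, add_zero] at h6 ⊢
    rw [h6]; simp) hyr
  -- With nothing below `G`, it would be the innermost frame `F`, and then `x = y`. Otherwise the
  -- last frame of `K₂` is `F`.
  rcases List.eq_nil_or_concat K₂ with rfl | ⟨K₃, F', rfl⟩
  · exfalso
    have := (List.append_inj' h8 rfl).2
    simp only [List.cons.injEq, and_true] at this
    subst this
    exact hxy (Option.some.inj (h1.symm.trans h9))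
  · rw [List.concat_eq_append, ← List.cons_append, ← List.append_assoc] at h8
    obtain ⟨-, h8'⟩ := List.append_inj' h8 rfl
    simp only [List.cons.injEq, and_true] at h8'
    subst h8'
    have e' : Ctx.fill (K₁ ++ K₃.concat F) (G.fill (.leaf t)) =
        Ctx.fill (K₁ ++ K₃) (F.fill (G.fill (.leaf t))) := by
      rw [List.concat_eq_append, ← List.append_assoc]
      exact Ctx.fill_append _ [F] _
    rw [e'] at h11 h12 h13
    have h13' := h13.trans (congrArg Tree.state e.symm)
    simp only [Tree.state, Ctx.thr_fill, Ctx.heap_fill, Ctx.env_fill, Frame.thr_fill,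
      Frame.heap_fill, Frame.env_fill, Tree.thr, Tree.heap, Tree.env, State.mk.injEq,
      add_zero] at h13'
    refine ⟨K₁ ++ K₃, F, G, h1, h2, h9, h10, hxy, h11, h4.trans h12, ?_, ?_, ?_⟩
    · rw [← h5]
      refine add_right_cancel (b := {t}) ?_
      calc _ = _ := by abel
        _ = _ := h13'.1
        _ = _ := by abel
    · rw [← h6, add_comm _ (Ctx.heap K'), ← h13'.2.1]; abel
    · rw [← h7, add_comm _ (Ctx.env K'), ← h13'.2.2]; abel

/-! ### Simulation of the transitions on session records -/

/-- The process of `a` reduces to, or is congruent to, the process of a tree whose state is `C`. -/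
def Tree.Simulates (a : Tree) (C : State) : Prop :=
  ∃ b : Tree, (Red a.proc b.proc ∨ Cong a.proc b.proc) ∧ b.Valid ∧ b.state = C

/-- Reduces a case of the simulation to the redex `b`: an axiom from `b.proc` to some `v`, and a
tree `c` for `v` with the right local state. The context contributes the same to both states. -/
theorem Tree.simulates_of_red {a b c : Tree} {K : Ctx} {T H E} {v : Proc}
    (hb : (Ctx.fill K b).Good) (ha : Arr a.proc (Ctx.fill K b).proc) (h : Red b.proc v)
    (hv : Cong v c.proc) (hc : c.Valid) (hT : c.thr + Ctx.thr K = T) (hH : c.heap + Ctx.heap K = H)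
    (hE : c.env + Ctx.env K = E) : a.Simulates ⟨T, H, E⟩ := by
  refine ⟨Ctx.fill K c, .inl (.cong ha.cong ?_ (.refl _)), ?_, ?_⟩
  · rw [Ctx.proc_fill, Ctx.proc_fill]
    exact Ctx.red K (.cong (.refl _) h hv)
  · exact (Ctx.valid_fill _ _).2 ⟨hb.of_fill.1, hc⟩
  · rw [Tree.state, Ctx.thr_fill, Ctx.heap_fill, Ctx.env_fill, ← hT, ← hH, ← hE]
    congr 1 <;> rw [add_comm]

theorem Tree.simulates_of_cong {a b c : Tree} {K : Ctx} {T H E}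
    (hb : (Ctx.fill K b).Good) (ha : Arr a.proc (Ctx.fill K b).proc) (hv : Cong b.proc c.proc)
    (hc : c.Valid) (hT : c.thr + Ctx.thr K = T) (hH : c.heap + Ctx.heap K = H)
    (hE : c.env + Ctx.env K = E) : a.Simulates ⟨T, H, E⟩ := by
  refine ⟨Ctx.fill K c, .inr (.trans ha.cong ?_), ?_, ?_⟩
  · rw [Ctx.proc_fill, Ctx.proc_fill]
    exact Ctx.cong K hv
  · exact (Ctx.valid_fill _ _).2 ⟨hb.of_fill.1, hc⟩
  · rw [Tree.state, Ctx.thr_fill, Ctx.heap_fill, Ctx.env_fill, ← hT, ← hH, ← hE]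
    congr 1 <;> rw [add_comm]

-- Polarities and side conditions of the redexes.

theorem Tree.eq_nil_of_proc {a : Tree} (h : a.proc = .nil) (hv : a.Valid) : a = .nil := by
  cases a with
  | nil => rfl
  | leaf t => exact absurd (show IsAction t from hv) (by rw [show t = .nil from h]; rintro ⟨⟩)
  | _ => cases h

theorem Rel.eq_nil {a : Tree} (h : Rel .nil a.proc) (hv : a.Valid) : a = .nil :=
  Tree.eq_nil_of_proc (h.sameNames.nil.1 rfl) hv

theorem EndTy.Neg.not_pos {A : EndTy} (h : A.Neg) : ¬ A.Pos := by
  rintro ⟨S, rfl, hS⟩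
  obtain ⟨S', e, hS'⟩ := h
  cases e
  exact hS' hS

theorem Ty.dual_pos (A : Ty) : A.dual.Pos ↔ ¬ A.Pos := by
  cases A <;> simp [Ty.dual, Ty.Pos]

/-- When a read empties the queue, a sequential record is always swapped, but the calculus swaps
only if the type of the writer is not positive. The two agree because a suspended writer never has a
positive type. After a swap the running reader has become the writer, hence a `wr` node. -/
theorem Tree.seqTurn {x A q y B} {P : Proc} {c : Tree} (hA : ¬ EndTy.Pos A)
    (hP : EndTy.Neg A ∨ P = .nil) (hc : c.Valid) :
    ∃ d : Tree, Cong (.cutPol .seq x A q y (some B) P c.proc) d.proc ∧ d.Valid ∧ d.thr = c.thr ∧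
      d.heap = Rec.seqTurn x A q P y (some B) ::ₘ c.heap ∧ d.env = c.env := by
  by_cases hq : q = []
  · subst hq
    refine ⟨.wr y B [] x A c P, ?_, hc, rfl, ?_, rfl⟩
    · rw [Proc.cutPol, if_pos ⟨rfl, hA⟩]; exact Cong.struct .comm
    · simp [Tree.heap, Rec.seqTurn]
  · refine ⟨.rd x A q y (some B) P c, ?_, ⟨hP, hc⟩, rfl, ?_, rfl⟩
    · rw [Proc.cutPol, if_neg (fun h => hq h.1)]; exact .refl _
    · simp [Tree.heap, Rec.seqTurn, hq]

theorem Tree.concTurn {x A q y B} {b c : Tree} (hb : b.Valid) (hc : c.Valid) :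
    ∃ d : Tree, Cong (.cutPol .conc x A q y B b.proc c.proc) d.proc ∧ d.Valid ∧
      d.thr = b.thr + c.thr ∧ d.heap = Rec.concTurn x A q y B ::ₘ (b.heap + c.heap) ∧
      d.env = b.env + c.env := by
  by_cases hq : q = [] ∧ ¬ EndTy.Pos A
  · refine ⟨.pc y B q x A c b, ?_, ⟨hc, hb⟩, add_comm _ _, ?_, add_comm _ _⟩
    · rw [Proc.cutPol, if_pos hq]; exact Cong.struct .comm
    · rw [Rec.concTurn, if_pos hq, add_comm b.heap]; rfl
  · refine ⟨.pc x A q y B b c, ?_, ⟨hb, hc⟩, rfl, ?_, rfl⟩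
    · rw [Proc.cutPol, if_neg hq]; exact .refl _
    · rw [Rec.concTurn, if_neg hq]; rfl

/-- The cut that composes a closure with the running receiver, after the choice of new names for
its endpoints. -/
theorem cutPol_run_right {S S' : Ty} {z w e f : Name} {R Q : Proc} {σ : Tree}
    (hS' : ¬ S'.Pos) (he : e ∉ Q.fn \ {w}) (hf : f ∉ R.fn \ {z}) (hσ : Rel (Q.ren w e) σ.proc) :
    Cong (.cutPol .seq z (some S') [] w (some S) R Q)
      (Tree.wr e S [] f (some S') σ (R.ren z f)).proc := by
  rw [Proc.cutPol, if_pos ⟨rfl, fun ⟨_, h, h'⟩ => hS' (by cases h; exact h')⟩]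
  exact .trans (Cong.struct .comm) (.trans (Rel.ren_left he).cong
    (.trans (Rel.ren_right hf).cong (.cut hσ.cong (.refl _))))

theorem cutPol_run_left {S S' : Ty} {z w e f : Name} {R Q : Proc} {σ : Tree}
    (hS' : S'.Pos) (he : e ∉ R.fn \ {z}) (hf : f ∉ Q.fn \ {w}) (hσ : Rel (R.ren z e) σ.proc) :
    Cong (.cutPol .seq z (some S') [] w (some S) R Q)
      (Tree.wr e S' [] f (some S) σ (Q.ren w f)).proc := by
  rw [Proc.cutPol, if_neg (fun h => h.2 ⟨_, rfl, hS'⟩)]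
  exact .trans (Rel.ren_left he).cong
    (.trans (Rel.ren_right hf).cong (.cut hσ.cong (.refl _)))

/-- If the suspended writer has terminated, its endpoint is void: `nil` uses no name, while `WL`
asks that a non-void endpoint be used. -/
theorem Tree.Good.reader {K : Ctx} {x A q y B R} {a : Tree}
    (h : (Ctx.fill K (.rd x A q y B R a)).Good) : (EndTy.Neg A ∨ R = .nil) ∧ ¬ EndTy.Pos A := by
  obtain ⟨-, h2, h3⟩ := h.of_fill
  refine ⟨h2.1, ?_⟩
  rcases h2.1 with h | rfl
  · exact h.not_pos
  · rintro ⟨S, rfl, -⟩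
    exact h3.2.2.2.2.1 (by simp)

theorem fwd_redex {m z A q₁ x B₁ y B₂ q₂ w C} {Q P : Proc} {u v : Name}
    (huv : (u = x ∧ v = y) ∨ (u = y ∧ v = x)) (hxy : x ≠ y)
    (hw : (Proc.cut m .left z A q₁ x B₁ Q (.cut m .left y B₂ q₂ w C (.fwd u v) P)).WL) :
    Red (.cut m .left z A q₁ x B₁ Q (.cut m .left y B₂ q₂ w C (.fwd u v) P))
      (.cut m .left z A (q₂ ++ q₁) w C Q P) := by
  -- The owner of `x` is a cut and not `nil`, so the type `B₁` is not void. Linearity of `x` and its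
  -- occurrence in the forwarder then exclude it from `q₂` and `P`, as `fwdp` demands.
  have hx : x ∈ (Proc.cut m .left y B₂ q₂ w C (.fwd u v) P).lin := by
    refine hw.2.2.2.2.2 fun hB => ?_
    cases hw.2.2.2.1 hB
  have h1 : x ∉ Queue.fn q₂ ∧ x ∉ P.fn \ {w} := by
    have hf : x ∈ (Proc.fwd u v).fn \ {y} := by
      refine ⟨?_, hxy⟩
      rcases huv with ⟨rfl, rfl⟩ | ⟨rfl, rfl⟩ <;> simp [Proc.fn]
    rcases hx with (h | h) | h
    · exact not_or.1 h.2
    · exact absurd (.inr hf) h.2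
    · exact absurd (.inl hf) h.2
  have hr : Red (.cut m .left z A q₁ x B₁ Q (.cut m .left y B₂ q₂ w C (.fwd x y) P))
      (.cut m .left z A (q₂ ++ q₁) w C Q P) := .fwdp hxy h1.1 h1.2
  rcases huv with ⟨rfl, rfl⟩ | ⟨rfl, rfl⟩
  · exact hr
  · exact .cong (.cut (.refl _) (.cut (Cong.struct .fwd) (.refl _))) hr (.refl _)

theorem NegAction.mem_fn {P : Proc} {x : Name} (h : NegAction P x) : x ∈ P.fn := by
  cases h <;> simp [Proc.fn]

theorem cons_add_eq {α : Type*} {A B C D : Multiset α} {r : α} (h : A + B = C + D) :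
    r ::ₘ A + B = r ::ₘ C + D := by
  rw [Multiset.cons_add, Multiset.cons_add, h]

/-- The endpoints are not bound in the queue; an endpoint occurring there would be free in the cut,
against closedness and distinctness. This gives the side condition of `Red.parr`. -/
theorem Tree.Good.not_mem_queue {K : Ctx} {x A q y B R} {a : Tree} {n : Name} {v : Val}
    (h : (Ctx.fill K (.rd x A (v :: q) y B R a)).Good) (hn : n = x ∨ n = y) : n ∉ v.fn := by
  intro h'
  refine h.not_mem_fn (n := n) ?_ ?_
  · simp [Tree.bnd, Tree.heap, Rec.ends, hn, ← or_assoc]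
  · simp [Tree.proc, Proc.fn, Queue.fn, h']

theorem Tree.Good.not_mem_queue_pc {K : Ctx} {x A q y B} {a b : Tree} {n : Name} {v : Val}
    (h : (Ctx.fill K (.pc x A (v :: q) y B a b)).Good) (hn : n = x ∨ n = y) : n ∉ v.fn := by
  intro h'
  refine h.not_mem_fn (n := n) ?_ ?_
  · simp [Tree.bnd, Tree.heap, Rec.ends, hn, ← or_assoc]
  · simp [Tree.proc, Proc.fn, Queue.fn, h']

/-- In each case the thread is brought next to its record, linearity supplies the side condition of
the matching axiom, and the tree `σ` of the new running process takes the place of the leaf. -/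
theorem Tree.Good.simulates_of_ne_call {a : Tree} (h : a.Good) {t N : Proc} {T H H' E E'}
    (hs : a.state = ⟨t ::ₘ T, H, E⟩) (ht : IsAction t) (hst : ThreadStep (t, H, E) (N, H', E'))
    {σ : Tree} (hσ : Rel N σ.proc) (hv : σ.Valid) (hc : ∀ y w Q, t ≠ .call y w Q) :
    a.Simulates ⟨σ.thr + T, H' + σ.heap, E' + σ.env⟩ := by
  cases hst with
  | cut_left | cut_right | cutB => cases ht
  | call_pos | call_neg => exact absurd rfl (hc _ _ _)
  | @fwd u v x y z A q₁ Q B₁ B₂ q₂ _ w C _ _ huv =>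
    have hx : x ∈ (Proc.fwd u v).fn := by
      rcases huv with ⟨rfl, rfl⟩ | ⟨rfl, rfl⟩ <;> simp [Proc.fn]
    have hy : y ∈ (Proc.fwd u v).fn := by
      rcases huv with ⟨rfl, rfl⟩ | ⟨rfl, rfl⟩ <;> simp [Proc.fn]
    obtain ⟨K, F, G, h1, h2, h3, h4, hxy, h5, h6, h7, h8, h9⟩ :=
      h.focus₂ hs hx hy (by simp [Rec.ends]) (by simp [Rec.ends])
    have hn := h5.nodup
    cases F <;> simp only [Frame.rcd, Frame.hole, Option.some.injEq, Rec.seq.injEq,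
      reduceCtorEq] at h1 h2
    -- The forwarder is the reader at `x` and the writer at `y`, so the frames must be `rd` and
    -- `wr`; any other combination identifies two endpoints.
    case wr =>
      obtain ⟨rfl, rfl, rfl, rfl, rfl, rfl⟩ := h2
      subst h1
      rw [Ctx.bnd_fill, Multiset.nodup_add] at hn
      simp [Frame.fill, Tree.bnd, Tree.heap, Tree.env, Rec.ends] at hn
    cases G <;> simp only [Frame.rcd, Frame.hole, Option.some.injEq, Rec.seq.injEq,
      reduceCtorEq] at h3 h4
    case rd =>
      obtain ⟨rfl, rfl, rfl, rfl, rfl, rfl⟩ := h4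
      subst h3
      rw [Ctx.bnd_fill, Multiset.nodup_add] at hn
      simp [Frame.fill, Tree.bnd, Tree.heap, Tree.env, Rec.ends, binders] at hn
    case wr =>
    obtain ⟨rfl, rfl, rfl, rfl, rfl, rfl⟩ := h2
    obtain ⟨rfl, rfl, rfl, rfl, rfl, rfl⟩ := h4
    simp only [Frame.rest, Frame.fill, Tree.thr, Tree.heap, Tree.env, zero_add,
      Multiset.cons_zero, Multiset.singleton_add, Multiset.cons_add, Multiset.cons_inj_right] at h7 h8 h9
    obtain ⟨rfl, rfl, rfl⟩ := And.intro h7 (And.intro h8 h9)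
    -- The owner of the read endpoint `w` now runs and `Q` stays suspended, so the merged cut is a
    -- `rd` node, valid because the first record was one.
    exact Tree.simulates_of_red (c := .rd _ _ _ _ _ _ σ) h5 h6
      (fwd_redex huv hxy h5.of_fill.2.2) (.cut (.refl _) hσ.cong) ⟨h5.reader.1, hv⟩ rfl
      (cons_add_eq (add_comm _ _)) (add_comm _ _)
  | @neg _ x A q R y B _ _ hn hA =>
    obtain ⟨K, A, rfl, h1, h2, rfl, rfl, rfl⟩ := h.focus_wr hs hn.mem_fn
    -- The same cut with the other side running: no reduction takes place.
    exact Tree.simulates_of_cong (c := .rd x (some A) q y B t σ) h1 h2 (.cut (.refl _) hσ.cong)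
      ⟨.inl hA, hv⟩ rfl (cons_add_eq (add_comm _ _)) (add_comm _ _)
  | @one x q R y B =>
    obtain ⟨K, A, e, h1, h2, rfl, rfl, rfl⟩ := h.focus_wr hs (by simp [Proc.fn])
    cases e
    exact Tree.simulates_of_red (c := .rd x none (q ++ [Val.tick]) y B .nil σ) h1 h2 .one
      (.cut (.refl _) hσ.cong) ⟨.inr rfl, hv⟩ rfl (cons_add_eq (add_comm _ _)) (add_comm _ _)
  | @bot x y R =>
    obtain ⟨K, h1, h2, rfl, rfl, rfl⟩ := h.focus_rd hs (by simp [Proc.fn])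
    have hy : y ∉ N.fn := by
      have : y ∈ (Proc.wait y N).lin := h1.of_fill.2.2.2.2.2.2.2 (by simp)
      simpa [Proc.lin] using this
    exact Tree.simulates_of_red (c := σ) h1 h2 (.bot hy) hσ.cong hv rfl (add_comm _ _)
      (add_comm _ _)
  | @tensor x z R Q S A q P y B =>
    obtain ⟨K, A, e, h1, h2, rfl, rfl, rfl⟩ := h.focus_wr hs (by simp [Proc.fn])
    cases e
    have hx : x ∉ R.fn \ {z} := by
      have : x ∈ (Proc.send x z R N).lin := h1.of_fill.2.2.2.2.2.2.1 (by simp)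
      simp only [Proc.lin, Set.mem_union, Set.mem_sdiff] at this ⊢
      simp at this
      tauto
    exact Tree.simulates_of_red (c := .wr x _ (q ++ [Val.clos z R]) y B σ P) h1 h2 (.tensor hx)
      (.cut hσ.cong (.refl _)) hv rfl (cons_add_eq (add_comm _ _)) (add_comm _ _)
  | @plus x L A l Q q P y B =>
    obtain ⟨K, A, e, h1, h2, rfl, rfl, rfl⟩ := h.focus_wr hs (by simp [Proc.fn])
    cases e
    exact Tree.simulates_of_red (c := .wr x _ (q ++ [Val.lab (l : Label)]) y B σ P) h1 h2 .plus
      (.cut hσ.cong (.refl _)) hv rfl (cons_add_eq (add_comm _ _)) (add_comm _ _)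
  | @bang x z Q A q P y B =>
    obtain ⟨K, A, e, h1, h2, rfl, rfl, rfl⟩ := h.focus_wr hs (by simp [Proc.fn])
    cases e
    have hx : x ∉ Q.fn \ {z} := by
      have : x ∈ (Proc.bang x z Q).lin := h1.of_fill.2.2.2.2.2.2.1 (by simp)
      exact this.2
    exact Tree.simulates_of_red (c := .rd x none (q ++ [Val.closB z Q]) y B .nil σ) h1 h2 (.bang hx)
      (.cut (.refl _) hσ.cong) ⟨.inr rfl, hv⟩ rfl (cons_add_eq (add_comm _ _)) (add_comm _ _)
  | @why y Q x z R A =>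
    obtain ⟨K, h1, h2, rfl, rfl, rfl⟩ := h.focus_rd hs (by simp [Proc.fn])
    exact Tree.simulates_of_red (c := .ex y A.dual z R σ) h1 h2 .why (.cutB (.refl _) hσ.cong) hv rfl
      (add_comm _ _) (cons_add_eq (add_comm _ _))
  | @amp y L' Q x A l q P L B _ _ hl hl' =>
    obtain ⟨K, h1, h2, rfl, rfl, rfl⟩ := h.focus_rd hs (by simp [Proc.fn])
    obtain ⟨d, h3, h4, h5, h6, h7⟩ := Tree.seqTurn (x := x) (q := q) (y := y) (B := B ⟨l, hl⟩)
      h1.reader.2 h1.reader.1 hv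
    refine Tree.simulates_of_red h1 h2 (.amp hl hl') (.trans ?_ h3) h4 (by rw [h5])
      (by rw [h6]; exact cons_add_eq (add_comm _ _)) (by rw [h7, add_comm])
    exact .cut (.refl _) hσ.cong
  | @parr_pos y w Q x A z R q P S B _ _ e f hS hef he hf =>
    obtain ⟨K, h1, h2, rfl, rfl, rfl⟩ := h.focus_rd hs (by simp [Proc.fn])
    have h0 : e ∉ Q.fn \ {w} := fun h => he.1 (.inr h)
    have h0' : f ∉ R.fn \ {z} := fun h => hf.2 (.inl ⟨_, Multiset.mem_cons_self _ _,
      .inl (.inr (.inl h))⟩)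
    obtain ⟨d, h3, h4, h5, h6, h7⟩ := Tree.seqTurn (c := .wr e S [] f (some S.dual) σ (R.ren z f))
      (x := x) (q := q) (y := y) (B := B) h1.reader.2 h1.reader.1 hv
    refine Tree.simulates_of_red h1 h2 (.parr (h1.not_mem_queue (.inr rfl))) (.trans ?_ h3) h4
      (by rw [h5]; rfl) (by rw [h6]; simp only [Tree.heap, Multiset.cons_add]; rw [Multiset.cons_swap, add_comm])
      (by rw [h7]; exact add_comm _ _)
    -- The endpoint of the closure has the negative type `S.dual`, so the calculus marks the
    -- endpoint of the receiver, which is also the process that the machine runs.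
    exact .cut (.refl _) (cutPol_run_right (fun h => (Ty.dual_pos S).1 h hS) h0 h0' hσ)
  | @parr_neg y w Q x A z R q P S B _ _ e f hS hef he hf =>
    obtain ⟨K, h1, h2, rfl, rfl, rfl⟩ := h.focus_rd hs (by simp [Proc.fn])
    have h0 : f ∉ Q.fn \ {w} := fun h => hf.1 (.inr h)
    have h0' : e ∉ R.fn \ {z} := fun h => he.2 (.inl ⟨_, Multiset.mem_cons_self _ _,
      .inl (.inr (.inl h))⟩)
    obtain ⟨d, h3, h4, h5, h6, h7⟩ := Tree.seqTurn (c := .wr e S.dual [] f (some S) σ (Q.ren w f))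
      (x := x) (q := q) (y := y) (B := B) h1.reader.2 h1.reader.1 hv
    refine Tree.simulates_of_red h1 h2 (.parr (h1.not_mem_queue (.inr rfl))) (.trans ?_ h3) h4
      (by rw [h5]; rfl) (by rw [h6]; simp only [Tree.heap, Multiset.cons_add]; rw [Multiset.cons_swap, add_comm])
      (by rw [h7]; exact add_comm _ _)
    exact .cut (.refl _) (cutPol_run_left ((Ty.dual_pos S).2 hS) h0' h0 hσ)
  | @fwd_c u v x y z A q₁ B₁ B₂ q₂ w C _ _ huv =>
    have hx : x ∈ (Proc.fwd u v).fn := by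
      rcases huv with ⟨rfl, rfl⟩ | ⟨rfl, rfl⟩ <;> simp [Proc.fn]
    have hy : y ∈ (Proc.fwd u v).fn := by
      rcases huv with ⟨rfl, rfl⟩ | ⟨rfl, rfl⟩ <;> simp [Proc.fn]
    obtain ⟨K, F, G, h1, h2, h3, h4, hxy, h5, h6, h7, h8, h9⟩ :=
      h.focus₂ hs hx hy (by simp [Rec.ends]) (by simp [Rec.ends])
    have hn := h5.nodup
    cases F <;> simp only [Frame.rcd, Frame.hole, Option.some.injEq, Rec.conc.injEq,
      reduceCtorEq] at h1 h2
    case pcL =>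
      obtain ⟨rfl, rfl, rfl, rfl, rfl⟩ := h2
      subst h1
      rw [Ctx.bnd_fill, Multiset.nodup_add] at hn
      simp [Frame.fill, Tree.bnd, Tree.heap, Tree.env, Rec.ends] at hn
    cases G <;> simp only [Frame.rcd, Frame.hole, Option.some.injEq, Rec.conc.injEq,
      reduceCtorEq] at h3 h4
    case pcR =>
      obtain ⟨rfl, rfl, rfl, rfl, rfl⟩ := h4
      subst h3
      rw [Ctx.bnd_fill, Multiset.nodup_add] at hn
      simp [Frame.fill, Tree.bnd, Tree.heap, Tree.env, Rec.ends, Multiset.nodup_cons] at hn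
    case pcL =>
    rename_i a' _ _ _ _ _ b
    obtain ⟨rfl, rfl, rfl, rfl, rfl⟩ := h2
    obtain ⟨rfl, rfl, rfl, rfl, rfl⟩ := h4
    simp only [Frame.rest, Frame.fill, Tree.thr, Tree.heap, Tree.env, zero_add, add_zero,
      Multiset.cons_add, Multiset.add_cons] at h7 h8 h9
    rw [Multiset.cons_swap, Multiset.cons_inj_right, Multiset.cons_inj_right] at h8
    obtain ⟨rfl, rfl, rfl⟩ := And.intro h7 (And.intro h8 h9)
    -- On concurrent records the forwarder becomes `nil`, and both peers are threads already, so
    -- their trees are kept.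
    obtain rfl := hσ.eq_nil hv
    have hv' := h5.of_fill.2.1
    exact Tree.simulates_of_red (c := .pc _ _ _ _ _ a' b) h5 h6
      (fwd_redex huv hxy h5.of_fill.2.2) (.refl _) ⟨hv'.1, hv'.2.2⟩ (zero_add _).symm
      (cons_add_eq (add_zero _).symm) (add_zero _).symm
  | @one_c x q y B =>
    obtain ⟨K, b, h1, h2, rfl, rfl, rfl⟩ := h.focus_pcL hs (by simp [Proc.fn])
    obtain rfl := hσ.eq_nil hv
    exact Tree.simulates_of_red (c := .pc x none (q ++ [Val.tick]) y B .nil b) h1 h2 .one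
      (.refl _) ⟨trivial, h1.of_fill.2.1.2⟩ (by simp [Tree.thr]) (by simp [Tree.heap])
      (by simp [Tree.env])
  | @bang_c x z Q A q y B =>
    obtain ⟨K, b, h1, h2, rfl, rfl, rfl⟩ := h.focus_pcL hs (by simp [Proc.fn])
    obtain rfl := hσ.eq_nil hv
    have hx : x ∉ Q.fn \ {z} := by
      have : x ∈ (Proc.bang x z Q).lin := h1.of_fill.2.2.2.2.2.2.1 (by simp)
      exact this.2
    exact Tree.simulates_of_red (c := .pc x none (q ++ [Val.closB z Q]) y B .nil b) h1 h2 (.bang hx)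
      (.refl _) ⟨trivial, h1.of_fill.2.1.2⟩ (by simp [Tree.thr]) (by simp [Tree.heap])
      (by simp [Tree.env])
  | @bot_c x y R =>
    obtain ⟨K, b, h1, h2, rfl, rfl, rfl⟩ := h.focus_pcR hs (by simp [Proc.fn])
    -- The void write endpoint forces its owner to be `nil`, hence its tree adds nothing to the
    -- state when the cut disappears.
    obtain rfl := Tree.eq_nil_of_proc (h1.of_fill.2.2.2.2.1 rfl) h1.of_fill.2.1.1
    have hy : y ∉ N.fn := by
      have : y ∈ (Proc.wait y N).lin := h1.of_fill.2.2.2.2.2.2.2 (by simp)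
      simpa [Proc.lin] using this
    exact Tree.simulates_of_red (c := σ) h1 h2 (.bot hy) hσ.cong hv (by simp [Tree.thr])
      (by simp [Tree.heap, add_comm]) (by simp [Tree.env, add_comm])
  | @why_c y Q x z R A =>
    obtain ⟨K, b, h1, h2, rfl, rfl, rfl⟩ := h.focus_pcR hs (by simp [Proc.fn])
    obtain rfl := Tree.eq_nil_of_proc (h1.of_fill.2.2.2.2.1 rfl) h1.of_fill.2.1.1
    exact Tree.simulates_of_red (c := .ex y A.dual z R σ) h1 h2 .why (.cutB (.refl _) hσ.cong) hv
      (by simp [Tree.thr]) (by simp [Tree.heap, add_comm]) (by simp [Tree.env, add_comm])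
  | @tensor_c x z R Q S A q y B =>
    obtain ⟨K, b, h1, h2, rfl, rfl, rfl⟩ := h.focus_pcL hs (by simp [Proc.fn])
    have hx : x ∉ R.fn \ {z} := by
      have : x ∈ (Proc.send x z R N).lin := h1.of_fill.2.2.2.2.2.2.1 (by simp)
      simp only [Proc.lin, Set.mem_union, Set.mem_sdiff] at this ⊢
      simp at this
      tauto
    exact Tree.simulates_of_red (c := .pc x (some A) (q ++ [Val.clos z R]) y B σ b) h1 h2 (.tensor hx)
      (.cut hσ.cong (.refl _)) ⟨hv, h1.of_fill.2.1.2⟩ (add_assoc _ _ _)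
      (cons_add_eq (by abel)) (by simp only [Tree.env]; abel)
  | @plus_c x L A l Q q y B =>
    obtain ⟨K, b, h1, h2, rfl, rfl, rfl⟩ := h.focus_pcL hs (by simp [Proc.fn])
    exact Tree.simulates_of_red (c := .pc x (some (A l)) (q ++ [Val.lab (l : Label)]) y B σ b) h1 h2
      .plus (.cut hσ.cong (.refl _)) ⟨hv, h1.of_fill.2.1.2⟩ (add_assoc _ _ _)
      (cons_add_eq (by abel)) (by simp only [Tree.env]; abel)
  | @amp_c y L' Q x A l q L B _ _ hl hl' =>
    obtain ⟨K, b, h1, h2, rfl, rfl, rfl⟩ := h.focus_pcR hs (by simp [Proc.fn])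
    obtain ⟨d, h3, h4, h5, h6, h7⟩ := Tree.concTurn (x := x) (A := A) (q := q) (y := y)
      (B := some (B ⟨l, hl⟩)) h1.of_fill.2.1.1 hv
    refine Tree.simulates_of_red h1 h2 (.amp hl hl') (.trans ?_ h3) h4 (by rw [h5]; abel)
      (by rw [h6]; exact cons_add_eq (by abel)) (by rw [h7]; abel)
    exact .cut (.refl _) hσ.cong
  | @parr_pos_c y w Q x A z R q S B _ _ e f hS hef he hf =>
    obtain ⟨K, b, h1, h2, rfl, rfl, rfl⟩ := h.focus_pcR hs (by simp [Proc.fn])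
    have h0 : e ∉ Q.fn \ {w} := fun h => he.1 (.inr h)
    have h0' : f ∉ R.fn \ {z} := fun h => hf.2 (.inl ⟨_, Multiset.mem_cons_self _ _,
      .inr (.inl h)⟩)
    obtain ⟨d, h3, h4, h5, h6, h7⟩ := Tree.concTurn (c := .wr e S [] f (some S.dual) σ (R.ren z f))
      (x := x) (A := A) (q := q) (y := y) (B := some B) h1.of_fill.2.1.1 hv
    refine Tree.simulates_of_red h1 h2 (.parr (h1.not_mem_queue_pc (.inr rfl))) (.trans ?_ h3) h4
      (by rw [h5]; simp only [Tree.thr]; abel)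
      (by rw [h6]; simp only [Tree.heap, Multiset.cons_add, Multiset.add_cons]; rw [Multiset.cons_swap, add_right_comm])
      (by rw [h7]; simp only [Tree.env]; abel)
    exact .cut (.refl _) (cutPol_run_right (fun h => (Ty.dual_pos S).1 h hS) h0 h0' hσ)
  | @parr_neg_c y w Q x A z R q S B _ _ e f hS hef he hf =>
    obtain ⟨K, b, h1, h2, rfl, rfl, rfl⟩ := h.focus_pcR hs (by simp [Proc.fn])
    have h0 : f ∉ Q.fn \ {w} := fun h => hf.1 (.inr h)
    have h0' : e ∉ R.fn \ {z} := fun h => he.2 (.inl ⟨_, Multiset.mem_cons_self _ _,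
      .inr (.inl h)⟩)
    obtain ⟨d, h3, h4, h5, h6, h7⟩ := Tree.concTurn (c := .wr e S.dual [] f (some S) σ (Q.ren w f))
      (x := x) (A := A) (q := q) (y := y) (B := some B) h1.of_fill.2.1.1 hv
    refine Tree.simulates_of_red h1 h2 (.parr (h1.not_mem_queue_pc (.inr rfl))) (.trans ?_ h3) h4
      (by rw [h5]; simp only [Tree.thr]; abel)
      (by rw [h6]; simp only [Tree.heap, Multiset.cons_add, Multiset.add_cons]; rw [Multiset.cons_swap, add_right_comm])
      (by rw [h7]; simp only [Tree.env]; abel)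
    exact .cut (.refl _) (cutPol_run_left ((Ty.dual_pos S).2 hS) h0' h0 hσ)

/-! ### Distribution of exponential cuts -/

mutual
theorem Proc.finite_fn : ∀ P : Proc, P.fn.Finite
  | .nil => Set.finite_empty
  | .mix P Q => P.finite_fn.union Q.finite_fn
  | .fwd x y => (Set.finite_singleton y).insert x
  | .cut _ _ _ _ q _ _ P Q =>
    (P.finite_fn.sdiff.union (Queue.finite_fn q)).union Q.finite_fn.sdiff
  | .close x => Set.finite_singleton x
  | .wait x P => (Set.finite_singleton x).union P.finite_fn
  | .case x _ P => (Set.finite_singleton x).union (Set.finite_iUnion fun l => (P l).finite_fn)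
  | .sel x _ P => (Set.finite_singleton x).union P.finite_fn
  | .send x _ P Q => ((Set.finite_singleton x).union P.finite_fn.sdiff).union Q.finite_fn
  | .recv x _ P => (Set.finite_singleton x).union P.finite_fn.sdiff
  | .bang x _ P => (Set.finite_singleton x).union P.finite_fn.sdiff
  | .why x P => (Set.finite_singleton x).union P.finite_fn
  | .cutB _ _ _ P Q => P.finite_fn.sdiff.union Q.finite_fn.sdiff
  | .call x _ P => (Set.finite_singleton x).union P.finite_fn.sdiff
theorem Val.finite_fn : ∀ v : Val, v.fn.Finite
  | .tick => Set.finite_empty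
  | .lab _ => Set.finite_empty
  | .clos _ P => P.finite_fn.sdiff
  | .closB _ P => P.finite_fn.sdiff
theorem Queue.finite_fn : ∀ q : List Val, (Queue.fn q).Finite
  | [] => Set.finite_empty
  | v :: q => v.finite_fn.union (Queue.finite_fn q)
end

theorem exists_new (P Q : Proc) (x : Name) : ∃ n, n ∉ P.fn ∧ n ∉ Q.fn ∧ n ≠ x := by
  obtain ⟨n, hn⟩ := ((P.finite_fn.union Q.finite_fn).union (Set.finite_singleton x)).exists_notMem
  simp only [Set.mem_union, not_or, Set.mem_singleton_iff] at hn
  exact ⟨n, hn.1.1, hn.1.2, hn.2⟩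

/-- Up to alpha-conversion of its closures, every queue has a distribution. -/
theorem DistQueue.exists (x : Name) (A : Ty) (y : Name) (R : Proc) (q p : Queue) :
    ∃ q' q'', (∀ m s a A b B P Q, Cong (.cut m s a A (p ++ q) b B P Q)
      (.cut m s a A (p ++ q') b B P Q)) ∧ DistQueue x A y R q' q'' := by
  -- The prefix `p` holds the values whose binders have been renamed already.
  induction q generalizing p with
  | nil => exact ⟨[], [], fun _ _ _ _ _ _ _ _ => .refl _, .nil⟩
  | cons v q ih =>
    cases v with
    | tick =>
      obtain ⟨q', q'', h, h'⟩ := ih (p ++ [Val.tick])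
      exact ⟨.tick :: q', _, by simpa using h, .keep (by simp [Val.fn]) h'⟩
    | lab l =>
      obtain ⟨q', q'', h, h'⟩ := ih (p ++ [Val.lab l])
      exact ⟨.lab l :: q', _, by simpa using h, .keep (by simp [Val.fn]) h'⟩
    | clos z S =>
      obtain ⟨n, h1, h2, h3⟩ := exists_new S R x
      obtain ⟨q', q'', h, h'⟩ := ih (p ++ [Val.clos n (S.ren z n)])
      refine ⟨.clos n (S.ren z n) :: q', _, fun m s a A b B P Q => .trans (Cong.alpha (.cut_clos h1)) (?_ : Cong _ _),
        .clos h3 (fun h => h2 h.1) h'⟩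
      simpa using h m s a A b B P Q
    | closB z S =>
      obtain ⟨n, h1, h2, h3⟩ := exists_new S R x
      obtain ⟨q', q'', h, h'⟩ := ih (p ++ [Val.closB n (S.ren z n)])
      refine ⟨.closB n (S.ren z n) :: q', _, fun m s a A b B P Q => .trans (Cong.alpha (.cut_closB h1)) (?_ : Cong _ _),
        .closB h3 (fun h => h2 h.1) h'⟩
      simpa using h m s a A b B P Q

/-- The exponential cut of `y` with the server `z.R` can be moved to the hole of `K` by a change
of the context only. -/
def Ctx.Distributes (y : Name) (A : Ty) (z : Name) (R : Proc) (K : Ctx) : Prop :=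
  ∃ Z : Proc → Proc, (∀ u, Cong (.cutB y A z R (Ctx.app K u)) (Z (.cutB y A z R u))) ∧
    (∀ u v, Cong u v → Cong (Z u) (Z v)) ∧ ∀ u v, Red u v → Red (Z u) (Z v)

/-- Distribution copies the server into every other part of the frame, so it applies even if these
parts use `y`. The new frame does not depend on the process in the hole, which is why the
distribution can be undone after a reduction there. -/
theorem Frame.distributes {y : Name} {A : Ty} {z : Name} {R : Proc} (F : Frame)
    (h : ∀ n ∈ F.rest.bnd, n ≠ y ∧ n ∉ R.fn \ {z}) : Ctx.Distributes y A z R [F] := by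
  have hcut : ∀ {m a B q b C}, a ∈ F.rest.bnd → b ∈ F.rest.bnd → ∃ q', ∀ P Q,
      Cong (.cutB y A z R (.cut m .left a B q b C P Q))
        (.cut m .left a B q' b C (.cutB y A z R P) (.cutB y A z R Q)) := by
    intro m a B q b C ha hb
    obtain ⟨q', q'', h1, h2⟩ := DistQueue.exists y A z R q []
    exact ⟨q'', fun P Q => .trans (.cutB (.refl _) (h1 m .left a B b C P Q))
      (Cong.struct (.dist_cut (h a ha).1.symm (h b hb).1.symm (h a ha).2 (h b hb).2 h2))⟩
  cases F with
  | mixL b =>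
    exact ⟨fun u => .mix u (.cutB y A z R b.proc), fun u => Cong.struct .dist_mix,
      fun _ _ h => .mix h (.refl _), fun _ _ h => .mix_left h⟩
  | mixR a =>
    exact ⟨fun u => .mix (.cutB y A z R a.proc) u, fun u => Cong.struct .dist_mix,
      fun _ _ h => .mix (.refl _) h, fun _ _ h => .mix_right h⟩
  | wr a B q b C V =>
    obtain ⟨q', h'⟩ := hcut (m := .seq) (a := a) (B := some B) (q := q) (b := b) (C := C)
      (by simp [rest, fill, Tree.bnd, Tree.heap, Rec.ends, binders])
      (by simp [rest, fill, Tree.bnd, Tree.heap, Rec.ends, binders])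
    exact ⟨fun u => .cut .seq .left a (some B) q' b C u (.cutB y A z R V), fun u => h' _ _,
      fun _ _ h => .cut h (.refl _), fun _ _ h => .cut_left h⟩
  | rd a B q b C V =>
    obtain ⟨q', h'⟩ := hcut (m := .seq) (a := a) (B := B) (q := q) (b := b) (C := C)
      (by simp [rest, fill, Tree.bnd, Tree.heap, Rec.ends, binders])
      (by simp [rest, fill, Tree.bnd, Tree.heap, Rec.ends, binders])
    exact ⟨fun u => .cut .seq .left a B q' b C (.cutB y A z R V) u, fun u => h' _ _,
      fun _ _ h => .cut (.refl _) h, fun _ _ h => .cut_right h⟩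
  | pcL a B q b C V =>
    obtain ⟨q', h'⟩ := hcut (m := .conc) (a := a) (B := B) (q := q) (b := b) (C := C)
      (by simp [rest, fill, Tree.bnd, Tree.heap, Rec.ends, binders])
      (by simp [rest, fill, Tree.bnd, Tree.heap, Rec.ends, binders])
    exact ⟨fun u => .cut .conc .left a B q' b C u (.cutB y A z R V.proc), fun u => h' _ _,
      fun _ _ h => .cut h (.refl _), fun _ _ h => .cut_left h⟩
  | pcR a B q b C V =>
    obtain ⟨q', h'⟩ := hcut (m := .conc) (a := a) (B := B) (q := q) (b := b) (C := C)
      (by simp [rest, fill, Tree.bnd, Tree.heap, Rec.ends, binders])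
      (by simp [rest, fill, Tree.bnd, Tree.heap, Rec.ends, binders])
    exact ⟨fun u => .cut .conc .left a B q' b C (.cutB y A z R V.proc) u, fun u => h' _ _,
      fun _ _ h => .cut (.refl _) h, fun _ _ h => .cut_right h⟩
  | ex a B b V =>
    -- The argument name `b` of the inner server is not a session name and may clash with `y` or
    -- with names of `R`; it is renamed first.
    obtain ⟨n, h1, h2, h3⟩ := exists_new V R y
    have ha := h a (by simp [rest, fill, Tree.bnd, Tree.heap, Tree.env, binders])
    exact ⟨fun u => .cutB a B n (.cutB y A z R (V.ren b n)) u, fun u =>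
      .trans (.cutB (.refl _) (Cong.alpha (.cutB_left h1)))
        (Cong.struct (.dist_cutB ha.1.symm h3.symm ha.2 fun h => h2 h.1)),
      fun _ _ h => .cutB (.refl _) h, fun _ _ h => .cutB_right h⟩

theorem Ctx.distributes {y : Name} {A : Ty} {z : Name} {R : Proc} (K : Ctx)
    (h : ∀ n ∈ Ctx.bnd K, n ≠ y ∧ n ∉ R.fn \ {z}) : Ctx.Distributes y A z R K := by
  induction K with
  | nil => exact ⟨id, fun _ => .refl _, fun _ _ h => h, fun _ _ h => h⟩
  | cons F K ih =>
    rw [Ctx.bnd_cons] at h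
    obtain ⟨Z, h1, h2, h3⟩ := F.distributes (A := A) fun n hn => h n (Multiset.mem_add.2 (.inl hn))
    obtain ⟨Y, h4, h5, h6⟩ := ih fun n hn => h n (Multiset.mem_add.2 (.inr hn))
    exact ⟨fun u => Z (Y u), fun u => .trans (h1 _) (h2 _ _ (h4 u)), fun u v h => h2 _ _ (h5 _ _ h),
      fun u v h => h3 _ _ (h6 _ _ h)⟩

theorem Cong.cutPol_cutB {z w x y : Name} {A B : EndTy} {D : Ty} {P Q R : Proc}
    (h1 : x ∉ P.fn \ {z}) (h2 : x ≠ w) (h3 : w ∉ Q.fn \ {y}) :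
    Cong (.cutPol .seq z A [] w B P (.cutB x D y Q R))
      (.cutB x D y Q (.cutPol .seq z A [] w B P R)) :=
  Cong.struct (.cut_cutB h1 (by simp [Queue.fn]) h2 h3)

/-- The exponential cut is distributed to the hole and the call fires there. The axiom leaves the
exponential cut around the continuation only; its scope is extended to the new session, since `y` is
not free in the server, and the distribution is then reversed. -/
theorem Ctx.red_call {y : Name} {A : Ty} {z : Name} {R : Proc} {K : Ctx} {w : Name} {Q : Proc}
    (hK : ∀ n ∈ Ctx.bnd K, n ≠ y ∧ n ∉ R.fn \ {z}) (hy : y ∉ R.fn \ {z}) (hwy : w ≠ y)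
    (hw : w ∉ R.fn \ {z}) :
    Red (.cutB y A z R (Ctx.app K (.call y w Q)))
      (.cutB y A z R (Ctx.app K (.cutPol .seq z (some A) [] w (some A.dual) R Q))) := by
  obtain ⟨Z, h1, h2, h3⟩ := Ctx.distributes (A := A) K hK
  exact .cong (h1 _) (h3 _ _ (.call hwy hw))
    (.trans (h2 _ _ (Cong.cutPol_cutB hy hwy.symm hw)) (.symm (h1 _)))

/-- Unlike in `focus`, the tree is only decomposed and nothing moves: the exponential cut keeps its
scope. -/
theorem Tree.Good.focus_call {a : Tree} (h : a.Good) {t : Proc} {T : Multiset Proc} {H : Heap}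
    {E : Env} {y z : Name} {A : Ty} {R : Proc} (hs : a.state = ⟨t ::ₘ T, H, ⟨y, A, z, R⟩ ::ₘ E⟩)
    (hy : y ∈ t.fn) : ∃ K L : Ctx, a = Ctx.fill K (Frame.ex y A z R |>.fill (Ctx.fill L (.leaf t))) ∧
      Ctx.thr K + Ctx.thr L = T ∧ Ctx.heap K + Ctx.heap L = H ∧ Ctx.env K + Ctx.env L = E := by
  have h1 : a.thr = t ::ₘ T := congrArg State.threads hs
  have h2 : a.heap = H := congrArg State.heap hs
  have h3 : a.env = ⟨y, A, z, R⟩ ::ₘ E := congrArg State.env hs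
  obtain ⟨K', rfl⟩ := Tree.exists_ctx (a := a) (t := t) (by rw [h1]; simp)
  have hcl := h.closed
  rw [Ctx.proc_fill] at hcl
  obtain ⟨F, hF, hFy⟩ := Ctx.exists_hole (K := K') (P := t) (n := y) hy (by
    rw [show Ctx.app K' t = Ctx.app K' (Tree.leaf t).proc from rfl, hcl]; simp)
  obtain ⟨K, L, rfl⟩ := List.append_of_mem hF
  have hnd := h.nodup
  rw [Ctx.thr_fill, Ctx.thr_append, Ctx.thr_cons] at h1
  rw [Ctx.heap_fill, Ctx.heap_append, Ctx.heap_cons] at h2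
  have h3' := h3
  rw [Ctx.env_fill, Ctx.env_append, Ctx.env_cons] at h3
  rw [Tree.bnd, h3'] at hnd
  have hex : F = .ex y A z R := by
    have hrec : ∀ r ∈ F.rest.heap, y ∉ r.ends := by
      intro r hr hyr
      refine not_mem_env_of_mem_ends hnd (r := r) ?_ hyr (by simp)
      rw [Ctx.heap_fill, Ctx.heap_append, Ctx.heap_cons]
      simp [hr]
    cases F with
    | mixL | mixR => cases hFy
    | wr | rd | pcL | pcR =>
      cases hFy
      exact absurd (by simp [Rec.ends]) (hrec _ (Multiset.mem_cons_self _ _))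
    | ex y' A' z' R' =>
      cases hFy
      have hm : (⟨y, A', z', R'⟩ : Bind) ∈ (⟨y, A, z, R⟩ : Bind) ::ₘ E := by
        rw [← h3]; simp [Frame.rest, Frame.fill, Tree.env]
      rcases Multiset.mem_cons.1 hm with e | hm
      · cases e; rfl
      · exfalso
        rw [binders, Multiset.nodup_add, Multiset.map_cons, Multiset.nodup_cons] at hnd
        exact hnd.2.1.1 (Multiset.mem_map.2 ⟨_, hm, rfl⟩)
  subst hex
  simp only [Frame.rest, Frame.fill, Tree.thr, Tree.heap, Tree.env, zero_add, add_zero,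
    Multiset.cons_add, Multiset.add_cons] at h1 h2 h3
  refine ⟨K, L, Ctx.fill_append _ _ _, ?_, h2, ?_⟩
  · rw [add_comm, Multiset.singleton_add] at h1
    exact (Multiset.cons_inj_right t).1 h1
  · exact (Multiset.cons_inj_right _).1 h3

/-- The name `e` is the one that the machine gives to the endpoint of the caller. Renaming the bound
name of the call to `e` beforehand makes it differ from `y` and avoid the free names of the server.
-/
theorem Tree.Good.simulates_call {a : Tree} (h : a.Good) {T : Multiset Proc} {H : Heap} {E : Env}
    {y z w e : Name} {A : Ty} {R Q : Proc} {c : Tree}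
    (hs : a.state = ⟨.call y w Q ::ₘ T, H, ⟨y, A, z, R⟩ ::ₘ E⟩)
    (he : New e (.call y w Q) H (⟨y, A, z, R⟩ ::ₘ E))
    (hc : Cong (.cutPol .seq z (some A) [] e (some A.dual) R (Q.ren w e)) c.proc) (hv : c.Valid) :
    a.Simulates ⟨c.thr + T, c.heap + H, c.env + ⟨y, A, z, R⟩ ::ₘ E⟩ := by
  obtain ⟨K, L, rfl, rfl, rfl, rfl⟩ := h.focus_call hs (by simp [Proc.fn])
  have hn : ∀ n ∈ Ctx.bnd L, n ≠ y ∧ n ∉ R.fn \ {z} := by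
    intro n hn
    have hb : n ∈ ((Frame.ex y A z R).fill (Ctx.fill L (.leaf (.call y w Q)))).bnd := by
      simp only [Frame.fill, Tree.bnd, Tree.heap, Tree.env, binders_cons_bind, Multiset.mem_cons]
      exact .inr (by rw [← Tree.bnd, Ctx.bnd_fill]; simp [hn])
    refine ⟨?_, fun h' => h.not_mem_fn hb (.inl h')⟩
    rintro rfl
    have hd := h.nodup
    rw [Ctx.bnd_fill, Multiset.nodup_add] at hd
    have := hd.2.1
    simp only [Frame.fill, Tree.bnd, Tree.heap, Tree.env, binders_cons_bind, Multiset.nodup_cons] at this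
    exact this.1 (by rw [← Tree.bnd, Ctx.bnd_fill]; simp [hn])
  have hy : y ∉ R.fn \ {z} := fun h' => h.not_mem_fn
    (by simp [Frame.fill, Tree.bnd, Tree.heap, Tree.env]) (.inl h')
  have he1 : e ≠ y := fun h' => he.1 (.inl h')
  have he2 : e ∉ R.fn \ {z} := fun h' =>
    he.2 (.inr ⟨_, Multiset.mem_cons_self _ _, .inr h'⟩)
  have he3 : Cong (.call y w Q) (.call y e (Q.ren w e)) := by
    by_cases hew : e = w
    · subst hew; rw [Proc.ren_self]; exact .refl _
    · exact Cong.alpha (.call fun h' => he.1 (.inr ⟨h', hew⟩))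
  refine Tree.simulates_of_red (c := .ex y A z R (Ctx.fill L c)) h (.refl _) (v := _) ?_
    (.refl _) ((Ctx.valid_fill _ _).2 ⟨((Ctx.valid_fill _ _).1 h.of_fill.2.1).1, hv⟩) ?_ ?_ ?_
  · simp only [Frame.fill, Tree.proc, Ctx.proc_fill]
    exact .cong (.cutB (.refl _) (L.cong he3)) (Ctx.red_call hn hy he1 he2)
      (.cutB (.refl _) (L.cong hc))
  · simp only [Tree.thr, Ctx.thr_fill]; abel
  · simp only [Tree.heap, Ctx.heap_fill]; abel
  · simp only [Tree.env, Ctx.env_fill, Multiset.cons_add, Multiset.add_cons]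
    congr 1; abel

theorem Tree.Good.simulates {a : Tree} (h : a.Good) {t N : Proc} {T : Multiset Proc} {H H' E E'}
    (hs : a.state = ⟨t ::ₘ T, H, E⟩) (ht : IsAction t) (hst : ThreadStep (t, H, E) (N, H', E'))
    {σ : Tree} (hσ : Rel N σ.proc) (hv : σ.Valid) :
    a.Simulates ⟨σ.thr + T, H' + σ.heap, E' + σ.env⟩ := by
  by_cases hc : ∀ y w Q, t ≠ .call y w Q
  · exact h.simulates_of_ne_call hs ht hst hσ hv hc
  push Not at hc
  obtain ⟨y, w, Q, rfl⟩ := hc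
  cases hst with
  | neg hn => cases hn
  | @call_pos _ _ _ A z R _ _ e f hA hef he hf =>
    have h1 : e ∉ Q.fn \ {w} := fun h' => he.1 (.inr h')
    have h2 : f ∉ R.fn \ {z} := fun h' => hf.2 (.inr ⟨_, Multiset.mem_cons_self _ _, .inr h'⟩)
    have h3 : Cong (.cutPol .seq z (some A) [] w (some A.dual) R Q)
      (.cutPol .seq z (some A) [] e (some A.dual) R (Q.ren w e)) := (Rel.ren_right h1).cong
    have := h.simulates_call hs he (c := .wr e A.dual [] f (some A) σ (R.ren z f)) (.trans (.symm h3)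
      (cutPol_run_right (fun h' => (Ty.dual_pos A).1 hA h') h1 h2 hσ)) hv
    simpa only [Tree.thr, Tree.heap, Tree.env, Multiset.cons_add, add_comm σ.heap, add_comm σ.env,
      Multiset.add_cons] using this
  | @call_neg _ _ _ A z R _ _ e f hA hef he hf =>
    have h1 : f ∉ Q.fn \ {w} := fun h' => hf.1 (.inr h')
    have h2 : e ∉ R.fn \ {z} := fun h' => he.2 (.inr ⟨_, Multiset.mem_cons_self _ _, .inr h'⟩)
    have h3 : Cong (.cutPol .seq z (some A) [] w (some A.dual) R Q)
      (.cutPol .seq z (some A) [] f (some A.dual) R (Q.ren w f)) := (Rel.ren_right h1).cong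
    have hA' : A.Pos := by
      by_contra h'
      exact hA ((Ty.dual_pos A).2 h')
    have := h.simulates_call hs hf (c := .wr e A [] f (some A.dual) σ (Q.ren w f)) (.trans (.symm h3)
      (cutPol_run_left hA' h2 h1 hσ)) hv
    simpa only [Tree.thr, Tree.heap, Tree.env, Multiset.cons_add, add_comm σ.heap, add_comm σ.env,
      Multiset.add_cons] using this

/-! ### Soundness -/

theorem Rec.seqTurn_ends {x A q R y B} : (Rec.seqTurn x A q R y B).ends = {x, y} := by
  rw [Rec.seqTurn]; split_ifs
  · exact Multiset.pair_comm _ _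
  · rfl

theorem Rec.concTurn_ends {x A q y B} : (Rec.concTurn x A q y B).ends = {x, y} := by
  rw [Rec.concTurn]; split_ifs
  · exact Multiset.pair_comm _ _
  · rfl

theorem New.not_mem_binders {n : Name} {P : Proc} {H : Heap} {E : Env} (h : New n P H E) :
    n ∉ binders H E := fun h' => h.2 (mem_binders_store h')

theorem nodup_pair_add {e f : Name} {M : Multiset Name} (hef : e ≠ f) (he : e ∉ M) (hf : f ∉ M)
    (h : M.Nodup) : ({e, f} + M).Nodup := by
  refine Multiset.nodup_add.2 ⟨by simp [hef], h, Multiset.disjoint_left.2 @fun n hn => ?_⟩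
  rcases Multiset.mem_cons.1 hn with rfl | hn
  · exact he
  · exact Multiset.mem_singleton.1 hn ▸ hf

/-- Transitions keep the session names pairwise distinct. -/
theorem ThreadStep.nodup {t N : Proc} {H H' E E'} (h : ThreadStep (t, H, E) (N, H', E'))
    (hn : (binders H E).Nodup) (ht : IsAction t) : (binders H' E').Nodup := by
  have hs : ∀ {x A q R y B}, (Rec.seq x A q R y B).ends = {x, y} := rfl
  have hc : ∀ {x A q y B}, (Rec.conc x A q y B).ends = {x, y} := rfl
  cases h with
  | cut_left | cut_right | cutB => cases ht
  | parr_pos _ hef he hf | parr_neg _ hef he hf | parr_pos_c _ hef he hf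
  | parr_neg_c _ hef he hf =>
    rw [binders_cons_rec]
    refine nodup_pair_add hef ?_ ?_ ?_
    · simpa only [binders_cons_rec, Rec.seqTurn_ends, Rec.concTurn_ends, hs, hc] using
        he.not_mem_binders
    · simpa only [binders_cons_rec, Rec.seqTurn_ends, Rec.concTurn_ends, hs, hc] using
        hf.not_mem_binders
    · simpa only [binders_cons_rec, Rec.seqTurn_ends, Rec.concTurn_ends, hs, hc] using hn
  | call_pos _ hef he hf | call_neg _ hef he hf =>
    rw [binders_cons_rec]
    exact nodup_pair_add hef he.not_mem_binders hf.not_mem_binders hn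
  | fwd | fwd_c | bot | bot_c | why | why_c =>
    simp [Rec.ends] at hn ⊢
    tauto
  | _ => simpa only [binders_cons_rec, Rec.seqTurn_ends, Rec.concTurn_ends, hs, hc] using hn

theorem Unfolds.fam_leaf {f : Multiset (Proc × Tree)}
    (h : ∀ p ∈ f, p.2 = .leaf p.1) : famThr f = f.map Prod.fst ∧ famHeap f = 0 ∧ famEnv f = 0 := by
  induction f using Multiset.induction with
  | empty => simp [famThr, famHeap, famEnv]
  | cons p f ih =>
    obtain ⟨h1, h2, h3⟩ := ih fun p hp => h p (Multiset.mem_cons_of_mem hp)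
    simp [h1, h2, h3, h p (Multiset.mem_cons_self _ _), Tree.thr, Tree.heap, Tree.env]

theorem Tree.thr_isAction {a : Tree} (h : a.Valid) : ∀ t ∈ a.thr, IsAction t := by
  induction a with
  | nil => simp [Tree.thr]
  | leaf t => simpa only [Tree.thr, Multiset.mem_singleton, forall_eq] using (show IsAction t from h)
  | mix a b iha ihb | pc x A q y B a b iha ihb =>
    intro t ht
    exact (Multiset.mem_add.1 ht).elim (iha h.1 t) (ihb h.2 t)
  | rd x A q y B R a ih => exact ih h.2
  | wr x A q y B a R ih | ex x A y R a ih => exact ih h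

/-- A closed process of a tree with pairwise distinct session names is encoded by the state of the
tree. -/
theorem Tree.enc {a : Tree} (hv : a.Valid) (hc : a.proc.fn = ∅) (hn : a.bnd.Nodup) :
    Enc a.proc a.state := by
  refine a.cutStar 0 0 0 hn hv (fun n _ => ⟨by simp [hc], by simp [State.mem_names]⟩) ?_
  simp only [add_zero]
  exact .done (a.thr_isAction hv)

theorem Enc.exists_tree {P : Proc} {S : State} (h : Enc P S) (hc : P.fn = ∅) (hw : P.WL) :
    ∃ a : Tree, Rel P a.proc ∧ a.Good ∧ a.state = S := by
  obtain ⟨f, h1, h2, h3, h4, h5, h6⟩ := CutStar.unfolds h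
  obtain ⟨a, g, rfl, hg⟩ := exists_of_map_fst_eq_cons (a := P) (s := 0) h1
  obtain rfl := Multiset.map_eq_zero.1 hg
  obtain ⟨h7, h8, -⟩ := h2 _ (Multiset.mem_cons_self _ _)
  have hs := h7.sameNames
  refine ⟨a, h7, ⟨h8, hs.wl.1 hw, hs.fn ▸ hc, ?_⟩, ?_⟩
  · simpa [Tree.bnd, famHeap, famEnv] using h6.1
  · cases S
    simp_all [Tree.state, famThr, famHeap, famEnv]

/-- After a transition from an encoding only the new process can have static constructs on top;
actions unfold to themselves, so a single tree describes what is executed. -/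
theorem CutStar.exists_tree {N : Proc} {T H E C} (h : CutStar ⟨N ::ₘ T, H, E⟩ C)
    (hT : ∀ t ∈ T, IsAction t) : ∃ σ : Tree, Rel N σ.proc ∧ σ.Valid ∧
      C = ⟨σ.thr + T, H + σ.heap, E + σ.env⟩ ∧ Fresh σ.bnd ⟨N ::ₘ T, H, E⟩ := by
  obtain ⟨f, h1, h2, h3, h4, h5, h6⟩ := CutStar.unfolds h
  obtain ⟨σ, g, rfl, hg⟩ := exists_of_map_fst_eq_cons h1
  obtain ⟨h7, h8, -⟩ := h2 _ (Multiset.mem_cons_self _ _)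
  obtain ⟨e1, e2, e3⟩ := Unfolds.fam_leaf (f := g) fun p hp =>
    (h2 p (Multiset.mem_cons_of_mem hp)).2.2 (hT _ (hg ▸ Multiset.mem_map_of_mem _ hp))
  simp only [famThr_cons, famHeap_cons, famEnv_cons, e1, e2, e3, hg, add_zero] at h3 h4 h5 h6
  refine ⟨σ, h7, h8, ?_, h6⟩
  cases C
  simp_all

/-- Closedness and `WL` are all that is used of typing. -/
theorem soundness {P : Proc} (hc : P.fn = ∅) (hw : P.WL) {S D C : State} (hS : Enc P S)
    (hstep : Step S D) (hcut : CutStar D C) : ∃ Q, (Red P Q ∨ Cong P Q) ∧ Enc Q C := by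
  obtain ⟨a, hPa, ha, rfl⟩ := hS.exists_tree hc hw
  have hact := a.thr_isAction ha.valid
  generalize hs : a.state = S at hstep
  have hs' : a.thr = S.threads := congrArg State.threads hs
  rw [hs'] at hact
  cases hstep with
  -- These transitions need a thread that is not an action, and an encoding has none.
  | zero | mix | pcut_left | pcut_right =>
    have := hact _ (Multiset.mem_cons_self _ _)
    cases this
  | @run t N T H H' E E' hst =>
    have ht := hact _ (Multiset.mem_cons_self _ _)
    obtain ⟨σ, hσ, hv, rfl, hf⟩ := hcut.exists_tree fun t ht => hact t (Multiset.mem_cons_of_mem ht)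
    obtain ⟨b, hab, hbv, hb⟩ := ha.simulates hs ht hst hσ hv
    have hbf : b.proc.fn = ∅ := by
      rcases hab with h | h
      · exact Set.subset_eq_empty h.fn_subset ha.closed
      · exact h.fn_eq ▸ ha.closed
    have hn : (binders H' E').Nodup := by
      refine hst.nodup ?_ ht
      have := ha.nodup
      rwa [Tree.bnd, show a.heap = H from congrArg State.heap hs,
        show a.env = E from congrArg State.env hs] at this
    -- The transition keeps the names of the store distinct, and the names allocated while
    -- completing `D` to `C` are new for that store.
    have hbn : b.bnd.Nodup := by
      rw [Tree.bnd, show b.heap = _ from congrArg State.heap hb,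
        show b.env = _ from congrArg State.env hb, binders_add, Multiset.nodup_add,
        Multiset.disjoint_left]
      exact ⟨hn, hf.1, @fun n h1 h2 => hf.2 n h2 (.inr (mem_binders_store h1))⟩
    refine ⟨b.proc, hab.imp (fun h => .cong hPa.cong h (.refl _)) (fun h => .trans hPa.cong h), ?_⟩
    rw [← hb]
    exact b.enc hbv hbf hbn

end CLLB

theorem mainTheorem9 (P : CLLB.Proc) (hP : CLLB.Typed P 0 0) (S D C : CLLB.State)
    (hS : CLLB.Enc P S) (hstep : CLLB.Step S D) (hcut : CLLB.CutStar D C) :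
    ∃ Q : CLLB.Proc, (CLLB.Red P Q ∨ CLLB.Cong P Q) ∧ CLLB.Enc Q C := by
  obtain ⟨-, -, hfn, hw⟩ := CLLB.Typed.linear hP
  refine CLLB.soundness (Set.eq_empty_iff_forall_notMem.2 fun n hn => ?_) hw hS hstep hcut
  simpa using hfn n hn
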